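/- **Setting.** Let $M>1$, $M_c\in(1,M)$, $\tau>0$ be real numbers and $\kappa=\frac{M_c-1}{M-1}\in(0,1)$. Let $p\in C^2(\mathbb R)$, $p_{min}\ge 0$ and $c_p>0$ be such that for all $x\in\mathbb R$ $$p(x)\in(p_{min},1],\qquad 0\le p'(x)\le c_p(1-p(x)),\qquad |p''(x)|\le c_p(1-p(x)),\qquad |p''(x)|\le c_p\,p'(x).$$ Let $g_0\in H^1(\mathbb R)$, $g_0\ge 0$, satisfy $$\int_{\mathbb R}\frac{g_0}{p}\,dx=1,\qquad \int_{\mathbb R}\frac{e^{4|x|}g_0^2}{p}\,dx<\infty,\qquad \int_{\mathbb R}e^{4|x|}|\partial_xg_0|^2\,dx<\infty .$$ Let $g=g(x,t)$ be a strong solution on $\mathbb R\times(0,\infty)$ of $$\partial_tg+c(t)\,p\,\partial_xg-d(t)\,p\,\partial_{xx}^2g=0,\qquad g(\cdot,0)=g_0,$$ $$c(t)=\frac{(M-1)(\kappa-\alpha(t))}{\sqrt\tau},\quad d(t)=\frac{(M-1)^2}{2}\Big((\kappa-\alpha(t))^2+\frac{\alpha(t)(1-\alpha(t))}{M-1}\Big),\quad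 \alpha(t)=\int_{\mathbb R} g(x,t)\,dx .$$ This means that $g\in C([0,\infty);L^2(\mathbb R))$, that $\partial_tg,\partial_xg,\partial^2_{xx}g$ exist as weak derivatives on $\mathbb R\times(0,\infty)$, that the equation holds almost everywhere, and that for every $T>0$ $$\frac{e^{2|x|}g}{\sqrt p},\ e^{2|x|}\partial_xg\in L^\infty((0,T);L^2(\mathbb R)),\qquad \frac{e^{2|x|}\partial_tg}{\sqrt p},\ e^{2|x|}\sqrt p\,\partial^2_{xx}g\in L^2((0,T);L^2(\mathbb R)).$$ Put $f(x,t)=g(x,t)/p(x)$ and $a(t)=\int_{\mathbb R}(\kappa-p(x))f(x,t)\,dx$. **Theorem.** There is a numerical constant $C_0>1$, independent of all the data above, such that the following holds in this setting, with $\hat c_p=2C_0(1+c_p)$. For every $t\ge0$, $f(\cdot,t)\ge 0$ almost everywhere, $\int_{\mathbb R}f(x,t)\,dx=1$, and $p^{7/4}(1-p)^{1/4}f^{7/4}(\cdot,t)$ is integrable. (i) (Sorting.) As $t\to\infty$, $$\int_{\mathbb R}p(x)^{7/4}(1-p(x))^{1/4}f^{7/4}(x,t)\,dx\to0,\qquad\text{and}\qquad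 \int_{-R}^Rf(x,t)\,dx\to0\ \text{ for every }R>0 .$$ (ii) (Aggregate learning.) Suppose in addition that $p_{min}>0$, that $p$ takes values both smaller and larger than $\kappa$, i.e. $\inf p<\kappa<\sup p$, and that $\hat c_p\sqrt\tau\,(M-1)<p_{min}^4$. Then $$\limsup_{t\to\infty}|a(t)|\le\frac{\hat c_p}{p_{min}^4}\sqrt\tau .$$ Moreover $\kappa\in\big(\frac{M_c-1}{M},\frac{M_c}{M}\big)$, and if $\tau$ is so small that both numbers $\kappa\pm\frac{\hat c_p}{p_{min}^4}\sqrt\tau$ lie in $\big(\frac{M_c-1}{M},\frac{M_c}{M}\big)$, then $$\liminf_{t\to\infty}\int_{\mathbb R} p(x)f(x,t)\,dx\ge\frac{M_c-1}{M},\qquad \limsup_{t\to\infty}\int_{\mathbb R} p(x)f(x,t)\,dx\le\frac{M_c}{M},$$ and $\int_{\mathbb R} p(x)f(x,t)\,dx\in\big(\frac{M_c-1}{M},\frac{M_c}{M}\big)$ for all sufficiently large $t$. -/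

import Mathlib

open Filter Topology MeasureTheory Set
open scoped ContDiff

noncomputable section

namespace MarketEntry

/-- `v` is the weak (distributional) derivative of `u` in the direction `e` on the open set `U`. -/
def HasWeakDerivOn {E : Type*} [NormedAddCommGroup E] [NormedSpace ℝ E] [MeasureSpace E]
    (U : Set E) (e : E) (u v : E → ℝ) : Prop :=
  LocallyIntegrableOn u U ∧ LocallyIntegrableOn v U ∧
    ∀ φ : E → ℝ, ContDiff ℝ ∞ φ → HasCompactSupport φ → tsupport φ ⊆ U →
      ∫ z, u z * fderiv ℝ φ z e = - ∫ z, v z * φ z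

/-- The space-time half plane `{(x, t) : t > 0}`. -/
def halfPlane : Set (ℝ × ℝ) := univ ×ˢ Ioi 0

/-- The space-time strip `ℝ × (0, T)`. -/
def strip (T : ℝ) : Set (ℝ × ℝ) := univ ×ˢ Ioo 0 T

/-- `u ∈ L^∞((0, T); L²(ℝ))`, for a function `u = u(x, t)`. -/
def MemLinftyL2 (T : ℝ) (u : ℝ → ℝ → ℝ) : Prop :=
  AEStronglyMeasurable (fun z : ℝ × ℝ => u z.1 z.2) (volume.restrict (strip T)) ∧
    ∃ C : ℝ, ∀ᵐ t ∂(volume.restrict (Ioo 0 T)),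
      eLpNorm (fun x => u x t) 2 volume ≤ ENNReal.ofReal C

/-- `u ∈ L²((0, T); L²(ℝ))`, for a function `u = u(x, t)`. -/
def MemL2L2 (T : ℝ) (u : ℝ → ℝ → ℝ) : Prop :=
  MemLp (fun z : ℝ × ℝ => u z.1 z.2) 2 (volume.restrict (strip T))

/-- `u ∈ C([0, ∞); L²(ℝ))`, for a function `u = u(x, t)`. -/
def ContinuousInL2 (u : ℝ → ℝ → ℝ) : Prop :=
  (∀ t, 0 ≤ t → MemLp (fun x => u x t) 2 volume) ∧
    ∀ t₀, 0 ≤ t₀ →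
      Tendsto (fun t => eLpNorm (fun x => u x t - u x t₀) 2 volume) (𝓝[Ici 0] t₀) (𝓝 0)

/-- The conditions on the probability function `p`, with lower bound `pmin` and constant `cp`. -/
structure IsEntryProbability (p : ℝ → ℝ) (pmin cp : ℝ) : Prop where
  pmin_nonneg : 0 ≤ pmin
  cp_pos : 0 < cp
  contDiff : ContDiff ℝ 2 p
  mem_Ioc : ∀ x, p x ∈ Ioc pmin 1
  deriv_nonneg : ∀ x, 0 ≤ deriv p x
  deriv_le : ∀ x, deriv p x ≤ cp * (1 - p x)
  abs_deriv2_le : ∀ x, |deriv (deriv p) x| ≤ cp * (1 - p x)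

/-- The conditions on the initial datum: `g₀ ∈ H¹(ℝ)`, `g₀ ≥ 0`, `∫ g₀ / p = 1`, with
exponentially weighted square integrability of `g₀ / √p` and of `∂ₓ g₀`. -/
structure IsInitialDatum (p g₀ : ℝ → ℝ) : Prop where
  memLp : MemLp g₀ 2 volume
  nonneg : ∀ᵐ x, 0 ≤ g₀ x
  mass : ∫ x, g₀ x / p x = 1
  weighted : Integrable fun x => Real.exp (4 * |x|) * g₀ x ^ 2 / p x
  weakDeriv : ∃ g₀' : ℝ → ℝ, HasWeakDerivOn univ 1 g₀ g₀' ∧ MemLp g₀' 2 volume ∧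
    Integrable fun x => Real.exp (4 * |x|) * g₀' x ^ 2

/-- `κ = (M_c - 1) / (M - 1)`. -/
def kappa (M Mc : ℝ) : ℝ := (Mc - 1) / (M - 1)

/-- `α(t) = ∫ g(x, t) dx`. -/
def alpha (g : ℝ → ℝ → ℝ) (t : ℝ) : ℝ := ∫ x, g x t

/-- The transport coefficient `c(t) = (M - 1) a(t) / √τ`, with `a(t) = κ - α(t)`. -/
def coeffC (M Mc τ : ℝ) (g : ℝ → ℝ → ℝ) (t : ℝ) : ℝ :=
  (M - 1) * (kappa M Mc - alpha g t) / Real.sqrt τ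

/-- The diffusion coefficient `d(t) = (M - 1)² / 2 * (a(t)² + b(t) / (M - 1))`, with
`a(t) = κ - α(t)` and `b(t) = α(t) (1 - α(t))`. -/
def coeffD (M Mc : ℝ) (g : ℝ → ℝ → ℝ) (t : ℝ) : ℝ :=
  (M - 1) ^ 2 / 2 *
    ((kappa M Mc - alpha g t) ^ 2 + 1 / (M - 1) * (alpha g t * (1 - alpha g t)))

/-- `g = g(x, t)` is a strong solution, on `ℝ × (0, ∞)`, of
`∂ₜ g + c(t) p ∂ₓ g - d(t) p ∂ₓₓ g = 0`, `g(·, 0) = g₀`.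
As `0 < p ≤ 1`, the weighted bounds contain `g ∈ L^∞((0, T); H¹(ℝ))`, and, when `p` is bounded
below by a positive constant, also `g ∈ L²((0, T); H²(ℝ))`. Neither `g ≥ 0` nor `∫ g / p = 1`
is imposed for positive times. -/
def IsStrongSolution (M Mc τ : ℝ) (p g₀ : ℝ → ℝ) (g : ℝ → ℝ → ℝ) : Prop :=
  ContinuousInL2 g ∧ (∀ᵐ x, g x 0 = g₀ x) ∧
  ∃ gt gx gxx : ℝ → ℝ → ℝ,
    HasWeakDerivOn halfPlane (0, 1) (fun z => g z.1 z.2) (fun z => gt z.1 z.2) ∧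
    HasWeakDerivOn halfPlane (1, 0) (fun z => g z.1 z.2) (fun z => gx z.1 z.2) ∧
    HasWeakDerivOn halfPlane (1, 0) (fun z => gx z.1 z.2) (fun z => gxx z.1 z.2) ∧
    (∀ T : ℝ, 0 < T →
      MemLinftyL2 T (fun x t => Real.exp (2 * |x|) * g x t / Real.sqrt (p x)) ∧
      MemLinftyL2 T (fun x t => Real.exp (2 * |x|) * gx x t) ∧
      MemL2L2 T (fun x t => Real.exp (2 * |x|) * gt x t / Real.sqrt (p x)) ∧
      MemL2L2 T (fun x t => Real.exp (2 * |x|) * Real.sqrt (p x) * gxx x t)) ∧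
    ∀ᵐ z ∂((volume : Measure (ℝ × ℝ)).restrict halfPlane),
      gt z.1 z.2 + coeffC M Mc τ g z.2 * p z.1 * gx z.1 z.2
        - coeffD M Mc g z.2 * p z.1 * gxx z.1 z.2 = 0

/-- The mean entry proportion `∫ p f(·, t) dx`. -/
def meanEntry (p : ℝ → ℝ) (f : ℝ → ℝ → ℝ) (t : ℝ) : ℝ := ∫ x, p x * f x t

/-- `a(t) = ∫ (κ - p) f(·, t) dx`. -/
def deviation (M Mc : ℝ) (p : ℝ → ℝ) (f : ℝ → ℝ → ℝ) (t : ℝ) : ℝ :=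
  ∫ x, (kappa M Mc - p x) * f x t

/-- The integrand `p^{7/4} (1 - p)^{1/4} f^{7/4}`. -/
def sortingDensity (p : ℝ → ℝ) (f : ℝ → ℝ → ℝ) (t x : ℝ) : ℝ :=
  p x ^ (7 / 4 : ℝ) * (1 - p x) ^ (1 / 4 : ℝ) * f x t ^ (7 / 4 : ℝ)

/-- Sorting: the mass of `f(·, t)` leaves every bounded interval as `t → ∞`. -/
def IsSorting (f : ℝ → ℝ → ℝ) : Prop :=
  ∀ R : ℝ, 0 < R → Tendsto (fun t => ∫ x in (-R)..R, f x t) atTop (𝓝 0)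

/-- Aggregate learning: asymptotically the mean entry proportion is in
`[(M_c - 1) / M, M_c / M]`. The limits are taken in the extended reals. -/
def IsAggregateLearning (M Mc : ℝ) (p : ℝ → ℝ) (f : ℝ → ℝ → ℝ) : Prop :=
  (((Mc - 1) / M : ℝ) : EReal) ≤ liminf (fun t => (meanEntry p f t : EReal)) atTop ∧
    limsup (fun t => (meanEntry p f t : EReal)) atTop ≤ ((Mc / M : ℝ) : EReal)

/-- `ĉ_p = 2 C₀ (1 + c_p)`. -/
def cHat (C₀ cp : ℝ) : ℝ := 2 * C₀ * (1 + cp)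

/-- The bound `(ĉ_p / p_min⁴) √τ`. -/
def learningBound (C₀ cp pmin τ : ℝ) : ℝ := cHat C₀ cp / pmin ^ 4 * Real.sqrt τ

end MarketEntry

end

open MarketEntry

noncomputable section

namespace MarketEntry

/-! Divided by `p`, the equation reads `∂ₜ(g/p) = d gₓₓ - c gₓ`, and the right side has coefficients
depending on time only. Integration by parts in `x` then gives two families of identities. Pairing
with `φ'(g)` kills the transport: `d/dt ∫ φ(g)/p = -d ∫ φ''(g) gₓ²` (`entropy_pairing`). Pairing
with a function `ψ(x)` gives `d/dt ∫ ψ g/p = d ∫ ψ'' g + c ∫ ψ' g` (`pairing_sub`). Both are used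
integrated in time. To justify them for a strong solution, `exists_regular` replaces `g` by a
jointly measurable representative given in time as a primitive, with `C¹` slices having absolutely
continuous derivative for almost every time; the exponential weights make all pairings integrable.

If `d ≥ 0`, convex entropies do not increase. Cubes of negative and truncated positive parts give
positivity and the maximum principle, and spatial cutoffs give `∫ g/p = 1` (`mass`), hence `α = ∫ g
∈ [0, 1]`. Conversely `d` is a function of `α` that is strictly positive on `[0, 1]`, so the circle
is closed by continuation in time (`density`), and compactness gives `d ≥ δ > 0` for all times.

Sorting: the square entropy has finite total dissipation, so `∫ gₓ²` is small at some time. Since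
`g² ≤ 2 ∫ |g gₓ|`, the supremum of `g` is small then, and by the maximum principle ever after
(`eventually_le`). So `g → 0` uniformly. The sorting integrand is at most `g^{7/4}` and `∫ g ≤ 1`;
on `[-R, R]` the monotone `p` is at least `p(-R) > 0`, so `f` tends to zero uniformly there.

Learning: let `a = κ - α` and `B = √τ (1 + c_p)`. Testing with `ψ = p` and using `|p''| ≤ c_p p'`,
the drift beats the diffusion whenever `|a| > B`, so `|a|` cannot grow there (`deviation_antitone`).
Moreover `|a| ≤ B` must occur (`exists_abs_deviation_le`): otherwise `a` keeps its sign, an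
exponential moment of `f` tends to zero, and the mass runs to the end of the line where `p` is on
the far side of `κ`, which forces `a` to change sign. Hence `|a| ≤ B` eventually, which is stronger
than the claim with `C₀ = 2`. -/

/-! ### Absolutely continuous functions on the line -/

/-- `F` is absolutely continuous on `[a, b]`, with derivative `F'` almost everywhere. -/
structure HasACDeriv (F F' : ℝ → ℝ) (a b : ℝ) : Prop where
  ac : AbsolutelyContinuousOnInterval F a b
  ae_deriv : ∀ᵐ x, x ∈ uIcc a b → HasDerivAt F (F' x) x

namespace HasACDeriv

variable {F F' G G' : ℝ → ℝ} {a b : ℝ}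

theorem integral_eq (h : HasACDeriv F F' a b) : ∫ x in a..b, F' x = F b - F a := by
  rw [← h.ac.integral_deriv_eq_sub]
  apply intervalIntegral.integral_congr_ae
  filter_upwards [h.ae_deriv] with x hx hx'
  exact (hx (uIoc_subset_uIcc hx')).deriv.symm

theorem mul (hF : HasACDeriv F F' a b) (hG : HasACDeriv G G' a b) :
    HasACDeriv (fun x => F x * G x) (fun x => F' x * G x + F x * G' x) a b := by
  refine ⟨hF.ac.fun_mul hG.ac, ?_⟩
  filter_upwards [hF.ae_deriv, hG.ae_deriv] with x h1 h2 hx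
  exact (h1 hx).mul (h2 hx)

theorem sub (hF : HasACDeriv F F' a b) (hG : HasACDeriv G G' a b) :
    HasACDeriv (fun x => F x - G x) (fun x => F' x - G' x) a b := by
  refine ⟨hF.ac.sub hG.ac, ?_⟩
  filter_upwards [hF.ae_deriv, hG.ae_deriv] with x h1 h2 hx
  exact (h1 hx).sub (h2 hx)

theorem of_hasDerivAt (hF : ∀ x, HasDerivAt F (F' x) x) (hc : Continuous F') (a b : ℝ) :
    HasACDeriv F F' a b := by
  have h1 : ContDiff ℝ 1 F := by
    rw [contDiff_one_iff_deriv]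
    refine ⟨fun x => (hF x).differentiableAt, ?_⟩
    rwa [show deriv F = F' from funext fun x => (hF x).deriv]
  exact ⟨h1.contDiffOn.absolutelyContinuousOnInterval, Eventually.of_forall fun x _ => hF x⟩

theorem of_primitive {c k : ℝ} (hi : ∀ a b : ℝ, IntervalIntegrable F' volume a b)
    (hF : ∀ x, F x = k + ∫ s in c..x, F' s) (a b : ℝ) : HasACDeriv F F' a b := by
  have e : F = fun x => (k + ∫ s in c..a, F' s) - (-∫ s in a..x, F' s) := by
    funext x
    rw [hF, ← intervalIntegral.integral_add_adjacent_intervals (hi c a) (hi a x)]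
    ring
  refine ⟨?_, ?_⟩
  · rw [e]
    refine AbsolutelyContinuousOnInterval.sub ?_
      ((hi a b).absolutelyContinuousOnInterval_intervalIntegral (by simp)).neg
    exact (contDiff_const (n := 1)).contDiffOn.absolutelyContinuousOnInterval
  · filter_upwards [(hi a b).ae_hasDerivAt_integral] with x hx hx'
    rw [e]
    simpa using (hx hx' a (by simp)).const_add (k + ∫ s in c..a, F' s)

/-- `F` is bounded on the interval and `φ` is `C¹`, so `φ` is Lipschitz on the range of `F`, and a
Lipschitz function preserves absolute continuity. -/
theorem comp {φ φ' : ℝ → ℝ} (hφ : ∀ s, HasDerivAt φ (φ' s) s) (hc : Continuous φ')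
    (hF : HasACDeriv F F' a b) :
    HasACDeriv (fun x => φ (F x)) (fun x => φ' (F x) * F' x) a b := by
  refine ⟨?_, ?_⟩
  · obtain ⟨C, hC⟩ := hF.ac.exists_bound
    obtain ⟨D, hD⟩ := (isCompact_Icc (a := -C) (b := C)).exists_bound_of_continuousOn
      hc.continuousOn
    have key : ∀ x ∈ uIcc a b, ∀ y ∈ uIcc a b, dist (φ (F x)) (φ (F y)) ≤
        D * dist (F x) (F y) := by
      intro x hx y hy
      rw [dist_eq_norm, dist_eq_norm]
      refine (convex_Icc (-C) C).norm_image_sub_le_of_norm_hasDerivWithin_le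
        (fun s _ => (hφ s).hasDerivWithinAt) (fun s hs => hD s hs) ?_ ?_
      · exact abs_le.1 (by simpa using hC y hy)
      · exact abs_le.1 (by simpa using hC x hx)
    have h0 := Tendsto.const_mul D hF.ac
    rw [mul_zero] at h0
    refine squeeze_zero' (Eventually.of_forall fun E => Finset.sum_nonneg fun _ _ => dist_nonneg)
      ?_ h0
    refine eventually_inf_principal.2 (Eventually.of_forall fun E hE => ?_)
    rw [Finset.mul_sum]
    refine Finset.sum_le_sum fun i hi => key _ ?_ _ ?_
    · exact (hE.1 i hi).1
    · exact (hE.1 i hi).2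
  · filter_upwards [hF.ae_deriv] with x hx hx'
    exact (hφ (F x)).comp x (hx hx')

/-- Integrability of `F'` gives `F` limits at both ends, and integrability of `F` forces both to be
zero. This replaces boundary terms in every integration by parts below. -/
theorem integral_eq_zero (h : ∀ a b, HasACDeriv F F' a b) (hF : Integrable F)
    (hF' : Integrable F') : ∫ x, F' x = 0 := by
  have key : ∀ x, F x = F 0 + ∫ s in (0 : ℝ)..x, F' s := fun x => by
    rw [(h 0 x).integral_eq]; ring
  have h1 : Tendsto F atTop (𝓝 (F 0 + ∫ s in Ioi 0, F' s)) := by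
    have := (intervalIntegral_tendsto_integral_Ioi (0 : ℝ) hF'.integrableOn tendsto_id).const_add
      (F 0)
    exact this.congr fun x => (key x).symm
  have h2 : Tendsto F atBot (𝓝 (F 0 - ∫ s in Iic 0, F' s)) := by
    have := (intervalIntegral_tendsto_integral_Iic (0 : ℝ) hF'.integrableOn tendsto_id).const_sub
      (F 0)
    refine this.congr fun x => ?_
    rw [key x, intervalIntegral.integral_symm]
    simp
  have e1 := IntegrableAtFilter.eq_zero_of_tendsto (hF.integrableAtFilter atTop)
    (fun s hs => by
      obtain ⟨c, hc⟩ := mem_atTop_sets.1 hs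
      exact measure_mono_top (s₁ := Ici c) (fun x hx => hc x hx) (by simp)) h1
  have e2 := IntegrableAtFilter.eq_zero_of_tendsto (hF.integrableAtFilter atBot)
    (fun s hs => by
      obtain ⟨c, hc⟩ := mem_atBot_sets.1 hs
      exact measure_mono_top (s₁ := Iic c) (fun x hx => hc x hx) (by simp)) h2
  rw [← intervalIntegral.integral_Iic_add_Ioi (b := 0) hF'.integrableOn hF'.integrableOn]
  linarith

end HasACDeriv

/-! ### Weak derivatives and increments along a direction -/

section Shift

variable {E : Type*} [NormedAddCommGroup E] [NormedSpace ℝ E]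

theorem HasWeakDerivOn.congr [MeasureSpace E] {U : Set E} (hU : MeasurableSet U) {e : E}
    {u v u' v' : E → ℝ}
    (h : HasWeakDerivOn U e u v) (hu : u =ᵐ[volume.restrict U] u')
    (hv : v =ᵐ[volume.restrict U] v') : HasWeakDerivOn U e u' v' := by
  have loc : ∀ {a b : E → ℝ}, LocallyIntegrableOn a U → a =ᵐ[volume.restrict U] b →
      LocallyIntegrableOn b U := by
    intro a b ha hab x hx
    obtain ⟨s, hs, hi⟩ := ha x hx
    refine ⟨s ∩ U, inter_mem hs self_mem_nhdsWithin, ?_⟩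
    refine (hi.mono_set inter_subset_left).congr_fun_ae ?_
    exact ae_restrict_of_ae_restrict_of_subset inter_subset_right hab
  rw [Filter.EventuallyEq, ae_restrict_iff' hU] at *
  refine ⟨loc h.1 ((ae_restrict_iff' hU).2 hu), loc h.2.1 ((ae_restrict_iff' hU).2 hv),
    fun φ h1 h2 h3 => ?_⟩
  have e1 : ∫ z, u z * fderiv ℝ φ z e = ∫ z, u' z * fderiv ℝ φ z e := by
    refine integral_congr_ae (hu.mono fun z hz => ?_)
    by_cases hzU : z ∈ U
    · simp [hz hzU]
    · have : fderiv ℝ φ z = 0 := by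
        by_contra hne
        exact hzU (h3 (support_fderiv_subset ℝ hne))
      simp [this]
  have e2 : ∫ z, v z * φ z = ∫ z, v' z * φ z := by
    refine integral_congr_ae (hv.mono fun z hz => ?_)
    by_cases hzU : z ∈ U
    · simp [hz hzU]
    · simp [image_eq_zero_of_notMem_tsupport fun hz' => hzU (h3 hz')]
  rw [← e1, ← e2]
  exact h.2.2 φ h1 h2 h3

/-- The average of a function over a segment of translates. -/
def segmentSum (φ : E → ℝ) (e : E) (h : ℝ) (z : E) : ℝ := ∫ s in (0 : ℝ)..h, φ (z - s • e)

/-- The compact set swept out by translating `K` along a segment. -/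
def sweep (K : Set E) (e : E) (h : ℝ) : Set E := (fun q : E × ℝ => q.1 + q.2 • e) '' (K ×ˢ uIcc 0 h)

theorem isCompact_sweep {K : Set E} (hK : IsCompact K) (e : E) (h : ℝ) :
    IsCompact (sweep K e h) :=
  (hK.prod isCompact_uIcc).image (by fun_prop)

variable [FiniteDimensional ℝ E] [MeasureSpace E] [BorelSpace E]

/-- Up to the sign coming from the orientation of `[0, h]`, this is the convolution of `φ` with the
image of Lebesgue measure on a segment, a finite measure. -/
theorem contDiff_segmentSum {φ : E → ℝ} (hφ : ContDiff ℝ ∞ φ) (hc : HasCompactSupport φ) (e : E)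
    (h : ℝ) : ContDiff ℝ ∞ (segmentSum φ e h) := by
  let ν : Measure E := (volume.restrict (uIoc 0 h)).map (fun s : ℝ => s • e)
  have hm : Measurable (fun s : ℝ => s • e) := by fun_prop
  have : IsFiniteMeasure (volume.restrict (uIoc 0 h)) := by
    rw [uIoc]; infer_instance
  have : IsFiniteMeasure ν := inferInstance
  have h1 : ContDiff ℝ ∞ (convolution (fun _ : E => (1 : ℝ)) φ (ContinuousLinearMap.mul ℝ ℝ) ν) :=
    hc.contDiff_convolution_right (n := ⊤) _ (locallyIntegrable_const 1) hφ
  have e1 : segmentSum φ e h = fun z => (if 0 ≤ h then (1 : ℝ) else -1) *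
      convolution (fun _ : E => (1 : ℝ)) φ (ContinuousLinearMap.mul ℝ ℝ) ν z := by
    funext z
    rw [segmentSum, intervalIntegral.intervalIntegral_eq_integral_uIoc, convolution,
      integral_map hm.aemeasurable]
    · simp
    · have := hφ.continuous
      simp only [ContinuousLinearMap.mul_apply', one_mul]
      exact (this.comp (continuous_const.sub continuous_id)).aestronglyMeasurable
  rw [e1]
  exact contDiff_const.mul h1

/-- Along the line `z + r e` the segment integral is the integral of `φ` over the sliding window `[r
- h, r]`, so the fundamental theorem of calculus leaves the two end values. -/
theorem fderiv_segmentSum {φ : E → ℝ} (hφ : ContDiff ℝ ∞ φ) (hc : HasCompactSupport φ) (e : E)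
    (h : ℝ) (z : E) : fderiv ℝ (segmentSum φ e h) z e = φ z - φ (z - h • e) := by
  have hd := ((contDiff_segmentSum hφ hc e h).differentiable (by simp) z).hasFDerivAt
  have hl : HasDerivAt (fun r : ℝ => z + r • e) e 0 := by
    simpa using ((hasDerivAt_id (0 : ℝ)).smul_const e).const_add z
  have h1 : HasDerivAt (fun r : ℝ => segmentSum φ e h (z + r • e))
      (fderiv ℝ (segmentSum φ e h) z e) 0 := by
    have := HasFDerivAt.comp_hasDerivAt (f := fun r : ℝ => z + r • e) 0 (by simpa using hd) hl
    exact this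
  have hcont : Continuous fun s : ℝ => φ (z - s • e) :=
    hφ.continuous.comp (by fun_prop)
  have hcont' : Continuous fun s : ℝ => φ (z + s • e) :=
    hφ.continuous.comp (by fun_prop)
  have e2 : (fun r : ℝ => segmentSum φ e h (z + r • e)) =
      fun r => ∫ s in (r - h)..r, φ (z + s • e) := by
    funext r
    have := intervalIntegral.integral_comp_sub_left (a := 0) (b := h) (fun s => φ (z + s • e)) r
    simp only [sub_zero] at this
    rw [← this, segmentSum]
    congr 1; funext s; congr 1; module
  rw [e2] at h1
  have h2 : HasDerivAt (fun r => ∫ s in (r - h)..r, φ (z + s • e))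
      (φ z - φ (z - h • e)) 0 := by
    have e3 : (fun r => ∫ s in (r - h)..r, φ (z + s • e)) =
        fun r => (∫ s in (0 : ℝ)..r, φ (z + s • e)) - ∫ s in (0 : ℝ)..(r - h), φ (z + s • e) := by
      funext r
      rw [intervalIntegral.integral_interval_sub_left] <;> exact hcont'.intervalIntegrable _ _
    rw [e3]
    have a1 := intervalIntegral.integral_hasDerivAt_right (hcont'.intervalIntegrable 0 0)
      hcont'.stronglyMeasurable.stronglyMeasurableAtFilter hcont'.continuousAt
    have a2 := intervalIntegral.integral_hasDerivAt_right (hcont'.intervalIntegrable 0 (0 - h))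
      hcont'.stronglyMeasurable.stronglyMeasurableAtFilter hcont'.continuousAt
    have a3 := a2.comp_sub_const (0 : ℝ) h
    convert! a1.sub a3 using 1
    simp [sub_eq_add_neg]
  exact h1.unique h2

variable [(volume : Measure E).IsAddHaarMeasure]

theorem integrable_shift {K : Set E} (hK : IsCompact K) {v : E → ℝ} (hv : Measurable v) {e : E}
    {h : ℝ} (hi : IntegrableOn v (sweep K e h)) :
    Integrable (fun q : ℝ × E => v (q.2 + q.1 • e))
      ((volume.restrict (uIoc 0 h)).prod (volume.restrict K)) := by
  have hm : Measurable fun q : ℝ × E => v (q.2 + q.1 • e) := by fun_prop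
  have : IsFiniteMeasure (volume.restrict (uIoc 0 h)) := by rw [uIoc]; infer_instance
  refine ⟨hm.aestronglyMeasurable, ?_⟩
  rw [HasFiniteIntegral, lintegral_prod _ hm.enorm.aemeasurable]
  have bd : ∀ s ∈ uIoc 0 h, ∫⁻ z in K, ‖v (z + s • e)‖ₑ ≤ ∫⁻ z in sweep K e h, ‖v z‖ₑ := by
    intro s hs
    calc ∫⁻ z in K, ‖v (z + s • e)‖ₑ
        ≤ ∫⁻ z in (fun z => z + s • e) ⁻¹' (sweep K e h), ‖v (z + s • e)‖ₑ := by
          refine lintegral_mono_set fun z hz => ?_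
          exact ⟨(z, s), ⟨hz, uIoc_subset_uIcc hs⟩, rfl⟩
      _ = ∫⁻ z in sweep K e h, ‖v z‖ₑ :=
          (measurePreserving_add_right volume (s • e)).setLIntegral_comp_preimage
            (isCompact_sweep hK e h).measurableSet hv.enorm
  calc ∫⁻ s in uIoc 0 h, ∫⁻ z in K, ‖v (z + s • e)‖ₑ
      ≤ ∫⁻ s in uIoc 0 h, ∫⁻ z in sweep K e h, ‖v z‖ₑ :=
        setLIntegral_mono measurable_const bd
    _ < ⊤ := by
        rw [lintegral_const]
        exact ENNReal.mul_lt_top hi.2 (measure_lt_top _ _)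

/-- Test the weak derivative with `segmentSum φ e h`: its derivative along `e` is a difference of
translates of `φ`. Translating back and applying Fubini shows that the defect in the increment
formula integrates to zero against every `φ`, so it vanishes almost everywhere. -/
theorem HasWeakDerivOn.ae_shift {U : Set E} (hU : IsOpen U) {e : E} {u v : E → ℝ}
    (hw : HasWeakDerivOn U e u v) (hv : Measurable v) {h : ℝ}
    (hinv : ∀ s ∈ uIcc 0 h, ∀ z ∈ U, z + s • e ∈ U) :
    ∀ᵐ z, z ∈ U → u (z + h • e) - u z = ∫ s in (0 : ℝ)..h, v (z + s • e) := by
  have sweep_sub : ∀ {K : Set E}, K ⊆ U → sweep K e h ⊆ U := by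
    rintro K hK _ ⟨⟨z, s⟩, ⟨hz, hs⟩, rfl⟩
    exact hinv s hs z (hK hz)
  have hh : h ∈ uIcc 0 h := right_mem_uIcc
  have intK : ∀ {w : E → ℝ}, LocallyIntegrableOn w U → ∀ {K : Set E}, IsCompact K → K ⊆ U →
      IntegrableOn w (sweep K e h) := fun hw _ hK hKU =>
    hw.integrableOn_compact_subset (sweep_sub hKU) (isCompact_sweep hK e h)
  have intV : ∀ {K : Set E}, IsCompact K → K ⊆ U →
      IntegrableOn (fun z => ∫ s in (0 : ℝ)..h, v (z + s • e)) K := by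
    intro K hK hKU
    simp only [intervalIntegral.intervalIntegral_eq_integral_uIoc]
    exact Integrable.smul (if (0 : ℝ) ≤ h then (1 : ℝ) else -1)
      (integrable_shift hK hv (intK hw.2.1 hK hKU)).integral_prod_right
  have intu : ∀ {K : Set E}, IsCompact K → K ⊆ U → IntegrableOn (fun z => u (z + h • e)) K := by
    intro K hK hKU
    have := (measurePreserving_add_right volume (h • e)).integrableOn_comp_preimage
      (measurableEmbedding_addRight (h • e)) |>.2 (intK hw.1 hK hKU)
    exact this.mono_set fun z hz => ⟨(z, h), ⟨hz, hh⟩, rfl⟩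
  have intu0 : ∀ {K : Set E}, IsCompact K → K ⊆ U → IntegrableOn u K := fun hK hKU =>
    hw.1.integrableOn_compact_subset hKU hK
  have main := hU.ae_eq_zero_of_integral_contDiff_smul_eq_zero (μ := volume)
    (f := fun z => u (z + h • e) - u z - ∫ s in (0 : ℝ)..h, v (z + s • e)) ?_ ?_
  · filter_upwards [main] with z hz hzU
    exact sub_eq_zero.1 (hz hzU)
  · rw [locallyIntegrableOn_iff hU.isLocallyClosed]
    exact fun K hKU hK => ((intu hK hKU).sub (intu0 hK hKU)).sub (intV hK hKU)
  · intro φ h1 h2 h3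
    set K := tsupport φ with hKdef
    have hK : IsCompact K := h2
    have hφ0 : ∀ z, z ∉ K → φ z = 0 := fun z hz => image_eq_zero_of_notMem_tsupport hz
    obtain ⟨C, hC⟩ := h1.continuous.bounded_above_of_compact_support h2
    have mulK : ∀ {w : E → ℝ}, IntegrableOn w K → Integrable fun z => φ z * w z := by
      intro w hw
      have : IntegrableOn (fun z => φ z * w z) K :=
        hw.bdd_mul h1.continuous.aestronglyMeasurable (Eventually.of_forall hC)
      refine (integrableOn_iff_integrable_of_support_subset fun z hz => ?_).1 this
      by_contra hzK
      exact hz (by simp [hφ0 z hzK])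
    have suppΦ : Function.support (segmentSum φ e h) ⊆ sweep K e h := by
      intro z hz
      by_contra hzK
      refine hz ?_
      rw [segmentSum]
      have : ∀ s ∈ uIcc 0 h, φ (z - s • e) = 0 := fun s hs => hφ0 _ fun hm =>
        hzK ⟨(z - s • e, s), ⟨hm, hs⟩, by simp⟩
      rw [intervalIntegral.integral_congr (g := fun _ => 0) this]
      simp
    have tsuppΦ : tsupport (segmentSum φ e h) ⊆ sweep K e h :=
      closure_minimal suppΦ (isCompact_sweep hK e h).isClosed
    have hΦ := hw.2.2 (segmentSum φ e h) (contDiff_segmentSum h1 h2 e h)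
      (HasCompactSupport.of_support_subset_isCompact (isCompact_sweep hK e h) suppΦ)
      (tsuppΦ.trans (sweep_sub h3))
    simp only [fderiv_segmentSum h1 h2] at hΦ
    have i1 := mulK (intu hK h3)
    have i2 := mulK (intu0 hK h3)
    have i3 := mulK (intV hK h3)
    have trans_u : ∫ z, φ z * u (z + h • e) = ∫ z, u z * φ (z - h • e) := by
      rw [← integral_add_right_eq_self (fun z => u z * φ (z - h • e)) (h • e)]
      simp [mul_comm]
    have i1' : Integrable fun z => u z * φ (z - h • e) := by
      have := i1.comp_sub_right (h • e)
      simpa [mul_comm] using this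
    have fub : ∫ z, φ z * ∫ s in (0 : ℝ)..h, v (z + s • e) = ∫ z, v z * segmentSum φ e h z := by
      have : IsFiniteMeasure (volume.restrict (uIoc 0 h)) := by rw [uIoc]; infer_instance
      set S := sweep K e h
      have hS : ∀ s ∈ uIoc 0 h, ∀ z, z ∉ S → φ (z - s • e) = 0 := fun s hs z hz => hφ0 _ fun hm =>
        hz ⟨(z - s • e, s), ⟨hm, uIoc_subset_uIcc hs⟩, by simp⟩
      have e1 : ∫ z, φ z * ∫ s in uIoc 0 h, v (z + s • e) =
          ∫ s in uIoc 0 h, ∫ z, φ z * v (z + s • e) := by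
        have a1 : ∫ z, φ z * ∫ s in uIoc 0 h, v (z + s • e) =
            ∫ z in K, ∫ s in uIoc 0 h, φ z * v (z + s • e) := by
          rw [← setIntegral_eq_integral_of_forall_compl_eq_zero (s := K)
            fun z hz => by simp [hφ0 z hz]]
          simp only [integral_const_mul]
        have a2 : Integrable (fun q : ℝ × E => φ q.2 * v (q.2 + q.1 • e))
            ((volume.restrict (uIoc 0 h)).prod (volume.restrict K)) :=
          (integrable_shift hK hv (intK hw.2.1 hK h3)).bdd_mul
            (h1.continuous.comp continuous_snd).aestronglyMeasurable
            (Eventually.of_forall fun q => hC q.2)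
        rw [a1, ← integral_integral_swap (f := fun s z => φ z * v (z + s • e)) a2]
        refine setIntegral_congr_fun measurableSet_uIoc fun s _ => ?_
        exact setIntegral_eq_integral_of_forall_compl_eq_zero fun z hz => by simp [hφ0 z hz]
      have e2 : ∫ z, v z * ∫ s in uIoc 0 h, φ (z - s • e) =
          ∫ s in uIoc 0 h, ∫ z, v z * φ (z - s • e) := by
        have a1 : ∫ z, v z * ∫ s in uIoc 0 h, φ (z - s • e) =
            ∫ z in S, ∫ s in uIoc 0 h, v z * φ (z - s • e) := by
          rw [← setIntegral_eq_integral_of_forall_compl_eq_zero (s := S) fun z hz => by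
            rw [setIntegral_congr_fun (g := fun _ => (0 : ℝ)) measurableSet_uIoc
              fun s hs => hS s hs z hz]
            simp]
          simp only [integral_const_mul]
        have hcont : Continuous fun q : ℝ × E => φ (q.2 - q.1 • e) :=
          h1.continuous.comp (by fun_prop)
        have a2 : Integrable (fun q : ℝ × E => v q.2 * φ (q.2 - q.1 • e))
            ((volume.restrict (uIoc 0 h)).prod (volume.restrict S)) := by
          have := Integrable.comp_snd (μ := volume.restrict (uIoc 0 h)) (intK hw.2.1 hK h3)
          exact this.mul_bdd hcont.aestronglyMeasurable (Eventually.of_forall fun q => hC _)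
        rw [a1, ← integral_integral_swap (f := fun s z => v z * φ (z - s • e)) a2]
        refine setIntegral_congr_fun measurableSet_uIoc fun s hs => ?_
        exact setIntegral_eq_integral_of_forall_compl_eq_zero fun z hz => by simp [hS s hs z hz]
      have e3 : ∀ s : ℝ, ∫ z, φ z * v (z + s • e) = ∫ z, v z * φ (z - s • e) := fun s => by
        rw [← integral_add_right_eq_self (fun z => v z * φ (z - s • e)) (s • e)]
        simp [mul_comm]
      simp only [segmentSum, intervalIntegral.intervalIntegral_eq_integral_uIoc, smul_eq_mul,
        mul_left_comm _ (if (0 : ℝ) ≤ h then (1 : ℝ) else -1), integral_const_mul]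
      rw [e1, e2]
      simp only [e3]
    have i2' : Integrable fun z => u z * φ z := by simpa [mul_comm] using i2
    simp only [smul_eq_mul, mul_sub]
    have i12 : Integrable fun z => φ z * u (z + h • e) - φ z * u z := i1.sub i2
    rw [integral_sub i12 i3, integral_sub i1 i2, trans_u, fub]
    simp only [mul_sub] at hΦ
    rw [integral_sub i2' i1'] at hΦ
    simp only [mul_comm (φ _) (u _)]
    linarith

end Shift

/-! ### Slices of weakly differentiable functions -/

theorem isOpen_halfPlane : IsOpen halfPlane := isOpen_univ.prod isOpen_Ioi

theorem restrict_halfPlane : (volume : Measure (ℝ × ℝ)).restrict halfPlane =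
    volume.prod (volume.restrict (Ioi 0)) := by
  rw [halfPlane, Measure.volume_eq_prod, ← Measure.prod_restrict, Measure.restrict_univ]

theorem restrict_strip (T : ℝ) : (volume : Measure (ℝ × ℝ)).restrict (strip T) =
    volume.prod (volume.restrict (Ioo 0 T)) := by
  rw [strip, Measure.volume_eq_prod, ← Measure.prod_restrict, Measure.restrict_univ]

theorem ae_ae_swap {α β : Type*} [MeasurableSpace α] [MeasurableSpace β] {μ : Measure α}
    {ν : Measure β} [SFinite μ] [SFinite ν] {P : α × β → Prop} (h : ∀ᵐ z ∂μ.prod ν, P z) :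
    ∀ᵐ y ∂ν, ∀ᵐ x ∂μ, P (x, y) := by
  have h2 : ∀ᵐ z ∂ν.prod μ, P z.swap := by
    have := Measure.measurePreserving_swap (μ := ν) (ν := μ)
    exact this.quasiMeasurePreserving.ae h
  exact Measure.ae_ae_of_ae_prod h2

/-- Countably many compact boxes exhaust the half plane, so one null set of times serves all
intervals. -/
theorem LocallyIntegrableOn.ae_intervalIntegrable_slice {v : ℝ × ℝ → ℝ}
    (hv : LocallyIntegrableOn v halfPlane) :
    ∀ᵐ t ∂volume.restrict (Ioi (0 : ℝ)), ∀ a b : ℝ,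
      IntervalIntegrable (fun x => v (x, t)) volume a b := by
  have h1 : ∀ n : ℕ, ∀ᵐ t ∂volume.restrict (Ioi (0 : ℝ)), t ∈ Icc (1 / ((n : ℝ) + 1)) n →
      IntegrableOn (fun x => v (x, t)) (Icc (-n : ℝ) n) := by
    intro n
    have hK : IsCompact (Icc (-n : ℝ) n ×ˢ Icc (1 / ((n : ℝ) + 1)) n) :=
      isCompact_Icc.prod isCompact_Icc
    have hi := hv.integrableOn_compact_subset (fun z hz =>
      ⟨mem_univ _, lt_of_lt_of_le (by positivity) hz.2.1⟩) hK
    rw [IntegrableOn, Measure.volume_eq_prod, ← Measure.prod_restrict] at hi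
    have h2 := hi.prod_left_ae
    rw [ae_restrict_iff' measurableSet_Icc] at h2
    exact ae_restrict_of_ae h2
  rw [← ae_all_iff] at h1
  filter_upwards [h1, ae_restrict_mem measurableSet_Ioi] with t ht ht0 a b
  obtain ⟨n1, hn1⟩ := exists_nat_gt (1 / t)
  obtain ⟨n2, hn2⟩ := exists_nat_gt (max t (max |a| |b|))
  set n := max n1 n2
  have c1 : (n1 : ℝ) ≤ n := by exact_mod_cast le_max_left n1 n2
  have c2 : (n2 : ℝ) ≤ n := by exact_mod_cast le_max_right n1 n2
  simp only [max_lt_iff, abs_lt] at hn2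
  have ht0' : 0 < t := ht0
  have h3 := ht n ⟨by
    rw [div_le_iff₀ (by positivity)]
    rw [div_lt_iff₀ ht0'] at hn1
    nlinarith, by linarith⟩
  refine (h3.mono_set ?_).intervalIntegrable
  intro x hx
  rcases le_total a b with h | h
  · rw [uIcc_of_le h] at hx; exact ⟨by linarith [hx.1], by linarith [hx.2]⟩
  · rw [uIcc_of_ge h] at hx; exact ⟨by linarith [hx.1], by linarith [hx.2]⟩

/-- For almost every `t` there is a base point `x₀` at which the increment formula holds for almost
every step; the primitive of `v(·, t)` from `x₀` is then the absolutely continuous representative.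
-/
theorem HasWeakDerivOn.ae_slice {u v : ℝ × ℝ → ℝ} (hw : HasWeakDerivOn halfPlane (1, 0) u v)
    (hu : Measurable u) (hv : Measurable v) :
    ∀ᵐ t ∂volume.restrict (Ioi (0 : ℝ)), ∃ H : ℝ → ℝ, (∀ᵐ x, H x = u (x, t)) ∧
      (∀ a b : ℝ, IntervalIntegrable (fun x => v (x, t)) volume a b) ∧
      ∃ c k : ℝ, ∀ x, H x = k + ∫ s in c..x, v (s, t) := by
  have h1 : ∀ h : ℝ, ∀ᵐ z ∂volume.prod (volume.restrict (Ioi (0 : ℝ))),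
      u (z.1 + h, z.2) - u z = ∫ s in (0 : ℝ)..h, v (z.1 + s, z.2) := by
    intro h
    rw [← restrict_halfPlane, ae_restrict_iff' isOpen_halfPlane.measurableSet]
    have := hw.ae_shift isOpen_halfPlane hv (h := h) (by
      rintro s - z hz
      exact ⟨mem_univ _, by simpa [halfPlane] using hz⟩)
    filter_upwards [this] with z hz hzU
    have e : ∀ r : ℝ, z + (r, (0 : ℝ)) = (z.1 + r, z.2) := fun r => by ext <;> simp
    simpa [e] using hz hzU
  -- Joint measurability in the step, the position and the time is what allows the quantifiers
  -- "every `h`, almost every `(x, t)`" to be exchanged.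
  have hmeas : Measurable fun q : ℝ × (ℝ × ℝ) => ∫ s in (0 : ℝ)..q.1, v (q.2.1 + s, q.2.2) := by
    simp only [intervalIntegral]
    have hf : Measurable fun q : (ℝ × (ℝ × ℝ)) × ℝ => v (q.1.2.1 + q.2, q.1.2.2) := by fun_prop
    have key : ∀ l r : ℝ × (ℝ × ℝ) → ℝ, Measurable l → Measurable r →
        Measurable fun q : ℝ × (ℝ × ℝ) => ∫ s in Ioc (l q) (r q), v (q.2.1 + s, q.2.2) := by
      intro l r hl hr
      have hs : MeasurableSet {q : (ℝ × (ℝ × ℝ)) × ℝ | q.2 ∈ Ioc (l q.1) (r q.1)} :=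
        (measurableSet_lt (hl.comp measurable_fst) measurable_snd).inter
          (measurableSet_le measurable_snd (hr.comp measurable_fst))
      have := ((hf.indicator hs).stronglyMeasurable.integral_prod_right' (ν := volume)).measurable
      convert! this using 2 with q
      rw [← integral_indicator measurableSet_Ioc]
      rfl
    exact (key _ _ measurable_const measurable_fst).sub (key _ _ measurable_fst measurable_const)
  have h2 : ∀ᵐ q ∂(volume : Measure ℝ).prod (volume.prod (volume.restrict (Ioi (0 : ℝ)))),
      u (q.2.1 + q.1, q.2.2) - u q.2 = ∫ s in (0 : ℝ)..q.1, v (q.2.1 + s, q.2.2) := by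
    refine (Measure.ae_prod_iff_ae_ae ?_).2 (Eventually.of_forall h1)
    refine measurableSet_eq_fun ?_ hmeas
    fun_prop
  filter_upwards [LocallyIntegrableOn.ae_intervalIntegrable_slice hw.2.1,
    ae_ae_swap (ae_ae_swap h2)] with t hti ht
  obtain ⟨x₀, hx₀⟩ := ht.exists
  refine ⟨fun x => u (x₀, t) + ∫ s in x₀..x, v (s, t), ?_, hti, x₀, u (x₀, t), fun x => rfl⟩
  have := (measurePreserving_sub_right volume x₀).quasiMeasurePreserving.ae hx₀
  filter_upwards [this] with x hx
  simp only [add_sub_cancel] at hx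
  rw [intervalIntegral.integral_comp_add_left (fun s => v (s, t)) x₀] at hx
  simp only [add_zero, add_sub_cancel] at hx
  linarith

/-! ### Regular solutions and exponential weights -/

/-- A jointly measurable solution of `∂ₜ g + c p ∂ₓ g = d p ∂ₓₓ g`, absolutely continuous in time
for every `x`, twice weakly differentiable on almost every time slice. -/
structure IsRegularSolution (p c d : ℝ → ℝ) (g gt gx gxx : ℝ → ℝ → ℝ) : Prop where
  meas : Measurable fun z : ℝ × ℝ => g z.1 z.2
  meas_t : Measurable fun z : ℝ × ℝ => gt z.1 z.2
  meas_x : Measurable fun z : ℝ × ℝ => gx z.1 z.2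
  meas_xx : Measurable fun z : ℝ × ℝ => gxx z.1 z.2
  time : ∀ x t, g x t = g x 0 + ∫ s in (0 : ℝ)..t, gt x s
  gt_neg : ∀ x t, t ≤ 0 → gt x t = 0
  space : ∀ᵐ t ∂volume.restrict (Ioi (0 : ℝ)), ∃ H K : ℝ → ℝ, (∀ᵐ x, H x = g x t) ∧
    (∀ᵐ x, K x = gx x t) ∧ (∀ x, HasDerivAt H (K x) x) ∧ Continuous K ∧
    ∀ a b, HasACDeriv K (fun x => gxx x t) a b
  initial : Integrable fun x => Real.exp (4 * |x|) * g x 0 ^ 2 / p x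
  bound : ∀ T : ℝ, 0 < T → ∃ C : ℝ, ∀ᵐ t ∂volume.restrict (Ioo 0 T),
    (Integrable (fun x => Real.exp (4 * |x|) * g x t ^ 2 / p x) ∧
      ∫ x, Real.exp (4 * |x|) * g x t ^ 2 / p x ≤ C) ∧
    (Integrable (fun x => Real.exp (4 * |x|) * gx x t ^ 2) ∧
      ∫ x, Real.exp (4 * |x|) * gx x t ^ 2 ≤ C)
  int_t : ∀ T : ℝ, 0 < T → Integrable (fun z : ℝ × ℝ => Real.exp (4 * |z.1|) * gt z.1 z.2 ^ 2 / p z.1)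
    (volume.prod (volume.restrict (Ioo 0 T)))
  int_xx : ∀ T : ℝ, 0 < T →
    Integrable (fun z : ℝ × ℝ => Real.exp (4 * |z.1|) * p z.1 * gxx z.1 z.2 ^ 2)
      (volume.prod (volume.restrict (Ioo 0 T)))
  eqn : ∀ᵐ z ∂(volume : Measure ℝ).prod (volume.restrict (Ioi (0 : ℝ))),
    gt z.1 z.2 = d z.2 * p z.1 * gxx z.1 z.2 - c z.2 * p z.1 * gx z.1 z.2

theorem integrable_exp_neg_mul_abs {b : ℝ} (hb : 0 < b) :
    Integrable fun x : ℝ => Real.exp (-(b * |x|)) := by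
  have h1 : IntegrableOn (fun x : ℝ => Real.exp (-(b * |x|))) (Ioi 0) := by
    refine (integrableOn_exp_mul_Ioi (a := -b) (by linarith) 0).congr_fun (fun x hx => ?_)
      measurableSet_Ioi
    simp only [abs_of_pos (show (0 : ℝ) < x from hx)]
    ring_nf
  have h2 : IntegrableOn (fun x : ℝ => Real.exp (-(b * |x|))) (Iic 0) := by
    refine (integrableOn_exp_mul_Iic hb 0).congr_fun (fun x hx => ?_) measurableSet_Iic
    simp only [abs_of_nonpos (show x ≤ 0 from hx)]
    ring_nf
  rw [← integrableOn_univ, ← Iic_union_Ioi (a := (0 : ℝ))]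
  exact h2.union h1

/-- Young's inequality with the exponential weight `exp (4 |x|)`. -/
theorem exp_mul_abs_le {q y x : ℝ} (hq : 0 < q) :
    Real.exp |x| * Real.sqrt q * |y| / q ≤
      Real.exp (-(2 * |x|)) + Real.exp (4 * |x|) * y ^ 2 / q := by
  have hs := Real.sqrt_pos.2 hq
  have e0 : Real.sqrt q ^ 2 = q := Real.sq_sqrt hq.le
  set r := Real.sqrt q
  have e1 : Real.exp |x| = Real.exp (-|x|) * Real.exp (2 * |x|) := by
    rw [← Real.exp_add]; ring_nf
  have e2 : Real.exp (-(2 * |x|)) = Real.exp (-|x|) ^ 2 := by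
    rw [← Real.exp_nat_mul]; push_cast; ring_nf
  have e3 : Real.exp (4 * |x|) = Real.exp (2 * |x|) ^ 2 := by
    rw [← Real.exp_nat_mul]; push_cast; ring_nf
  rw [e1, e2, e3, ← e0, ← sq_abs y]
  set A := Real.exp (-|x|)
  set B := Real.exp (2 * |x|)
  have e4 : A * B * r * |y| / r ^ 2 = A * (B * |y| / r) := by field_simp
  have e5 : B ^ 2 * |y| ^ 2 / r ^ 2 = (B * |y| / r) ^ 2 := by field_simp
  rw [e4, e5]
  nlinarith [sq_nonneg (A - B * |y| / r), sq_nonneg A, sq_nonneg (B * |y| / r)]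

/-! ### A regular representative of a strong solution -/

/-- Carries information known for almost every positive time to limits as `t → 0⁺`. -/
theorem frequently_nhdsGT_of_ae {P : ℝ → Prop} (h : ∀ᵐ t ∂volume.restrict (Ioi (0 : ℝ)), P t) :
    ∃ᶠ t in 𝓝[>] (0 : ℝ), P t := by
  intro hn
  obtain ⟨ε, hε, hs⟩ := mem_nhdsGT_iff_exists_Ioo_subset.1 hn
  have h1 := ae_restrict_of_ae_restrict_of_subset (s := Ioo 0 ε) Ioo_subset_Ioi_self h
  have : (volume.restrict (Ioo 0 ε)) ≠ 0 := by
    simp only [ne_eq, Measure.restrict_eq_zero, Real.volume_Ioo, sub_zero, ENNReal.ofReal_eq_zero,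
      not_le]
    exact hε
  have : (ae (volume.restrict (Ioo 0 ε))).NeBot := ae_neBot.2 this
  obtain ⟨t, ht, ht'⟩ := (h1.and (ae_restrict_mem measurableSet_Ioo)).exists
  exact hs ht' ht

theorem ContinuousInL2.tendsto_setIntegral {g : ℝ → ℝ → ℝ} (hc : ContinuousInL2 g) {A : Set ℝ}
    (hA : volume A < ⊤) {t₀ : ℝ} (h0 : 0 ≤ t₀) :
    Tendsto (fun t => ∫ x in A, g x t) (𝓝[Ici 0] t₀) (𝓝 (∫ x in A, g x t₀)) := by
  have : IsFiniteMeasure (volume.restrict A) := ⟨by simpa using hA⟩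
  have hi : ∀ t, 0 ≤ t → Integrable (fun x => g x t) (volume.restrict A) := fun t ht =>
    ((hc.1 t ht).restrict A).integrable (by norm_num)
  refine tendsto_integral_of_L1' _ (hi t₀ h0).1
    (eventually_nhdsWithin_of_forall fun t ht => hi t ht) ?_
  have h1 := ENNReal.Tendsto.mul_const (b := (volume.restrict A univ) ^
    (1 / ENNReal.toReal 1 - 1 / ENNReal.toReal 2)) (hc.2 t₀ h0)
    (Or.inr (ENNReal.rpow_ne_top_of_nonneg (by norm_num) (measure_ne_top _ _)))
  rw [zero_mul] at h1
  refine tendsto_of_tendsto_of_tendsto_of_le_of_le' tendsto_const_nhds h1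
    (Eventually.of_forall fun _ => zero_le) (eventually_nhdsWithin_of_forall fun t ht => ?_)
  refine (eLpNorm_le_eLpNorm_mul_rpow_measure_univ (q := 2) (by norm_num)
    ((hi t ht).1.sub (hi t₀ h0).1)).trans ?_
  gcongr
  exact eLpNorm_restrict_le _ _ _ _

theorem integrable_prod_Ioc_of_Ioo {v : ℝ × ℝ → ℝ}
    (hint : ∀ T : ℝ, 0 < T → Integrable v (volume.prod (volume.restrict (Ioo 0 T)))) {a b : ℝ}
    (ha : 0 ≤ a) : Integrable v (volume.prod (volume.restrict (Ioc a b))) := by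
  refine (hint (max b 0 + 1) (by positivity)).mono_measure ?_
  have hs : Ioc a b ⊆ Ioo 0 (max b 0 + 1) := fun t ht =>
    ⟨lt_of_le_of_lt ha ht.1, lt_of_le_of_lt ht.2 (by linarith [le_max_left b 0])⟩
  exact Measure.prod_mono le_rfl (Measure.restrict_mono hs le_rfl)

/-- The increment formula over `[t, t + h]` is known only for almost every `t > 0`. Integrated over
a set `A` of finite measure, both sides have limits as `t → 0⁺`: the left by continuity in `L²`, the
right by integrability of `v`. So the formula reaches `t = 0`, and `A` is arbitrary. -/
theorem time_representation {g : ℝ → ℝ → ℝ} {u v : ℝ × ℝ → ℝ} (hc : ContinuousInL2 g)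
    (hw : HasWeakDerivOn halfPlane (0, 1) u v) (hv : Measurable v)
    (hug : ∀ᵐ z ∂(volume : Measure ℝ).prod (volume.restrict (Ioi (0 : ℝ))), u z = g z.1 z.2)
    (hint : ∀ T : ℝ, 0 < T → Integrable v (volume.prod (volume.restrict (Ioo 0 T))))
    {h : ℝ} (hh : 0 ≤ h) : ∀ᵐ x, g x h = g x 0 + ∫ s in (0 : ℝ)..h, v (x, s) := by
  have shift : ∀ᵐ t ∂volume.restrict (Ioi (0 : ℝ)), ∀ᵐ x,
      u (x, t + h) - u (x, t) = ∫ s in (0 : ℝ)..h, v (x, t + s) := by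
    refine ae_ae_swap (P := fun z => u (z.1, z.2 + h) - u (z.1, z.2) =
      ∫ s in (0 : ℝ)..h, v (z.1, z.2 + s)) ?_
    rw [← restrict_halfPlane, ae_restrict_iff' isOpen_halfPlane.measurableSet]
    have := hw.ae_shift isOpen_halfPlane hv (h := h) (by
      rintro s hs z hz
      rw [uIcc_of_le hh] at hs
      refine ⟨mem_univ _, ?_⟩
      have h2 : (0 : ℝ) < z.2 := hz.2
      have : (0 : ℝ) < z.2 + s := by linarith [hs.1]
      simpa using this)
    filter_upwards [this] with z hz hzU
    have e : ∀ r : ℝ, z + ((0 : ℝ), r) = (z.1, z.2 + r) := fun r => by ext <;> simp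
    simpa [e] using hz hzU
  have P0 : ∀ᵐ t ∂volume.restrict (Ioi (0 : ℝ)), ∀ᵐ x, u (x, t) = g x t := ae_ae_swap hug
  have Ph : ∀ᵐ t ∂volume.restrict (Ioi (0 : ℝ)), ∀ᵐ x, u (x, t + h) = g x (t + h) := by
    rw [ae_restrict_iff' measurableSet_Ioi] at P0 ⊢
    filter_upwards [(measurePreserving_add_right volume h).quasiMeasurePreserving.ae P0] with t ht
      ht0
    exact ht (add_pos_of_pos_of_nonneg ht0 hh)
  have hgi : ∀ t, 0 ≤ t → ∀ A, volume A < ⊤ → IntegrableOn (fun x => g x t) A := by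
    intro t ht A hA
    have : IsFiniteMeasure (volume.restrict A) := ⟨by simpa using hA⟩
    exact ((hc.1 t ht).restrict A).integrable (by norm_num)
  have hVi : Integrable fun x => ∫ s in (0 : ℝ)..h, v (x, s) := by
    simp only [intervalIntegral.integral_of_le hh]
    exact (integrable_prod_Ioc_of_Ioo hint le_rfl).integral_prod_left
  refine ae_eq_of_forall_setIntegral_eq_of_sigmaFinite (fun A _ hA => hgi h hh A hA)
    (fun A _ hA => (hgi 0 le_rfl A hA).add hVi.integrableOn) fun A hAm hA => ?_
  rw [integral_add (hgi 0 le_rfl A hA) hVi.integrableOn]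
  have swap : ∀ t, 0 ≤ t → ∫ x in A, ∫ s in t..(t + h), v (x, s) =
      ∫ s in t..(t + h), ∫ x in A, v (x, s) := by
    intro t ht
    simp only [intervalIntegral.integral_of_le (show t ≤ t + h by linarith)]
    refine integral_integral_swap (f := fun x s => v (x, s)) ?_
    refine (integrable_prod_Ioc_of_Ioo (b := t + h) hint ht).mono_measure ?_
    exact Measure.prod_mono Measure.restrict_le_self le_rfl
  have hn : IntegrableOn (fun s => ∫ x in A, v (x, s)) (Ioo 0 (h + 1)) := by
    have : Integrable v ((volume.restrict A).prod (volume.restrict (Ioo 0 (h + 1)))) :=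
      (hint (h + 1) (by linarith)).mono_measure
        (Measure.prod_mono Measure.restrict_le_self le_rfl)
    exact this.integral_prod_right
  set n := fun s => ∫ x in A, v (x, s) with hndef
  -- The truncation is integrable on the whole line, so its primitive is continuous everywhere; it
  -- agrees with `n` on `(t, t + h]` for `0 < t < 1`.
  set n' := (Ioo 0 (h + 1)).indicator n with hn'
  have hn'i : Integrable n' := (integrable_indicator_iff measurableSet_Ioo).2 hn
  have lim_right : Tendsto (fun t => ∫ s in t..(t + h), n' s) (𝓝[>] 0) (𝓝 (∫ s in (0 : ℝ)..h, n' s)) := by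
    have hcont : Continuous fun t => (∫ s in (0 : ℝ)..(t + h), n' s) - ∫ s in (0 : ℝ)..t, n' s :=
      ((intervalIntegral.continuous_primitive (fun a b => hn'i.intervalIntegrable) 0).comp
        (by fun_prop)).sub
        (intervalIntegral.continuous_primitive (fun a b => hn'i.intervalIntegrable) 0)
    have := (hcont.tendsto 0).mono_left (nhdsWithin_le_nhds (s := Ioi 0))
    simp only [zero_add, intervalIntegral.integral_same, sub_zero] at this
    refine this.congr fun t => ?_
    rw [intervalIntegral.integral_interval_sub_left] <;> exact hn'i.intervalIntegrable
  have lim_left : Tendsto (fun t => (∫ x in A, g x (t + h)) - ∫ x in A, g x t) (𝓝[>] 0)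
      (𝓝 ((∫ x in A, g x h) - ∫ x in A, g x 0)) := by
    refine Tendsto.sub ?_ ?_
    · refine (hc.tendsto_setIntegral hA hh).comp (tendsto_nhdsWithin_iff.2 ⟨?_, ?_⟩)
      · have : Tendsto (fun t : ℝ => t + h) (𝓝 0) (𝓝 (0 + h)) :=
          (continuous_id.add continuous_const).tendsto 0
        rw [zero_add] at this
        exact this.mono_left nhdsWithin_le_nhds
      · exact eventually_nhdsWithin_of_forall fun t ht => add_nonneg (le_of_lt ht) hh
    · exact (hc.tendsto_setIntegral hA le_rfl).mono_left (nhdsWithin_mono _ Ioi_subset_Ici_self)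
  have freq : ∃ᶠ t in 𝓝[>] (0 : ℝ), (∫ x in A, g x (t + h)) - ∫ x in A, g x t =
      ∫ s in t..(t + h), n' s := by
    have ev : ∀ᶠ t in 𝓝[>] (0 : ℝ), t ∈ Ioo (0 : ℝ) 1 := Ioo_mem_nhdsGT (by norm_num)
    refine ((frequently_nhdsGT_of_ae ((shift.and P0).and Ph)).and_eventually ev).mono ?_
    rintro t ⟨⟨⟨h1, h2⟩, h3⟩, ht0, ht1⟩
    rw [← integral_sub (hgi _ (by linarith) A hA) (hgi t ht0.le A hA)]
    have : ∫ s in t..(t + h), n' s = ∫ s in t..(t + h), n s := by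
      rw [intervalIntegral.integral_of_le (by linarith), intervalIntegral.integral_of_le
        (by linarith)]
      refine setIntegral_congr_fun measurableSet_Ioc fun s hs => ?_
      have : s ∈ Ioo 0 (h + 1) := ⟨by linarith [hs.1], by linarith [hs.2]⟩
      exact indicator_of_mem this _
    rw [this, hndef, ← swap t ht0.le]
    refine integral_congr_ae (ae_restrict_of_ae ?_)
    filter_upwards [h1, h2, h3] with x a1 a2 a3
    rw [← a2, ← a3, a1, intervalIntegral.integral_comp_add_left (fun s => v (x, s)) t]
    simp
  have fin := tendsto_nhds_unique_of_frequently_eq lim_left lim_right freq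
  have : ∫ s in (0 : ℝ)..h, n' s = ∫ s in (0 : ℝ)..h, n s := by
    rw [intervalIntegral.integral_of_le hh, intervalIntegral.integral_of_le hh]
    refine setIntegral_congr_fun measurableSet_Ioc fun s hs => ?_
    have : s ∈ Ioo 0 (h + 1) := ⟨by linarith [hs.1], by linarith [hs.2]⟩
    exact indicator_of_mem this _
  have sw := swap 0 le_rfl
  rw [zero_add] at sw
  rw [sw, ← this]
  linarith

theorem integral_sq_le_of_eLpNorm_le {f : ℝ → ℝ} (hf : AEStronglyMeasurable f volume) {C : ℝ}
    (h : eLpNorm f 2 volume ≤ ENNReal.ofReal C) :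
    Integrable (fun x => f x ^ 2) ∧ ∫ x, f x ^ 2 ≤ (max C 0) ^ 2 := by
  have hm : MemLp f 2 volume := ⟨hf, h.trans_lt ENNReal.ofReal_lt_top⟩
  refine ⟨hm.integrable_sq, ?_⟩
  rw [hm.eLpNorm_eq_integral_rpow_norm (by norm_num) (by norm_num)] at h
  have h0 : (0 : ℝ) ≤ ∫ x, f x ^ 2 := integral_nonneg fun x => sq_nonneg _
  have e : ∫ x, ‖f x‖ ^ (2 : ENNReal).toReal = ∫ x, f x ^ 2 := by
    simp
  rw [e, show (2 : ENNReal).toReal⁻¹ = 1 / 2 by norm_num, ← Real.sqrt_eq_rpow] at h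
  have h2 : Real.sqrt (∫ x, f x ^ 2) ≤ max C 0 := by
    rcases le_total 0 C with hC | hC
    · rw [max_eq_left hC]; exact (ENNReal.ofReal_le_ofReal_iff hC).1 h
    · rw [ENNReal.ofReal_of_nonpos hC] at h
      rw [max_eq_right hC]
      exact ENNReal.ofReal_eq_zero.1 (le_antisymm h zero_le)
  calc ∫ x, f x ^ 2 = Real.sqrt (∫ x, f x ^ 2) ^ 2 := (Real.sq_sqrt h0).symm
    _ ≤ _ := by gcongr

/-- Weights of size `e^{|x|} √p` are admissible: Young's inequality splits the product into
`e^{-2|x|}` and the controlled weighted square. The map `π` lets one statement serve both space and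
space-time. -/
theorem integrable_weighted {α : Type*} [MeasurableSpace α] {μ : Measure α} {π v : α → ℝ}
    {p w : ℝ → ℝ} {C : ℝ} (hπ : Measurable π) (hv : AEStronglyMeasurable v μ) (hp : Measurable p)
    (hp0 : ∀ x, 0 < p x) (hw : Measurable w)
    (hC : ∀ x, |w x| ≤ C * (Real.exp |x| * Real.sqrt (p x)))
    (he : Integrable (fun z => Real.exp (-(2 * |π z|))) μ)
    (hi : Integrable (fun z => Real.exp (4 * |π z|) * v z ^ 2 / p (π z)) μ) :
    Integrable (fun z => w (π z) * v z / p (π z)) μ := by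
  refine ((he.add hi).const_mul C).mono' ?_ (Eventually.of_forall fun z => ?_)
  · exact ((hw.comp hπ).aestronglyMeasurable.mul hv).div₀ (hp.comp hπ).aestronglyMeasurable
  · have hq := hp0 (π z)
    have hC0 : 0 ≤ C := by
      have h1 := (abs_nonneg _).trans (hC 0)
      have h2 : 0 < Real.exp |0| * Real.sqrt (p 0) :=
        mul_pos (Real.exp_pos _) (Real.sqrt_pos.2 (hp0 0))
      exact nonneg_of_mul_nonneg_left h1 h2
    rw [Real.norm_eq_abs, abs_div, abs_mul, abs_of_pos hq]
    calc |w (π z)| * |v z| / p (π z)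
        ≤ C * (Real.exp |π z| * Real.sqrt (p (π z))) * |v z| / p (π z) := by
          gcongr; exact hC _
      _ = C * (Real.exp |π z| * Real.sqrt (p (π z)) * |v z| / p (π z)) := by ring
      _ ≤ _ := by
          refine mul_le_mul_of_nonneg_left ?_ hC0
          exact exp_mul_abs_le hq

theorem le_sqrt_of_le_one {q : ℝ} (h0 : 0 ≤ q) (h1 : q ≤ 1) : q ≤ Real.sqrt q :=
  Real.le_sqrt_of_sq_le (by nlinarith)

theorem abs_le_exp_mul_sqrt {p : ℝ → ℝ} (hp0 : ∀ x, 0 < p x) (hp1 : ∀ x, p x ≤ 1) (x : ℝ) :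
    |p x| ≤ 1 * (Real.exp |x| * Real.sqrt (p x)) := by
  rw [abs_of_pos (hp0 x), one_mul]
  have := le_sqrt_of_le_one (hp0 x).le (hp1 x)
  have h2 : 1 ≤ Real.exp |x| := Real.one_le_exp (abs_nonneg x)
  nlinarith [Real.sqrt_nonneg (p x)]

theorem exp_two_mul_div_sqrt_sq {q y x : ℝ} (hq : 0 ≤ q) :
    (Real.exp (2 * |x|) * y / Real.sqrt q) ^ 2 = Real.exp (4 * |x|) * y ^ 2 / q := by
  rw [div_pow, mul_pow, Real.sq_sqrt hq, ← Real.exp_nat_mul]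
  push_cast; ring_nf

theorem integrable_exp_prod {ν : Measure ℝ} [IsFiniteMeasure ν] :
    Integrable (fun z : ℝ × ℝ => Real.exp (-(2 * |z.1|))) ((volume : Measure ℝ).prod ν) :=
  (integrable_exp_neg_mul_abs (b := 2) (by norm_num)).comp_fst ν

/-- The representative is a measurable version of `g(·, 0)` plus the time primitive of a measurable
version of `∂ₜ g`. It agrees with `g` at every time `t ≥ 0`, for almost every `x`, so `α` and the
coefficients are unaffected. -/
theorem IsStrongSolution.exists_regular {M Mc τ : ℝ} {p g₀ : ℝ → ℝ} {g : ℝ → ℝ → ℝ}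
    (hpc : Continuous p) (hp0 : ∀ x, 0 < p x) (hp1 : ∀ x, p x ≤ 1) (h0 : IsInitialDatum p g₀)
    (h : IsStrongSolution M Mc τ p g₀ g) :
    ∃ G Gt Gx Gxx : ℝ → ℝ → ℝ,
      IsRegularSolution p (coeffC M Mc τ g) (coeffD M Mc g) G Gt Gx Gxx ∧
      ∀ t, 0 ≤ t → ∀ᵐ x, G x t = g x t := by
  obtain ⟨hc, hinit, gt, gx, gxx, wt, wx, wxx, hb, heq⟩ := h
  have hUm := isOpen_halfPlane.measurableSet
  have mg := wt.1.aestronglyMeasurable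
  have mt := wt.2.1.aestronglyMeasurable
  have mx := wx.2.1.aestronglyMeasurable
  have mxx := wxx.2.1.aestronglyMeasurable
  set u : ℝ × ℝ → ℝ := mg.mk _ with hu
  -- Vanishing for `t ≤ 0` lets the time identities be written for every real `t`.
  set vt : ℝ × ℝ → ℝ := halfPlane.indicator (mt.mk _) with hvt
  set vx : ℝ × ℝ → ℝ := mx.mk _ with hvx
  set vxx : ℝ × ℝ → ℝ := mxx.mk _ with hvxx
  have hum : Measurable u := mg.stronglyMeasurable_mk.measurable
  have hvtm : Measurable vt := mt.stronglyMeasurable_mk.measurable.indicator hUm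
  have hvxm : Measurable vx := mx.stronglyMeasurable_mk.measurable
  have hvxxm : Measurable vxx := mxx.stronglyMeasurable_mk.measurable
  have eu : (fun z : ℝ × ℝ => g z.1 z.2) =ᵐ[volume.restrict halfPlane] u := mg.ae_eq_mk
  have et : (fun z : ℝ × ℝ => gt z.1 z.2) =ᵐ[volume.restrict halfPlane] vt := by
    filter_upwards [mt.ae_eq_mk, ae_restrict_mem hUm] with z hz hzU
    rw [hz, hvt, indicator_of_mem hzU]
  have ex : (fun z : ℝ × ℝ => gx z.1 z.2) =ᵐ[volume.restrict halfPlane] vx := mx.ae_eq_mk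
  have exx : (fun z : ℝ × ℝ => gxx z.1 z.2) =ᵐ[volume.restrict halfPlane] vxx := mxx.ae_eq_mk
  have wt' := wt.congr hUm eu et
  have wx' := wx.congr hUm eu ex
  have wxx' := wxx.congr hUm ex exx
  have strip_sub : ∀ T, strip T ⊆ halfPlane := fun T z hz => ⟨hz.1, hz.2.1⟩
  have sub : ∀ T {P : ℝ × ℝ → Prop}, (∀ᵐ z ∂volume.restrict halfPlane, P z) →
      ∀ᵐ z ∂(volume : Measure ℝ).prod (volume.restrict (Ioo 0 T)), P z := by
    intro T P hP
    rw [← restrict_strip]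
    exact ae_restrict_of_ae_restrict_of_subset (strip_sub T) hP
  have int_t : ∀ T : ℝ, 0 < T →
      Integrable (fun z : ℝ × ℝ => Real.exp (4 * |z.1|) * vt z ^ 2 / p z.1)
        (volume.prod (volume.restrict (Ioo 0 T))) := by
    intro T hT
    have h1 := (hb T hT).2.2.1.integrable_sq
    rw [restrict_strip] at h1
    refine h1.congr ?_
    filter_upwards [sub T et] with z hz
    rw [exp_two_mul_div_sqrt_sq (hp0 _).le, ← hz]
  have int_xx : ∀ T : ℝ, 0 < T →
      Integrable (fun z : ℝ × ℝ => Real.exp (4 * |z.1|) * p z.1 * vxx z ^ 2)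
        (volume.prod (volume.restrict (Ioo 0 T))) := by
    intro T hT
    have h1 := (hb T hT).2.2.2.integrable_sq
    rw [restrict_strip] at h1
    refine h1.congr ?_
    filter_upwards [sub T exx] with z hz
    rw [mul_pow, mul_pow, Real.sq_sqrt (hp0 _).le, ← Real.exp_nat_mul, ← hz]
    push_cast; ring_nf
  have int_v : ∀ T : ℝ, 0 < T → Integrable vt (volume.prod (volume.restrict (Ioo 0 T))) := by
    intro T hT
    have := integrable_weighted measurable_fst hvtm.aestronglyMeasurable hpc.measurable hp0
      hpc.measurable (abs_le_exp_mul_sqrt hp0 hp1) integrable_exp_prod (int_t T hT)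
    refine this.congr (Eventually.of_forall fun z => ?_)
    have := hp0 z.1
    field_simp
  have hmg0 := (hc.1 0 le_rfl).1
  set k : ℝ → ℝ := hmg0.mk _ with hk
  have hkm : Measurable k := hmg0.stronglyMeasurable_mk.measurable
  have ek : ∀ᵐ x, g x 0 = k x := hmg0.ae_eq_mk
  set G : ℝ → ℝ → ℝ := fun x t => k x + ∫ s in (0 : ℝ)..t, vt (x, s) with hG
  have hGm : Measurable fun z : ℝ × ℝ => G z.1 z.2 := by
    have key : ∀ l r : ℝ × ℝ → ℝ, Measurable l → Measurable r →
        Measurable fun q : ℝ × ℝ => ∫ s in Ioc (l q) (r q), vt (q.1, s) := by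
      intro l r hl hr
      have hs : MeasurableSet {q : (ℝ × ℝ) × ℝ | q.2 ∈ Ioc (l q.1) (r q.1)} :=
        (measurableSet_lt (hl.comp measurable_fst) measurable_snd).inter
          (measurableSet_le measurable_snd (hr.comp measurable_fst))
      have hf : Measurable fun q : (ℝ × ℝ) × ℝ => vt (q.1.1, q.2) := by fun_prop
      have := ((hf.indicator hs).stronglyMeasurable.integral_prod_right' (ν := volume)).measurable
      convert! this using 2 with q
      rw [← integral_indicator measurableSet_Ioc]
      rfl
    simp only [hG, intervalIntegral]
    exact (hkm.comp measurable_fst).add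
      ((key _ _ measurable_const measurable_snd).sub (key _ _ measurable_snd measurable_const))
  have hGg : ∀ t, 0 ≤ t → ∀ᵐ x, G x t = g x t := by
    intro t ht
    have hug : ∀ᵐ z ∂(volume : Measure ℝ).prod (volume.restrict (Ioi (0 : ℝ))),
        u z = g z.1 z.2 := by
      rw [← restrict_halfPlane]
      exact eu.symm
    filter_upwards [time_representation hc wt' hvtm hug int_v ht, ek] with x h1 h2
    rw [hG, h1, h2]
  have hGu : ∀ᵐ t ∂volume.restrict (Ioi (0 : ℝ)), ∀ᵐ x, u (x, t) = G x t := by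
    have hug := eu
    rw [Filter.EventuallyEq, restrict_halfPlane] at hug
    filter_upwards [ae_ae_swap hug, ae_restrict_mem measurableSet_Ioi] with t ht ht0
    filter_upwards [ht, hGg t (le_of_lt ht0)] with x h1 h2
    rw [h2, ← h1]
  have restr : ∀ T {P : ℝ → Prop}, (∀ᵐ t ∂volume.restrict (Ioi (0 : ℝ)), P t) →
      ∀ᵐ t ∂volume.restrict (Ioo 0 T), P t := fun T P hP =>
    ae_restrict_of_ae_restrict_of_subset Ioo_subset_Ioi_self hP
  refine ⟨G, fun x t => vt (x, t), fun x t => vx (x, t), fun x t => vxx (x, t), ⟨hGm, hvtm, hvxm,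
    hvxxm, ?_, ?_, ?_, ?_, ?_, int_t, int_xx, ?_⟩, hGg⟩
  · intro x t
    simp [hG]
  · intro x t ht
    refine indicator_of_notMem (fun hm => ?_) _
    exact not_lt.2 ht hm.2
  · filter_upwards [wx'.ae_slice hum hvxm, wxx'.ae_slice hvxm hvxxm, hGu] with t h1 h2 h3
    obtain ⟨H, hH, hHi, c, k, hHk⟩ := h1
    obtain ⟨K, hK, hKi, c', k', hKk⟩ := h2
    have hKac := HasACDeriv.of_primitive hKi hKk
    have hKc : Continuous K := by
      have : Continuous fun x => k' + ∫ s in c'..x, vxx (s, t) :=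
        continuous_const.add (intervalIntegral.continuous_primitive hKi c')
      exact (funext hKk) ▸ this
    refine ⟨H, K, ?_, hK, ?_, hKc, hKac⟩
    · filter_upwards [hH, h3] with x a1 a2
      rw [a1, a2]
    · have e : H = fun x => k + ∫ s in c..x, K s := by
        funext x
        rw [hHk]
        congr 1
        refine intervalIntegral.integral_congr_ae ?_
        filter_upwards [hK] with s hs _ using hs.symm
      intro x
      rw [e]
      exact (intervalIntegral.integral_hasDerivAt_right (hKc.intervalIntegrable _ _)
        hKc.stronglyMeasurable.stronglyMeasurableAtFilter hKc.continuousAt).const_add k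
  · refine h0.weighted.congr ?_
    filter_upwards [hinit, ek] with x h1 h2
    simp [hG, ← h1, h2]
  · intro T hT
    obtain ⟨⟨-, C1, h1⟩, ⟨-, C2, h2⟩, -, -⟩ := hb T hT
    refine ⟨max ((max C1 0) ^ 2) ((max C2 0) ^ 2), ?_⟩
    have ex' := ex
    rw [Filter.EventuallyEq, restrict_halfPlane] at ex'
    filter_upwards [h1, h2, restr T (ae_ae_swap ex'), ae_restrict_mem measurableSet_Ioo] with t a1
      a2 a3 ht
    have a4 := hGg t ht.1.le
    have e1 : (fun x => Real.exp (2 * |x|) * g x t / Real.sqrt (p x)) =ᵐ[volume]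
        fun x => Real.exp (2 * |x|) * G x t / Real.sqrt (p x) := by
      filter_upwards [a4] with x hx
      rw [hx]
    have e2 : (fun x => Real.exp (2 * |x|) * gx x t) =ᵐ[volume]
        fun x => Real.exp (2 * |x|) * vx (x, t) := by
      filter_upwards [a3] with x hx
      rw [hx]
    rw [eLpNorm_congr_ae e1] at a1
    rw [eLpNorm_congr_ae e2] at a2
    have hGt : Measurable fun x => G x t := hGm.comp (by fun_prop : Measurable fun x : ℝ => (x, t))
    have hpm := hpc.measurable
    have b1 := integral_sq_le_of_eLpNorm_le (Measurable.aestronglyMeasurable (by fun_prop)) a1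
    have b2 := integral_sq_le_of_eLpNorm_le (Measurable.aestronglyMeasurable (by fun_prop)) a2
    have f1 : ∀ x, (Real.exp (2 * |x|) * G x t / Real.sqrt (p x)) ^ 2 =
        Real.exp (4 * |x|) * G x t ^ 2 / p x := fun x => exp_two_mul_div_sqrt_sq (hp0 x).le
    have f2 : ∀ x, (Real.exp (2 * |x|) * vx (x, t)) ^ 2 =
        Real.exp (4 * |x|) * vx (x, t) ^ 2 := fun x => by
      rw [mul_pow, ← Real.exp_nat_mul]; push_cast; ring_nf
    simp only [f1] at b1
    simp only [f2] at b2
    exact ⟨⟨b1.1, b1.2.trans (le_max_left _ _)⟩, ⟨b2.1, b2.2.trans (le_max_right _ _)⟩⟩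
  · rw [← restrict_halfPlane]
    filter_upwards [heq, et, ex, exx] with z h1 h2 h3 h4
    simp only [Prod.mk.eta, ← h2, ← h3, ← h4]
    linarith

/-! ### Integral identities on a time slice -/

/-- A continuous weight with values in `(0, 1]`. -/
structure IsWeight (p : ℝ → ℝ) : Prop where
  continuous : Continuous p
  pos : ∀ x, 0 < p x
  le_one : ∀ x, p x ≤ 1

/-- A `C²` function with `φ(0) = φ'(0) = 0`, together with its first two derivatives. -/
structure IsEntropy (φ φ' φ'' : ℝ → ℝ) : Prop where
  hasDerivAt : ∀ s, HasDerivAt φ (φ' s) s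
  hasDerivAt' : ∀ s, HasDerivAt φ' (φ'' s) s
  continuous : Continuous φ''
  zero : φ 0 = 0
  zero' : φ' 0 = 0

theorem IsEntropy.continuous₀ {φ φ' φ'' : ℝ → ℝ} (h : IsEntropy φ φ' φ'') : Continuous φ :=
  continuous_iff_continuousAt.2 fun s => (h.hasDerivAt s).continuousAt

theorem IsEntropy.continuous₁ {φ φ' φ'' : ℝ → ℝ} (h : IsEntropy φ φ' φ'') : Continuous φ' :=
  continuous_iff_continuousAt.2 fun s => (h.hasDerivAt' s).continuousAt

/-- The mean value inequality, applied twice from the double zero at the origin. It makes `φ(g)/p`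
integrable as soon as `g` is bounded and `g²/p` is integrable. -/
theorem IsEntropy.exists_bound {φ φ' φ'' : ℝ → ℝ} (h : IsEntropy φ φ' φ'') (B : ℝ) :
    ∃ D, 0 ≤ D ∧ ∀ s, |s| ≤ B → |φ'' s| ≤ D ∧ |φ' s| ≤ D * |s| ∧ |φ s| ≤ D * s ^ 2 := by
  obtain ⟨D, hD⟩ := (isCompact_Icc (a := -B) (b := B)).exists_bound_of_continuousOn
    h.continuous.continuousOn
  have h2 : ∀ s, |s| ≤ B → |φ'' s| ≤ max D 0 := fun s hs =>
    (hD s (abs_le.1 hs)).trans (le_max_left _ _)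
  have h1 : ∀ s, |s| ≤ B → |φ' s| ≤ max D 0 * |s| := fun s hs => by
    have := (convex_Icc (-|s|) |s|).norm_image_sub_le_of_norm_hasDerivWithin_le
      (C := max D 0) (fun y _ => (h.hasDerivAt' y).hasDerivWithinAt)
      (fun y hy => h2 y ((abs_le.2 hy).trans hs)) (x := 0) (y := s)
      (show (0 : ℝ) ∈ Icc (-|s|) |s| from ⟨neg_nonpos.2 (abs_nonneg s), abs_nonneg s⟩)
      (abs_le.1 le_rfl)
    simpa [h.zero'] using this
  refine ⟨max D 0, le_max_right _ _, fun s hs => ⟨h2 s hs, h1 s hs, ?_⟩⟩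
  have := (convex_Icc (-|s|) |s|).norm_image_sub_le_of_norm_hasDerivWithin_le
    (C := max D 0 * |s|) (fun y _ => (h.hasDerivAt y).hasDerivWithinAt)
    (fun y hy => (h1 y ((abs_le.2 hy).trans hs)).trans
      (mul_le_mul_of_nonneg_left (abs_le.2 hy) (le_max_right _ _))) (x := 0) (y := s)
      (show (0 : ℝ) ∈ Icc (-|s|) |s| from ⟨neg_nonpos.2 (abs_nonneg s), abs_nonneg s⟩)
    (abs_le.1 le_rfl)
  simp only [h.zero, sub_zero, Real.norm_eq_abs] at this
  calc |φ s| ≤ max D 0 * |s| * |s| := this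
    _ = max D 0 * s ^ 2 := by rw [mul_assoc, ← sq, sq_abs]

/-- A time slice `H` of a regular solution, with its first two derivatives `K` and `L`. -/
structure IsSlice (p H K L : ℝ → ℝ) : Prop where
  hasDerivAt : ∀ x, HasDerivAt H (K x) x
  continuous : Continuous K
  ac : ∀ a b, HasACDeriv K L a b
  meas : Measurable L
  int_H : Integrable fun x => Real.exp (4 * |x|) * H x ^ 2 / p x
  int_K : Integrable fun x => Real.exp (4 * |x|) * K x ^ 2
  int_L : Integrable fun x => Real.exp (4 * |x|) * p x * L x ^ 2

namespace IsSlice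

variable {p H K L : ℝ → ℝ}

theorem continuous_H (h : IsSlice p H K L) : Continuous H :=
  continuous_iff_continuousAt.2 fun s => (h.hasDerivAt s).continuousAt

theorem one_le_exp_abs (x : ℝ) : 1 ≤ Real.exp (4 * |x|) := Real.one_le_exp (by positivity)

theorem integrable_sq_div (h : IsSlice p H K L) (hp : IsWeight p) :
    Integrable fun x => H x ^ 2 / p x := by
  refine h.int_H.mono' ?_ (Eventually.of_forall fun x => ?_)
  · exact ((h.continuous_H.pow 2).div₀ hp.continuous fun x => (hp.pos x).ne').aestronglyMeasurable
  · have := hp.pos x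
    rw [Real.norm_of_nonneg (by positivity), mul_div_assoc]
    exact le_mul_of_one_le_left (by positivity) (one_le_exp_abs x)

theorem integrable_exp_mul_sq (h : IsSlice p H K L) (hp : IsWeight p) :
    Integrable fun x => Real.exp (4 * |x|) * H x ^ 2 := by
  have hH := h.continuous_H
  refine h.int_H.mono' (Continuous.aestronglyMeasurable (by fun_prop))
    (Eventually.of_forall fun x => ?_)
  have := hp.pos x
  rw [Real.norm_of_nonneg (by positivity)]
  exact le_div_self (by positivity) this (hp.le_one x)

theorem integrable_sq (h : IsSlice p H K L) (hp : IsWeight p) : Integrable fun x => H x ^ 2 := by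
  have hH := h.continuous_H
  refine (h.integrable_exp_mul_sq hp).mono' (Continuous.aestronglyMeasurable (by fun_prop))
    (Eventually.of_forall fun x => ?_)
  rw [Real.norm_of_nonneg (by positivity)]
  exact le_mul_of_one_le_left (by positivity) (one_le_exp_abs x)

theorem integrable_deriv_sq (h : IsSlice p H K L) : Integrable fun x => K x ^ 2 := by
  have hK := h.continuous
  refine h.int_K.mono' (Continuous.aestronglyMeasurable (by fun_prop))
    (Eventually.of_forall fun x => ?_)
  rw [Real.norm_of_nonneg (by positivity)]
  exact le_mul_of_one_le_left (by positivity) (one_le_exp_abs x)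

theorem integrable_deriv2_sq (h : IsSlice p H K L) (hp : IsWeight p) :
    Integrable fun x => p x * L x ^ 2 := by
  have hL := h.meas
  have hp' := hp.continuous.measurable
  refine h.int_L.mono' (Measurable.aestronglyMeasurable (by fun_prop))
    (Eventually.of_forall fun x => ?_)
  have := hp.pos x
  rw [Real.norm_of_nonneg (by positivity), mul_assoc]
  exact le_mul_of_one_le_left (by positivity) (one_le_exp_abs x)

theorem integrable_mul_deriv (h : IsSlice p H K L) (hp : IsWeight p) :
    Integrable fun x => H x * K x := by
  refine ((h.integrable_sq hp).add h.integrable_deriv_sq).mono'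
    (h.continuous_H.mul h.continuous).aestronglyMeasurable (Eventually.of_forall fun x => ?_)
  rw [Real.norm_eq_abs, abs_mul]
  simp only [Pi.add_apply]
  nlinarith [sq_nonneg (|H x| - |K x|), sq_abs (H x), sq_abs (K x), sq_nonneg (H x),
    sq_nonneg (K x)]

theorem integrable_mul_deriv2 (h : IsSlice p H K L) (hp : IsWeight p) :
    Integrable fun x => |H x| * |L x| := by
  have hL := h.meas
  refine ((h.integrable_sq_div hp).add (h.integrable_deriv2_sq hp)).mono'
    (h.continuous_H.measurable.abs.mul hL.abs).aestronglyMeasurable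
    (Eventually.of_forall fun x => ?_)
  have h0 := hp.pos x
  rw [Real.norm_of_nonneg (by positivity)]
  simp only [Pi.add_apply]
  have e0 := Real.sq_sqrt h0.le
  have hs := Real.sqrt_pos.2 h0
  set r := Real.sqrt (p x)
  rw [← e0, ← sq_abs (H x), ← sq_abs (L x)]
  have e1 : |H x| * |L x| = (|H x| / r) * (r * |L x|) := by field_simp
  have e2 : |H x| ^ 2 / r ^ 2 = (|H x| / r) ^ 2 := by rw [div_pow]
  rw [e1, e2]
  nlinarith [sq_nonneg (|H x| / r - r * |L x|), sq_nonneg (|H x| / r), sq_nonneg (r * |L x|)]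

/-- `H²` has the integrable derivative `2 H K` and is itself integrable, so it vanishes at `-∞`;
integrate from there to `x`. -/
theorem sq_le (h : IsSlice p H K L) (hp : IsWeight p) (x : ℝ) :
    H x ^ 2 ≤ 2 * ∫ y, |H y * K y| := by
  have hd : ∀ y, HasDerivAt (fun y => H y ^ 2) (2 * (H y * K y)) y := fun y => by
    convert! (h.hasDerivAt y).pow 2 using 1
    push_cast; ring
  have hi := (h.integrable_mul_deriv hp).const_mul 2
  have hlim := tendsto_zero_of_hasDerivAt_of_integrableOn_Iic (a := x) (fun y _ => hd y)
    hi.integrableOn (h.integrable_sq hp).integrableOn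
  have e := integral_Iic_of_hasDerivAt_of_tendsto' (a := x) (fun y _ => hd y) hi.integrableOn hlim
  rw [sub_zero] at e
  rw [← e, ← integral_const_mul]
  calc ∫ y in Iic x, 2 * (H y * K y) ≤ ∫ y in Iic x, 2 * |H y * K y| :=
        integral_mono hi.integrableOn ((h.integrable_mul_deriv hp).abs.const_mul 2).integrableOn
          fun y => by
            have := le_abs_self (H y * K y)
            simp only; linarith
    _ ≤ ∫ y, 2 * |H y * K y| :=
        setIntegral_le_integral ((h.integrable_mul_deriv hp).abs.const_mul 2)
          (Eventually.of_forall fun y => by positivity)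

theorem exists_bound (h : IsSlice p H K L) (hp : IsWeight p) : ∃ B, ∀ x, |H x| ≤ B :=
  ⟨_, fun x => Real.abs_le_sqrt (h.sq_le hp x)⟩

variable {φ φ' φ'' : ℝ → ℝ}

theorem integrable_entropy_dissipation (h : IsSlice p H K L) (hp : IsWeight p)
    (hφ : IsEntropy φ φ' φ'') : Integrable fun x => φ'' (H x) * K x ^ 2 := by
  obtain ⟨B, hB⟩ := h.exists_bound hp
  obtain ⟨D, hD, hD'⟩ := hφ.exists_bound B
  exact h.integrable_deriv_sq.bdd_mul (hφ.continuous.comp h.continuous_H).aestronglyMeasurable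
    (Eventually.of_forall fun x => (hD' _ (hB x)).1)

/-- Division by `p` cancels the weight. The transport term is then the total derivative of `φ(H)`,
and integrating the derivative of `φ'(H) K` handles the diffusion term. -/
theorem integral_entropy (h : IsSlice p H K L) (hp : IsWeight p) (hφ : IsEntropy φ φ' φ'')
    (c d : ℝ) :
    ∫ x, φ' (H x) * (d * p x * L x - c * p x * K x) / p x =
      -(d * ∫ x, φ'' (H x) * K x ^ 2) := by
  obtain ⟨B, hB⟩ := h.exists_bound hp
  obtain ⟨D, hD, hD'⟩ := hφ.exists_bound B
  have hH := h.continuous_H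
  have hφc := hφ.continuous₁
  have i2 := h.integrable_entropy_dissipation hp hφ
  have iL : Integrable fun x => φ' (H x) * L x := by
    refine ((h.integrable_mul_deriv2 hp).const_mul D).mono'
      ((hφc.comp hH).measurable.mul h.meas).aestronglyMeasurable (Eventually.of_forall fun x => ?_)
    rw [Real.norm_eq_abs, abs_mul, ← mul_assoc]
    exact mul_le_mul_of_nonneg_right (hD' _ (hB x)).2.1 (abs_nonneg _)
  have iK : Integrable fun x => φ' (H x) * K x := by
    refine ((h.integrable_mul_deriv hp).abs.const_mul D).mono'
      ((hφc.comp hH).mul h.continuous).aestronglyMeasurable (Eventually.of_forall fun x => ?_)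
    rw [Real.norm_eq_abs, abs_mul, abs_mul, ← mul_assoc]
    exact mul_le_mul_of_nonneg_right (hD' _ (hB x)).2.1 (abs_nonneg _)
  have iφ : Integrable fun x => φ (H x) := by
    refine ((h.integrable_sq hp).const_mul D).mono'
      (hφ.continuous₀.comp hH).aestronglyMeasurable (Eventually.of_forall fun x => ?_)
    exact (hD' _ (hB x)).2.2
  have hHac : ∀ a b, HasACDeriv H K a b := HasACDeriv.of_hasDerivAt h.hasDerivAt h.continuous
  have z1 : ∫ x, φ' (H x) * K x = 0 := HasACDeriv.integral_eq_zero
    (fun a b => (hHac a b).comp hφ.hasDerivAt hφc) iφ iK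
  have z2 : ∫ x, (φ'' (H x) * K x * K x + φ' (H x) * L x) = 0 := by
    refine HasACDeriv.integral_eq_zero
      (fun a b => ((hHac a b).comp hφ.hasDerivAt' hφ.continuous).mul (h.ac a b)) iK ?_
    refine Integrable.add ?_ iL
    simpa [sq, mul_assoc] using i2
  have z3 : ∫ x, φ' (H x) * L x = -∫ x, φ'' (H x) * K x ^ 2 := by
    have e : ∀ x, φ'' (H x) * K x * K x + φ' (H x) * L x =
        φ'' (H x) * K x ^ 2 + φ' (H x) * L x := fun x => by ring
    simp only [e] at z2
    rw [integral_add i2 iL] at z2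
    linarith
  have e : ∀ x, φ' (H x) * (d * p x * L x - c * p x * K x) / p x =
      d * (φ' (H x) * L x) - c * (φ' (H x) * K x) := fun x => by
    have := hp.pos x
    field_simp
  simp only [e]
  rw [integral_sub (iL.const_mul d) (iK.const_mul c), integral_const_mul, integral_const_mul, z1,
    z3]
  ring

end IsSlice

/-! ### Pairing a time slice with test functions -/

/-- A `C²` test function, with its first two derivatives, whose growth is compatible with the
weighted bounds on the solutions. -/
structure IsTest (p ψ ψ' ψ'' : ℝ → ℝ) : Prop where
  hasDerivAt : ∀ x, HasDerivAt ψ (ψ' x) x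
  hasDerivAt' : ∀ x, HasDerivAt ψ' (ψ'' x) x
  continuous : Continuous ψ''
  bound : ∃ C : ℝ, ∀ x, |ψ x| ≤ C * (Real.exp |x| * Real.sqrt (p x)) ∧
    |ψ' x| ≤ C * (Real.exp |x| * Real.sqrt (p x)) ∧
    |ψ'' x| ≤ C * (Real.exp |x| * Real.sqrt (p x))

theorem IsTest.continuous₀ {p ψ ψ' ψ'' : ℝ → ℝ} (h : IsTest p ψ ψ' ψ'') : Continuous ψ :=
  continuous_iff_continuousAt.2 fun s => (h.hasDerivAt s).continuousAt

theorem IsTest.continuous₁ {p ψ ψ' ψ'' : ℝ → ℝ} (h : IsTest p ψ ψ' ψ'') : Continuous ψ' :=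
  continuous_iff_continuousAt.2 fun s => (h.hasDerivAt' s).continuousAt

namespace IsSlice

variable {p H K L ψ ψ' ψ'' : ℝ → ℝ}

theorem integrable_mul_of_exp {w v : ℝ → ℝ} {C : ℝ} (hp : IsWeight p) (hw : Measurable w)
    (hv : Measurable v) (hC : ∀ x, |w x| ≤ C * (Real.exp |x| * Real.sqrt (p x)))
    (hi : Integrable fun x => Real.exp (4 * |x|) * v x ^ 2) : Integrable fun x => w x * v x := by
  have hC0 : 0 ≤ C := by
    have h1 := (abs_nonneg _).trans (hC 0)
    have h2 : 0 < Real.exp |0| * Real.sqrt (p 0) :=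
      mul_pos (Real.exp_pos _) (Real.sqrt_pos.2 (hp.pos 0))
    exact nonneg_of_mul_nonneg_left h1 h2
  have := integrable_weighted (μ := volume) (π := id) (v := v) (p := fun _ => 1) (w := w) (C := C)
    measurable_id hv.aestronglyMeasurable measurable_const (fun _ => one_pos) hw (fun x => by
      refine (hC x).trans (mul_le_mul_of_nonneg_left ?_ hC0)
      refine mul_le_mul_of_nonneg_left ?_ (Real.exp_pos _).le
      exact Real.sqrt_le_sqrt (hp.le_one x))
    (integrable_exp_neg_mul_abs (b := 2) (by norm_num)) (by simpa using hi)
  simpa using this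

/-- All derivatives are moved onto `ψ` by integrating the derivatives of `ψ H` and of `ψ K - ψ' H`.
-/
theorem integral_test (h : IsSlice p H K L) (hp : IsWeight p) (hψ : IsTest p ψ ψ' ψ'')
    (c d : ℝ) :
    ∫ x, ψ x * (d * p x * L x - c * p x * K x) / p x =
      d * (∫ x, ψ'' x * H x) + c * ∫ x, ψ' x * H x := by
  obtain ⟨C, hC⟩ := hψ.bound
  have m0 := hψ.continuous₀.measurable
  have m1 := hψ.continuous₁.measurable
  have m2 := hψ.continuous.measurable
  have mH := h.continuous_H.measurable
  have mK := h.continuous.measurable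
  have iH := h.integrable_exp_mul_sq hp
  have i1 : Integrable fun x => ψ' x * H x := integrable_mul_of_exp hp m1 mH (fun x => (hC x).2.1) iH
  have i2 : Integrable fun x => ψ'' x * H x := integrable_mul_of_exp hp m2 mH (fun x => (hC x).2.2) iH
  have i0 : Integrable fun x => ψ x * H x := integrable_mul_of_exp hp m0 mH (fun x => (hC x).1) iH
  have iK : Integrable fun x => ψ x * K x :=
    integrable_mul_of_exp hp m0 mK (fun x => (hC x).1) h.int_K
  have iK' : Integrable fun x => ψ' x * K x :=
    integrable_mul_of_exp hp m1 mK (fun x => (hC x).2.1) h.int_K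
  have iL : Integrable fun x => ψ x * L x := by
    -- Only `p L²` is controlled, so the weighted bound is applied with `1/p` in the role of `p` and
    -- `ψ/p` in the role of the weight.
    have := integrable_weighted (μ := volume) (π := id) (v := L) (p := fun x => (p x)⁻¹)
      (w := fun x => ψ x / p x) (C := C) measurable_id h.meas.aestronglyMeasurable
      hp.continuous.measurable.inv (fun x => inv_pos.2 (hp.pos x))
      (m0.div hp.continuous.measurable) (fun x => by
        have h0 := hp.pos x
        rw [abs_div, abs_of_pos h0, div_le_iff₀ h0, Real.sqrt_inv]
        refine ((hC x).1).trans (le_of_eq ?_)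
        have hs := Real.sqrt_pos.2 h0
        have e := Real.sq_sqrt h0.le
        set r := Real.sqrt (p x)
        rw [← e]
        field_simp)
      (integrable_exp_neg_mul_abs (b := 2) (by norm_num)) (by
        refine h.int_L.congr (Eventually.of_forall fun x => ?_)
        simp only [id, div_inv_eq_mul]; ring)
    refine this.congr (Eventually.of_forall fun x => ?_)
    have h0 := hp.pos x
    simp only [id]
    field_simp
  have hHac : ∀ a b, HasACDeriv H K a b := HasACDeriv.of_hasDerivAt h.hasDerivAt h.continuous
  have p0 := HasACDeriv.of_hasDerivAt hψ.hasDerivAt hψ.continuous₁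
  have p1 := HasACDeriv.of_hasDerivAt hψ.hasDerivAt' hψ.continuous
  have z1 : ∫ x, (ψ' x * H x + ψ x * K x) = 0 := HasACDeriv.integral_eq_zero
    (fun a b => (p0 a b).mul (hHac a b)) i0 (i1.add iK)
  have z2 : ∫ x, (ψ' x * K x + ψ x * L x - (ψ'' x * H x + ψ' x * K x)) = 0 :=
    HasACDeriv.integral_eq_zero
      (fun a b => ((p0 a b).mul (h.ac a b)).sub ((p1 a b).mul (hHac a b))) (iK.sub i1)
      ((iK'.add iL).sub (i2.add iK'))
  rw [integral_add i1 iK] at z1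
  have e2 : ∀ x, ψ' x * K x + ψ x * L x - (ψ'' x * H x + ψ' x * K x) =
      ψ x * L x - ψ'' x * H x := fun x => by ring
  simp only [e2] at z2
  rw [integral_sub iL i2] at z2
  have e : ∀ x, ψ x * (d * p x * L x - c * p x * K x) / p x =
      d * (ψ x * L x) - c * (ψ x * K x) := fun x => by
    have := hp.pos x
    field_simp
  simp only [e]
  rw [integral_sub (iL.const_mul d) (iK.const_mul c), integral_const_mul, integral_const_mul,
    show ∫ x, ψ x * L x = ∫ x, ψ'' x * H x by linarith,
    show ∫ x, ψ x * K x = -∫ x, ψ' x * H x by linarith]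
  ring

end IsSlice

/-! ### Integration in time -/

theorem intervalIntegrable_of_Ioo {n : ℝ → ℝ} (h0 : ∀ s, s ≤ 0 → n s = 0)
    (hi : ∀ T : ℝ, 0 < T → IntegrableOn n (Ioo 0 T)) (a b : ℝ) :
    IntervalIntegrable n volume a b := by
  have h1 : IntegrableOn n (Iic 0) :=
    (show IntegrableOn (fun _ : ℝ => (0 : ℝ)) (Iic 0) from integrableOn_zero).congr_fun (fun s hs => (h0 s hs).symm)
      measurableSet_Iic
  refine ((h1.union (hi (max (max a b) 0 + 1) (by positivity))).mono_set
    fun s hs => ?_).intervalIntegrable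
  have hs2 : s ≤ max a b := hs.2
  rcases le_or_gt s 0 with h | h
  · exact Or.inl h
  · exact Or.inr ⟨h, by linarith [le_max_left (max a b) 0]⟩

theorem ae_restrict_Ioi_of_Ioo {P : ℝ → Prop}
    (h : ∀ T : ℝ, 0 < T → ∀ᵐ t ∂volume.restrict (Ioo 0 T), P t) :
    ∀ᵐ t ∂volume.restrict (Ioi (0 : ℝ)), P t := by
  rw [ae_restrict_iff' measurableSet_Ioi]
  have h1 : ∀ n : ℕ, ∀ᵐ t : ℝ, t ∈ Ioo (0 : ℝ) (n + 1) → P t := fun n => by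
    rw [← ae_restrict_iff' measurableSet_Ioo]
    exact h _ (by positivity)
  rw [← ae_all_iff] at h1
  filter_upwards [h1] with t ht ht0
  obtain ⟨n, hn⟩ := exists_nat_gt t
  exact ht n ⟨ht0, by linarith⟩

/-- Integration over space of a family of primitives in time. -/
theorem integral_primitive {Φ Θ : ℝ → ℝ → ℝ} (h0 : ∀ x s, s ≤ 0 → Θ x s = 0)
    (hi : ∀ T : ℝ, 0 < T → Integrable (fun z : ℝ × ℝ => Θ z.1 z.2)
      (volume.prod (volume.restrict (Ioo 0 T))))
    (hΦ : ∀ᵐ x, ∀ t, Φ x t = Φ x 0 + ∫ s in (0 : ℝ)..t, Θ x s)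
    (hΦ0 : Integrable fun x => Φ x 0) :
    (∀ t, Integrable fun x => Φ x t) ∧ (∀ a b, IntervalIntegrable (fun s => ∫ x, Θ x s) volume a b) ∧
      ∀ t, ∫ x, Φ x t = (∫ x, Φ x 0) + ∫ s in (0 : ℝ)..t, ∫ x, Θ x s := by
  have key : ∀ t, Integrable (fun x => ∫ s in (0 : ℝ)..t, Θ x s) ∧
      ∫ x, ∫ s in (0 : ℝ)..t, Θ x s = ∫ s in (0 : ℝ)..t, ∫ x, Θ x s := by
    intro t
    rcases le_total 0 t with ht | ht
    · have h1 := integrable_prod_Ioc_of_Ioo (b := t) hi le_rfl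
      simp only [intervalIntegral.integral_of_le ht]
      exact ⟨h1.integral_prod_left, integral_integral_swap h1⟩
    · have e : ∀ x, ∫ s in (0 : ℝ)..t, Θ x s = 0 := fun x => by
        rw [intervalIntegral.integral_congr (g := fun _ => (0 : ℝ)) fun s hs => h0 x s ?_]
        · simp
        · rw [uIcc_of_ge ht] at hs; exact hs.2
      have e2 : ∫ s in (0 : ℝ)..t, ∫ x, Θ x s = 0 := by
        rw [intervalIntegral.integral_congr (g := fun _ => (0 : ℝ)) fun s hs => ?_]
        · simp
        · rw [uIcc_of_ge ht] at hs
          simp [h0 _ s hs.2]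
      simp only [e, e2, integral_zero]
      exact ⟨integrable_zero _ _ _, trivial⟩
  refine ⟨fun t => ?_, ?_, fun t => ?_⟩
  · refine (hΦ0.add (key t).1).congr ?_
    filter_upwards [hΦ] with x hx
    exact (hx t).symm
  · refine intervalIntegrable_of_Ioo (fun s hs => by simp [h0 _ s hs]) fun T hT => ?_
    exact (hi T hT).integral_prod_right
  · rw [← (key t).2, ← integral_add hΦ0 (key t).1]
    refine integral_congr_ae ?_
    filter_upwards [hΦ] with x hx
    exact hx t

/-! ### Entropy and test identities along a regular solution -/

namespace IsRegularSolution

variable {p c d : ℝ → ℝ} {g gt gx gxx : ℝ → ℝ → ℝ}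

theorem integrable_weight_mul_t (h : IsRegularSolution p c d g gt gx gxx) (hp : IsWeight p)
    {w : ℝ → ℝ} {C : ℝ} (hw : Measurable w)
    (hC : ∀ x, |w x| ≤ C * (Real.exp |x| * Real.sqrt (p x))) {T : ℝ} (hT : 0 < T) :
    Integrable (fun z : ℝ × ℝ => w z.1 * gt z.1 z.2 / p z.1)
      (volume.prod (volume.restrict (Ioo 0 T))) :=
  integrable_weighted measurable_fst h.meas_t.aestronglyMeasurable hp.continuous.measurable hp.pos hw hC
    integrable_exp_prod (h.int_t T hT)

theorem ae_intervalIntegrable (h : IsRegularSolution p c d g gt gx gxx) (hp : IsWeight p) :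
    ∀ᵐ x, ∀ a b, IntervalIntegrable (gt x) volume a b := by
  have h1 : ∀ n : ℕ, ∀ᵐ x, IntegrableOn (gt x) (Ioo 0 ((n : ℝ) + 1)) := fun n => by
    have := (h.integrable_weight_mul_t hp hp.continuous.measurable
      (abs_le_exp_mul_sqrt hp.pos hp.le_one) (T := (n : ℝ) + 1) (by positivity)).prod_right_ae
    filter_upwards [this] with x hx
    refine hx.congr (Eventually.of_forall fun s => ?_)
    have := hp.pos x
    simp only
    field_simp
  rw [← ae_all_iff] at h1
  filter_upwards [h1] with x hx
  refine intervalIntegrable_of_Ioo (h.gt_neg x) fun T hT => ?_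
  obtain ⟨n, hn⟩ := exists_nat_gt T
  exact (hx n).mono_set (Ioo_subset_Ioo_right (by linarith))

theorem ae_hasACDeriv (h : IsRegularSolution p c d g gt gx gxx) (hp : IsWeight p) :
    ∀ᵐ x, ∀ a b, HasACDeriv (g x) (gt x) a b := by
  filter_upwards [h.ae_intervalIntegrable hp] with x hx
  exact HasACDeriv.of_primitive hx (h.time x)

theorem weight_pairing (h : IsRegularSolution p c d g gt gx gxx) (hp : IsWeight p)
    {w : ℝ → ℝ} {C : ℝ} (hw : Measurable w)
    (hC : ∀ x, |w x| ≤ C * (Real.exp |x| * Real.sqrt (p x))) :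
    (∀ t, Integrable fun x => w x * g x t / p x) ∧
    (∀ a b, IntervalIntegrable (fun s => ∫ x, w x * gt x s / p x) volume a b) ∧
    ∀ t, ∫ x, w x * g x t / p x = (∫ x, w x * g x 0 / p x) +
      ∫ s in (0 : ℝ)..t, ∫ x, w x * gt x s / p x := by
  refine integral_primitive (Φ := fun x t => w x * g x t / p x)
    (Θ := fun x s => w x * gt x s / p x) (fun x s hs => by simp [h.gt_neg x s hs])
    (fun T hT => h.integrable_weight_mul_t hp hw hC hT) (Eventually.of_forall fun x t => ?_) ?_
  · simp only [mul_div_right_comm, intervalIntegral.integral_const_mul]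
    rw [← mul_add, h.time x t]
  · have hm : Measurable fun x => g x 0 := h.meas.comp (by fun_prop : Measurable fun x : ℝ => (x, (0 : ℝ)))
    exact integrable_weighted (π := id) measurable_id hm.aestronglyMeasurable
      hp.continuous.measurable hp.pos hw hC (integrable_exp_neg_mul_abs (b := 2) (by norm_num))
      h.initial

theorem continuous_weight_pairing (h : IsRegularSolution p c d g gt gx gxx) (hp : IsWeight p)
    {w : ℝ → ℝ} {C : ℝ} (hw : Measurable w)
    (hC : ∀ x, |w x| ≤ C * (Real.exp |x| * Real.sqrt (p x))) :
    Continuous fun t => ∫ x, w x * g x t / p x := by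
  obtain ⟨-, h2, h3⟩ := h.weight_pairing hp hw hC
  rw [funext h3]
  exact continuous_const.add (intervalIntegral.continuous_primitive h2 0)

theorem ae_isSlice (h : IsRegularSolution p c d g gt gx gxx) :
    ∀ᵐ t ∂volume.restrict (Ioi (0 : ℝ)), ∃ H K : ℝ → ℝ, IsSlice p H K (fun x => gxx x t) ∧
      (∀ᵐ x, H x = g x t) ∧ (∀ᵐ x, K x = gx x t) ∧
      ∀ᵐ x, gt x t = d t * p x * gxx x t - c t * p x * K x := by
  have h1 : ∀ᵐ t ∂volume.restrict (Ioi (0 : ℝ)),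
      (Integrable fun x => Real.exp (4 * |x|) * g x t ^ 2 / p x) ∧
      (Integrable fun x => Real.exp (4 * |x|) * gx x t ^ 2) := by
    refine ae_restrict_Ioi_of_Ioo fun T hT => ?_
    obtain ⟨C, hC⟩ := h.bound T hT
    filter_upwards [hC] with t ht using ⟨ht.1.1, ht.2.1⟩
  have h2 : ∀ᵐ t ∂volume.restrict (Ioi (0 : ℝ)),
      Integrable fun x => Real.exp (4 * |x|) * p x * gxx x t ^ 2 :=
    ae_restrict_Ioi_of_Ioo fun T hT => (h.int_xx T hT).prod_left_ae
  filter_upwards [h.space, h1, h2, ae_ae_swap h.eqn] with t ⟨H, K, hH, hK, hd, hc, hac⟩ hi hxx heq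
  refine ⟨H, K, ⟨hd, hc, hac, ?_, ?_, ?_, hxx⟩, hH, hK, ?_⟩
  · exact h.meas_xx.comp (by fun_prop : Measurable fun x : ℝ => (x, t))
  · refine hi.1.congr ?_
    filter_upwards [hH] with x hx
    rw [hx]
  · refine hi.2.congr ?_
    filter_upwards [hK] with x hx
    rw [hx]
  · filter_upwards [heq, hK] with x h1 h2
    rw [h1, h2]

/-- The time primitive of the pairing has integrand `∫ ψ gt / p`, which the slice identity evaluates
for almost every time. -/
theorem pairing_sub (h : IsRegularSolution p c d g gt gx gxx) (hp : IsWeight p)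
    {ψ ψ' ψ'' : ℝ → ℝ} (hψ : IsTest p ψ ψ' ψ'') {s t : ℝ} (hs : 0 ≤ s) (hst : s ≤ t) :
    IntervalIntegrable (fun r => d r * (∫ x, ψ'' x * g x r) + c r * ∫ x, ψ' x * g x r) volume s t ∧
    (∫ x, ψ x * g x t / p x) - ∫ x, ψ x * g x s / p x =
      ∫ r in s..t, (d r * (∫ x, ψ'' x * g x r) + c r * ∫ x, ψ' x * g x r) := by
  obtain ⟨C, hC⟩ := hψ.bound
  obtain ⟨-, h2, h3⟩ := h.weight_pairing hp hψ.continuous₀.measurable fun x => (hC x).1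
  have e : ∀ᵐ r, r ∈ uIoc s t → ∫ x, ψ x * gt x r / p x =
      d r * (∫ x, ψ'' x * g x r) + c r * ∫ x, ψ' x * g x r := by
    have := h.ae_isSlice
    rw [ae_restrict_iff' measurableSet_Ioi] at this
    filter_upwards [this] with r hr hrst
    rw [uIoc_of_le hst] at hrst
    obtain ⟨H, K, hsl, hH, hK, heq⟩ := hr (lt_of_le_of_lt hs hrst.1)
    rw [show ∫ x, ψ'' x * g x r = ∫ x, ψ'' x * H x from integral_congr_ae (by
      filter_upwards [hH] with x hx; rw [hx]),
      show ∫ x, ψ' x * g x r = ∫ x, ψ' x * H x from integral_congr_ae (by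
      filter_upwards [hH] with x hx; rw [hx]), ← hsl.integral_test hp hψ]
    refine integral_congr_ae ?_
    filter_upwards [heq] with x hx
    rw [hx]
  refine ⟨(h2 s t).congr_ae ((ae_restrict_iff' measurableSet_uIoc).2 e), ?_⟩
  rw [h3 t, h3 s, ← intervalIntegral.integral_congr_ae e,
    ← intervalIntegral.integral_add_adjacent_intervals (h2 0 s) (h2 s t)]
  ring

theorem integrable_sq_prod (h : IsRegularSolution p c d g gt gx gxx) (hp : IsWeight p) {T : ℝ}
    (hT : 0 < T) : Integrable (fun z : ℝ × ℝ => Real.exp (4 * |z.1|) * g z.1 z.2 ^ 2 / p z.1)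
      (volume.prod (volume.restrict (Ioo 0 T))) := by
  have hm := h.meas
  have hpm := hp.continuous.measurable
  have hm2 : Measurable fun z : ℝ × ℝ => Real.exp (4 * |z.1|) * g z.1 z.2 ^ 2 / p z.1 := by
    fun_prop
  obtain ⟨C, hC⟩ := h.bound T hT
  rw [integrable_prod_iff' hm2.aestronglyMeasurable]
  refine ⟨by filter_upwards [hC] with t ht using ht.1.1, ?_⟩
  refine (integrable_const C).mono' hm2.stronglyMeasurable.norm.integral_prod_left'.aestronglyMeasurable ?_
  filter_upwards [hC] with t ht
  rw [Real.norm_of_nonneg (integral_nonneg fun x => norm_nonneg _)]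
  refine le_trans (le_of_eq (integral_congr_ae (Eventually.of_forall fun x => ?_))) ht.1.2
  have := hp.pos x
  exact Real.norm_of_nonneg (by positivity)

/-- The weighted energy bounds are uniform on `(0, T)`, and `sq_le` turns them into a supremum bound
on almost every slice. Fubini exchanges the order of "almost every", and continuity in time carries
the bound to `t = 0`. -/
theorem exists_bound (h : IsRegularSolution p c d g gt gx gxx) (hp : IsWeight p) {T : ℝ}
    (hT : 0 < T) : ∃ B, (∀ᵐ z ∂(volume : Measure ℝ).prod (volume.restrict (Ioo 0 T)),
      |g z.1 z.2| ≤ B) ∧ ∀ᵐ x, |g x 0| ≤ B := by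
  obtain ⟨C, hC⟩ := h.bound T hT
  have hm := h.meas
  have hs := ae_restrict_of_ae_restrict_of_subset (s := Ioo 0 T) Ioo_subset_Ioi_self h.ae_isSlice
  have h1 : ∀ᵐ t ∂volume.restrict (Ioo 0 T), ∀ᵐ x, |g x t| ≤ Real.sqrt (2 * (C + C)) := by
    filter_upwards [hC, hs] with t ht ⟨H, K, hsl, hH, hK, _⟩
    have b1 : ∫ x, H x ^ 2 ≤ C := by
      refine le_trans (integral_mono_ae (hsl.integrable_sq hp) ht.1.1 ?_) ht.1.2
      filter_upwards [hH] with x hx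
      rw [hx]
      have := hp.pos x
      rw [mul_div_assoc]
      calc g x t ^ 2 ≤ g x t ^ 2 / p x := le_div_self (by positivity) this (hp.le_one x)
        _ ≤ _ := le_mul_of_one_le_left (by positivity) (IsSlice.one_le_exp_abs x)
    have b2 : ∫ x, K x ^ 2 ≤ C := by
      refine le_trans (integral_mono_ae hsl.integrable_deriv_sq ht.2.1 ?_) ht.2.2
      filter_upwards [hK] with x hx
      rw [hx]
      exact le_mul_of_one_le_left (by positivity) (IsSlice.one_le_exp_abs x)
    have b3 : ∫ x, |H x * K x| ≤ C + C := by
      refine le_trans ?_ (add_le_add b1 b2)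
      rw [← integral_add (hsl.integrable_sq hp) hsl.integrable_deriv_sq]
      refine integral_mono (hsl.integrable_mul_deriv hp).abs
        ((hsl.integrable_sq hp).add hsl.integrable_deriv_sq) fun x => ?_
      simp only [abs_mul]
      nlinarith [sq_nonneg (|H x| - |K x|), sq_abs (H x), sq_abs (K x), sq_nonneg (H x),
        sq_nonneg (K x)]
    filter_upwards [hH] with x hx
    rw [← hx]
    exact Real.abs_le_sqrt ((hsl.sq_le hp x).trans (by linarith))
  have h2 : ∀ᵐ z ∂(volume.restrict (Ioo 0 T)).prod (volume : Measure ℝ),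
      |g z.2 z.1| ≤ Real.sqrt (2 * (C + C)) :=
    (Measure.ae_prod_iff_ae_ae (measurableSet_le (by fun_prop) measurable_const)).2 h1
  have h3 : ∀ᵐ z ∂(volume : Measure ℝ).prod (volume.restrict (Ioo 0 T)),
      |g z.1 z.2| ≤ Real.sqrt (2 * (C + C)) :=
    (Measure.measurePreserving_swap (μ := (volume : Measure ℝ))
      (ν := volume.restrict (Ioo 0 T))).quasiMeasurePreserving.ae h2
  refine ⟨_, h3, ?_⟩
  filter_upwards [Measure.ae_ae_of_ae_prod h3, h.ae_hasACDeriv hp] with x h4 h5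
  have hc : ContinuousOn (g x) (uIcc 0 T) := (h5 0 T).ac.continuousOn
  have h6 : ∀ᵐ t ∂volume.restrict (Ioi (0 : ℝ)), t < T → |g x t| ≤ Real.sqrt (2 * (C + C)) := by
    rw [ae_restrict_iff' measurableSet_Ioo] at h4
    rw [ae_restrict_iff' measurableSet_Ioi]
    filter_upwards [h4] with t ht h0 hT using ht ⟨h0, hT⟩
  have h7 := (frequently_nhdsGT_of_ae h6).and_eventually (Ioo_mem_nhdsGT hT)
  have h8 : Tendsto (g x) (𝓝[>] 0) (𝓝 (g x 0)) := by
    have := (hc 0 left_mem_uIcc).tendsto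
    rw [uIcc_of_le hT.le] at this
    refine this.mono_left ?_
    rw [← nhdsWithin_Ioo_eq_nhdsGT hT]
    exact nhdsWithin_mono _ Ioo_subset_Icc_self
  have h9 : IsClosed {y : ℝ | |y| ≤ Real.sqrt (2 * (C + C))} :=
    isClosed_le continuous_abs continuous_const
  exact h9.mem_of_frequently_of_tendsto (h7.mono fun t ht => ht.1 ht.2.2) h8

/-- The chain rule in time for fixed `x`, then Fubini, then `integral_entropy` on almost every
slice. The supremum bound makes `|φ'(g)| ≤ D |g|`, which supplies the domination for Fubini. -/
theorem entropy_pairing (h : IsRegularSolution p c d g gt gx gxx) (hp : IsWeight p)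
    {φ φ' φ'' : ℝ → ℝ} (hφ : IsEntropy φ φ' φ'') :
    (∀ t, Integrable fun x => φ (g x t) / p x) ∧ ∀ s t, 0 ≤ s → s ≤ t →
      IntervalIntegrable (fun r => d r * ∫ x, φ'' (g x r) * gx x r ^ 2) volume s t ∧
      (∫ x, φ (g x t) / p x) - ∫ x, φ (g x s) / p x =
        -∫ r in s..t, d r * ∫ x, φ'' (g x r) * gx x r ^ 2 := by
  have hpm := hp.continuous.measurable
  have hm := h.meas
  have hmt := h.meas_t
  have m0 := hφ.continuous₀.measurable
  have m1 := hφ.continuous₁.measurable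
  have hprim := integral_primitive (Φ := fun x t => φ (g x t) / p x)
    (Θ := fun x s => φ' (g x s) * gt x s / p x) (fun x s hs => by simp [h.gt_neg x s hs]) ?_ ?_ ?_
  · obtain ⟨h1, h2, h3⟩ := hprim
    refine ⟨h1, fun s t hs hst => ?_⟩
    have e : ∀ᵐ r, r ∈ uIoc s t → ∫ x, φ' (g x r) * gt x r / p x =
        -(d r * ∫ x, φ'' (g x r) * gx x r ^ 2) := by
      have := h.ae_isSlice
      rw [ae_restrict_iff' measurableSet_Ioi] at this
      filter_upwards [this] with r hr hrst
      rw [uIoc_of_le hst] at hrst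
      obtain ⟨H, K, hsl, hH, hK, heq⟩ := hr (lt_of_le_of_lt hs hrst.1)
      rw [show ∫ x, φ'' (g x r) * gx x r ^ 2 = ∫ x, φ'' (H x) * K x ^ 2 from
        integral_congr_ae (by filter_upwards [hH, hK] with x hx hx'; rw [hx, hx']),
        ← hsl.integral_entropy hp hφ (c r)]
      refine integral_congr_ae ?_
      filter_upwards [heq, hH] with x hx hx'
      rw [hx, hx']
    refine ⟨?_, ?_⟩
    · have := ((h2 s t).congr_ae ((ae_restrict_iff' measurableSet_uIoc).2 e)).neg
      exact this.congr_ae (Eventually.of_forall fun r => by simp)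
    · rw [← intervalIntegral.integral_neg, ← intervalIntegral.integral_congr_ae e, h3 t, h3 s,
        ← intervalIntegral.integral_add_adjacent_intervals (h2 0 s) (h2 s t)]
      ring
  · intro T hT
    obtain ⟨B, hB, -⟩ := h.exists_bound hp hT
    obtain ⟨D, hD, hD'⟩ := hφ.exists_bound B
    have mm : Measurable fun z : ℝ × ℝ => φ' (g z.1 z.2) * gt z.1 z.2 / p z.1 := by fun_prop
    refine (((h.integrable_sq_prod hp hT).add (h.int_t T hT)).const_mul D).mono'
      mm.aestronglyMeasurable ?_
    filter_upwards [hB] with z hz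
    have h0 := hp.pos z.1
    have h1 := IsSlice.one_le_exp_abs z.1
    have h2 := (hD' _ hz).2.1
    rw [Real.norm_eq_abs, abs_div, abs_mul, abs_of_pos h0]
    simp only [Pi.add_apply]
    rw [← add_div, ← mul_div_assoc]
    refine div_le_div_of_nonneg_right ?_ h0.le
    set a := g z.1 z.2
    set b := gt z.1 z.2
    calc |φ' a| * |b| ≤ D * |a| * |b| := mul_le_mul_of_nonneg_right h2 (abs_nonneg _)
      _ = D * (|a| * |b|) := by ring
      _ ≤ D * (Real.exp (4 * |z.1|) * a ^ 2 + Real.exp (4 * |z.1|) * b ^ 2) := by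
        refine mul_le_mul_of_nonneg_left ?_ hD
        rw [← mul_add]
        have : |a| * |b| ≤ a ^ 2 + b ^ 2 := by
          nlinarith [sq_nonneg (|a| - |b|), sq_abs a, sq_abs b, sq_nonneg a, sq_nonneg b]
        exact this.trans (le_mul_of_one_le_left (by positivity) h1)
  · filter_upwards [h.ae_hasACDeriv hp] with x hx t
    have := ((hx 0 t).comp hφ.hasDerivAt hφ.continuous₁).integral_eq
    rw [intervalIntegral.integral_div, this]
    ring
  · obtain ⟨B, -, hB⟩ := h.exists_bound hp one_pos
    obtain ⟨D, hD, hD'⟩ := hφ.exists_bound B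
    have hm0 : Measurable fun x => g x 0 :=
      h.meas.comp (by fun_prop : Measurable fun x : ℝ => (x, (0 : ℝ)))
    have mm : Measurable fun x => φ (g x 0) / p x := by fun_prop
    refine (h.initial.const_mul D).mono' mm.aestronglyMeasurable ?_
    filter_upwards [hB] with x hx
    have h0 := hp.pos x
    rw [Real.norm_eq_abs, abs_div, abs_of_pos h0, ← mul_div_assoc]
    refine div_le_div_of_nonneg_right ((hD' _ hx).2.2.trans ?_) h0.le
    refine mul_le_mul_of_nonneg_left ?_ hD
    exact le_mul_of_one_le_left (by positivity) (IsSlice.one_le_exp_abs x)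

end IsRegularSolution

/-! ### Entropies and the comparison principle -/

theorem hasDerivAt_max_zero_pow (n : ℕ) (y : ℝ) :
    HasDerivAt (fun y : ℝ => max y 0 ^ (n + 2)) ((n + 2) * max y 0 ^ (n + 1)) y := by
  rcases lt_trichotomy y 0 with h | rfl | h
  · rw [max_eq_right h.le]
    simp only [ne_eq, Nat.add_eq_zero_iff, one_ne_zero, and_false, not_false_eq_true, zero_pow,
      mul_zero]
    refine (hasDerivAt_const y (0 : ℝ)).congr_of_eventuallyEq ?_
    filter_upwards [Iio_mem_nhds h] with z hz
    rw [max_eq_right (le_of_lt hz)]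
    simp
  · rw [hasDerivAt_iff_isLittleO]
    simp only [max_self, ne_eq, Nat.add_eq_zero_iff, OfNat.ofNat_ne_zero, and_false,
      not_false_eq_true, zero_pow, sub_zero, one_ne_zero, mul_zero, smul_eq_mul]
    refine Asymptotics.IsBigO.trans_isLittleO (g := fun z : ℝ => z ^ (n + 2)) ?_
      (Asymptotics.isLittleO_pow_id (by omega))
    refine Asymptotics.IsBigO.of_bound 1 (Eventually.of_forall fun z => ?_)
    rw [one_mul, norm_pow, norm_pow]
    gcongr
    rw [Real.norm_of_nonneg (le_max_right _ _), Real.norm_eq_abs]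
    exact max_le (le_abs_self z) (abs_nonneg z)
  · rw [max_eq_left h.le]
    have := hasDerivAt_pow (n + 2) y
    push_cast at this
    refine HasDerivAt.congr_of_eventuallyEq (by simpa using this) ?_
    filter_upwards [Ioi_mem_nhds h] with z hz
    rw [max_eq_left (le_of_lt hz)]

theorem isEntropy_sq : IsEntropy (fun s => s ^ 2) (fun s => 2 * s) (fun _ => 2) where
  hasDerivAt s := by simpa using hasDerivAt_pow 2 s
  hasDerivAt' s := by simpa using (hasDerivAt_id s).const_mul 2
  continuous := continuous_const
  zero := by simp
  zero' := by simp

/-- A cube rather than a square, so that the second derivative is continuous. The condition on `k`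
makes the entropy vanish to second order at zero. -/
theorem isEntropy_pos_cube {k : ℝ} (hk : 0 ≤ k) :
    IsEntropy (fun s => max (s - k) 0 ^ 3) (fun s => 3 * max (s - k) 0 ^ 2)
      (fun s => 6 * max (s - k) 0) where
  hasDerivAt s := by
    have := (hasDerivAt_max_zero_pow 1 (s - k)).comp_sub_const s k
    convert! this using 1
    norm_num
  hasDerivAt' s := by
    have := ((hasDerivAt_max_zero_pow 0 (s - k)).comp_sub_const s k).const_mul 3
    convert! this using 1
    norm_num; ring
  continuous := by fun_prop
  zero := by simp [hk]
  zero' := by simp [hk]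

theorem isEntropy_neg_cube :
    IsEntropy (fun s => max (-s) 0 ^ 3) (fun s => -(3 * max (-s) 0 ^ 2))
      (fun s => 6 * max (-s) 0) where
  hasDerivAt s := by
    have := (hasDerivAt_max_zero_pow 1 (-s)).comp s (hasDerivAt_neg s)
    convert! this using 1
    norm_num
  hasDerivAt' s := by
    have := (((hasDerivAt_max_zero_pow 0 (-s)).comp s (hasDerivAt_neg s)).const_mul 3).neg
    convert! this using 1
    norm_num; ring
  continuous := by fun_prop
  zero := by simp
  zero' := by simp

namespace IsRegularSolution

variable {p c d : ℝ → ℝ} {g gt gx gxx : ℝ → ℝ → ℝ}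

theorem entropy_antitone (h : IsRegularSolution p c d g gt gx gxx) (hp : IsWeight p)
    {φ φ' φ'' : ℝ → ℝ} (hφ : IsEntropy φ φ' φ'') (hconv : ∀ s, 0 ≤ φ'' s) {s t : ℝ} (hs : 0 ≤ s)
    (hst : s ≤ t) (hd : ∀ r ∈ Ioo s t, 0 ≤ d r) :
    ∫ x, φ (g x t) / p x ≤ ∫ x, φ (g x s) / p x := by
  have h1 := ((h.entropy_pairing hp hφ).2 s t hs hst).2
  have h2 : 0 ≤ ∫ r in s..t, d r * ∫ x, φ'' (g x r) * gx x r ^ 2 := by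
    refine intervalIntegral.integral_nonneg_of_ae_restrict hst ?_
    rw [← restrict_Ioo_eq_restrict_Icc]
    filter_upwards [ae_restrict_mem measurableSet_Ioo] with r hr
    exact mul_nonneg (hd r hr) (integral_nonneg fun x => mul_nonneg (hconv _) (sq_nonneg _))
  linarith

/-- A nonnegative convex entropy that starts with zero integral keeps zero integral. With the two
cubes this is the comparison principle. -/
theorem entropy_eq_zero (h : IsRegularSolution p c d g gt gx gxx) (hp : IsWeight p)
    {φ φ' φ'' : ℝ → ℝ} (hφ : IsEntropy φ φ' φ'') (hconv : ∀ s, 0 ≤ φ'' s) (hpos : ∀ s, 0 ≤ φ s)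
    {s t : ℝ} (hs : 0 ≤ s) (hst : s ≤ t) (hd : ∀ r ∈ Ioo s t, 0 ≤ d r)
    (h0 : ∀ᵐ x, φ (g x s) = 0) : ∀ᵐ x, φ (g x t) = 0 := by
  have h1 := h.entropy_antitone hp hφ hconv hs hst hd
  have h2 : ∫ x, φ (g x s) / p x = 0 := by
    rw [integral_congr_ae (g := fun _ => (0 : ℝ)) (by filter_upwards [h0] with x hx; simp [hx])]
    simp
  have hnn : ∀ x, 0 ≤ φ (g x t) / p x := fun x => div_nonneg (hpos _) (hp.pos x).le
  have h3 : ∫ x, φ (g x t) / p x = 0 := le_antisymm (h1.trans h2.le) (integral_nonneg hnn)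
  rw [integral_eq_zero_iff_of_nonneg hnn ((h.entropy_pairing hp hφ).1 t)] at h3
  filter_upwards [h3] with x hx
  have := (hp.pos x).ne'
  simpa [this] using hx

theorem nonneg_of_initial (h : IsRegularSolution p c d g gt gx gxx) (hp : IsWeight p) {t : ℝ}
    (ht : 0 ≤ t) (hd : ∀ r ∈ Ioo 0 t, 0 ≤ d r) (h0 : ∀ᵐ x, 0 ≤ g x 0) : ∀ᵐ x, 0 ≤ g x t := by
  have := h.entropy_eq_zero hp isEntropy_neg_cube (fun s => by positivity) (fun s => by positivity)
    le_rfl ht hd (by filter_upwards [h0] with x hx; simp [hx])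
  filter_upwards [this] with x hx
  simpa using pow_eq_zero_iff (n := 3) (by norm_num) |>.1 hx

theorem le_of_le (h : IsRegularSolution p c d g gt gx gxx) (hp : IsWeight p) {k s t : ℝ}
    (hk : 0 ≤ k) (hs : 0 ≤ s) (hst : s ≤ t) (hd : ∀ r ∈ Ioo s t, 0 ≤ d r)
    (h0 : ∀ᵐ x, g x s ≤ k) : ∀ᵐ x, g x t ≤ k := by
  have := h.entropy_eq_zero hp (isEntropy_pos_cube hk) (fun s => by positivity)
    (fun s => by positivity) hs hst hd (by filter_upwards [h0] with x hx; simp [hx])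
  filter_upwards [this] with x hx
  simpa using pow_eq_zero_iff (n := 3) (by norm_num) |>.1 hx

end IsRegularSolution

/-! ### Conservation of mass -/

/-- On the compact support the positive continuous function `√p` is bounded below, so the growth
condition is automatic even if `inf p = 0`. -/
theorem IsTest.of_hasCompactSupport {p ψ : ℝ → ℝ} (hp : IsWeight p) (hψ : ContDiff ℝ ∞ ψ)
    (hc : HasCompactSupport ψ) : IsTest p ψ (deriv ψ) (deriv (deriv ψ)) := by
  have h1 : ContDiff ℝ ∞ (deriv ψ) := (contDiff_infty_iff_deriv.1 hψ).2
  have h2 : ContDiff ℝ ∞ (deriv (deriv ψ)) := (contDiff_infty_iff_deriv.1 h1).2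
  have bd : ∀ f : ℝ → ℝ, Continuous f → HasCompactSupport f →
      ∃ C, ∀ x, |f x| ≤ C * (Real.exp |x| * Real.sqrt (p x)) := by
    intro f hf hfc
    have hs : ∀ x, 0 < Real.sqrt (p x) := fun x => Real.sqrt_pos.2 (hp.pos x)
    have hpc := hp.continuous
    obtain ⟨C, hC⟩ := Continuous.bounded_above_of_compact_support (f := fun x => f x * (Real.sqrt (p x))⁻¹)
      (hf.mul ((Real.continuous_sqrt.comp hpc).inv₀ fun x => (hs x).ne')) hfc.mul_right
    refine ⟨C, fun x => ?_⟩
    have h3 := hC x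
    rw [norm_mul, norm_inv, Real.norm_eq_abs, Real.norm_of_nonneg (hs x).le,
      ← div_eq_mul_inv, div_le_iff₀ (hs x)] at h3
    have h4 : 1 ≤ Real.exp |x| := Real.one_le_exp (abs_nonneg x)
    calc |f x| ≤ C * Real.sqrt (p x) := h3
      _ ≤ Real.exp |x| * (C * Real.sqrt (p x)) :=
        le_mul_of_one_le_left ((abs_nonneg _).trans h3) h4
      _ = _ := by ring
  obtain ⟨C0, b0⟩ := bd _ hψ.continuous hc
  obtain ⟨C1, b1⟩ := bd _ h1.continuous hc.deriv
  obtain ⟨C2, b2⟩ := bd _ h2.continuous hc.deriv.deriv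
  have mono : ∀ x {a b : ℝ}, a ≤ b →
      a * (Real.exp |x| * Real.sqrt (p x)) ≤ b * (Real.exp |x| * Real.sqrt (p x)) :=
    fun x a b hab => mul_le_mul_of_nonneg_right hab (by positivity)
  exact ⟨fun x => (hψ.differentiable (by simp) x).hasDerivAt,
    fun x => (h1.differentiable (by simp) x).hasDerivAt, h2.continuous, max C0 (max C1 C2),
    fun x => ⟨(b0 x).trans (mono x (le_max_left _ _)),
      (b1 x).trans (mono x ((le_max_left _ _).trans (le_max_right _ _))),
      (b2 x).trans (mono x ((le_max_right _ _).trans (le_max_right _ _)))⟩⟩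

/-- Cutoff functions: equal to one on `[-(n+1), n+1]`, with derivatives of order `1 / (n + 1)`. -/
theorem exists_cutoff : ∃ (ψ : ℕ → ℝ → ℝ) (C : ℝ), (∀ n, ContDiff ℝ ∞ (ψ n)) ∧
    (∀ n, HasCompactSupport (ψ n)) ∧ (∀ n x, ψ n x ∈ Icc (0 : ℝ) 1) ∧
    (∀ (n : ℕ) x, |x| ≤ (n : ℝ) + 1 → ψ n x = 1) ∧
    (∀ (n : ℕ) x, |deriv (ψ n) x| ≤ C * ((n : ℝ) + 1)⁻¹) ∧
    ∀ (n : ℕ) x, |deriv (deriv (ψ n)) x| ≤ C * ((n : ℝ) + 1)⁻¹ := by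
  let f : ContDiffBump (0 : ℝ) := ⟨1, 2, by norm_num, by norm_num⟩
  have hf : ContDiff ℝ ∞ f := f.contDiff
  have h1 : ContDiff ℝ ∞ (deriv f) := (contDiff_infty_iff_deriv.1 hf).2
  have h2 : ContDiff ℝ ∞ (deriv (deriv f)) := (contDiff_infty_iff_deriv.1 h1).2
  obtain ⟨C1, b1⟩ := h1.continuous.bounded_above_of_compact_support f.hasCompactSupport.deriv
  obtain ⟨C2, b2⟩ := h2.continuous.bounded_above_of_compact_support f.hasCompactSupport.deriv.deriv
  let r : ℕ → ℝ := fun n => ((n : ℝ) + 1)⁻¹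
  have hr : ∀ n, 0 < r n := fun n => by positivity
  have hr1 : ∀ n, r n ≤ 1 := fun n => inv_le_one_of_one_le₀ (by simp)
  have d1 : ∀ n, deriv (fun x => f (r n * x)) = fun x => r n * deriv f (r n * x) := fun n => by
    funext x
    have := ((hf.differentiable (by simp) (r n * x)).hasDerivAt).comp x
      ((hasDerivAt_id x).const_mul (r n))
    refine this.deriv.trans ?_
    ring
  have d2 : ∀ n, deriv (fun x => r n * deriv f (r n * x)) =
      fun x => r n * (r n * deriv (deriv f) (r n * x)) := fun n => by
    funext x
    have := (((h1.differentiable (by simp) (r n * x)).hasDerivAt).comp x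
      ((hasDerivAt_id x).const_mul (r n))).const_mul (r n)
    refine this.deriv.trans ?_
    ring
  refine ⟨fun n x => f (r n * x), max C1 C2, fun n => hf.comp (contDiff_const.mul contDiff_id),
    fun n => ?_, fun n x => ⟨f.nonneg, f.le_one⟩, fun n x hx => ?_, fun n x => ?_, fun n x => ?_⟩
  · exact f.hasCompactSupport.comp_homeomorph (Homeomorph.mulLeft₀ (r n) (hr n).ne')
  · refine f.one_of_mem_closedBall ?_
    rw [mem_closedBall_zero_iff, Real.norm_eq_abs, abs_mul, abs_of_pos (hr n)]
    show r n * |x| ≤ 1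
    calc r n * |x| ≤ r n * ((n : ℝ) + 1) := mul_le_mul_of_nonneg_left hx (hr n).le
      _ = 1 := inv_mul_cancel₀ (by positivity)
  · rw [d1, abs_mul, abs_of_pos (hr n), mul_comm]
    exact mul_le_mul_of_nonneg_right ((b1 _).trans (le_max_left _ _)) (hr n).le
  · rw [d1, d2, abs_mul, abs_mul, abs_of_pos (hr n), mul_comm]
    have h3 : |deriv (deriv f) (r n * x)| ≤ max C1 C2 := (b2 _).trans (le_max_right _ _)
    -- The second derivative scales like the square of `1 / (n + 1)`; one factor is all that is
    -- needed.
    refine mul_le_mul_of_nonneg_right ?_ (hr n).le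
    calc r n * |deriv (deriv f) (r n * x)| ≤ 1 * |deriv (deriv f) (r n * x)| :=
          mul_le_mul_of_nonneg_right (hr1 n) (abs_nonneg _)
      _ ≤ _ := by rwa [one_mul]

namespace IsRegularSolution

variable {p c d : ℝ → ℝ} {g gt gx gxx : ℝ → ℝ → ℝ}

theorem integrable_slice (h : IsRegularSolution p c d g gt gx gxx) (hp : IsWeight p) (t : ℝ) :
    Integrable fun x => g x t := by
  refine ((h.weight_pairing hp hp.continuous.measurable
    (abs_le_exp_mul_sqrt hp.pos hp.le_one)).1 t).congr (Eventually.of_forall fun x => ?_)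
  have := hp.pos x
  simp only
  field_simp

theorem continuous_alpha (h : IsRegularSolution p c d g gt gx gxx) (hp : IsWeight p) :
    Continuous (alpha g) := by
  refine (h.continuous_weight_pairing hp hp.continuous.measurable
    (abs_le_exp_mul_sqrt hp.pos hp.le_one)).congr fun t => ?_
  refine integral_congr_ae (Eventually.of_forall fun x => ?_)
  have := hp.pos x
  simp only
  field_simp

/-- Tested with cutoffs, the mass changes by `O(1/n)`, because `ψₙ'` and `ψₙ''` are of that order
and `∫ g` is integrable over bounded times. -/
theorem mass (h : IsRegularSolution p c d g gt gx gxx) (hp : IsWeight p) (hc : Continuous c)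
    (hd : Continuous d) {t : ℝ} (ht : 0 ≤ t) (hnn : ∀ r ∈ Icc 0 t, ∀ᵐ x, 0 ≤ g x r)
    (hi : Integrable fun x => g x 0 / p x) :
    (Integrable fun x => g x t / p x) ∧ ∫ x, g x t / p x = ∫ x, g x 0 / p x := by
  obtain ⟨ψ, C, h1, h2, h3, h4, h5, h6⟩ := exists_cutoff
  have hα := h.continuous_alpha hp
  have pt : ∀ x, Tendsto (fun n => ψ n x) atTop (𝓝 1) := fun x => by
    refine tendsto_const_nhds.congr' ?_
    obtain ⟨N, hN⟩ := exists_nat_gt |x|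
    filter_upwards [eventually_ge_atTop N] with n hn
    have : (N : ℝ) ≤ n := by exact_mod_cast hn
    rw [h4 n x (by linarith)]
  have ptf : ∀ r x, Tendsto (fun n => ψ n x * g x r / p x) atTop (𝓝 (g x r / p x)) := fun r x => by
    simpa using ((pt x).mul_const (g x r)).div_const (p x)
  have slice_meas : ∀ r, Measurable fun x => g x r := fun r =>
    h.meas.comp (by fun_prop : Measurable fun x : ℝ => (x, r))
  have dom : ∀ r, (Integrable fun x => g x r / p x) →
      Tendsto (fun n => ∫ x, ψ n x * g x r / p x) atTop (𝓝 (∫ x, g x r / p x)) := by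
    intro r hr
    refine tendsto_integral_of_dominated_convergence (fun x => ‖g x r / p x‖) (fun n => ?_) hr.norm
      (fun n => Eventually.of_forall fun x => ?_) (Eventually.of_forall (ptf r))
    · exact (((h1 n).continuous.measurable.mul (slice_meas r)).div
        hp.continuous.measurable).aestronglyMeasurable
    · rw [mul_div_assoc, norm_mul]
      refine mul_le_of_le_one_left (norm_nonneg _) ?_
      rw [Real.norm_of_nonneg (h3 n x).1]
      exact (h3 n x).2
  have est : ∀ n, |(∫ x, ψ n x * g x t / p x) - ∫ x, ψ n x * g x 0 / p x| ≤
      ((n : ℝ) + 1)⁻¹ * (C * ∫ r in (0 : ℝ)..t, (|d r| + |c r|) * alpha g r) := by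
    intro n
    have bd : ∀ r ∈ Icc 0 t, ∀ w : ℝ → ℝ, Continuous w → (∀ x, |w x| ≤ C * ((n : ℝ) + 1)⁻¹) →
        |∫ x, w x * g x r| ≤ C * ((n : ℝ) + 1)⁻¹ * alpha g r := by
      intro r hr w hwc hw
      rw [alpha, ← integral_const_mul]
      refine (abs_integral_le_integral_abs).trans (integral_mono_of_nonneg
        (Eventually.of_forall fun x => abs_nonneg _) ((h.integrable_slice hp r).const_mul _) ?_)
      filter_upwards [hnn r hr] with x hx
      rw [abs_mul, abs_of_nonneg hx]
      exact mul_le_mul_of_nonneg_right (hw x) hx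
    rw [(h.pairing_sub hp (IsTest.of_hasCompactSupport hp (h1 n) (h2 n)) le_rfl ht).2]
    rw [← intervalIntegral.integral_const_mul, ← intervalIntegral.integral_const_mul]
    have hcont : Continuous fun r => ((n : ℝ) + 1)⁻¹ * (C * ((|d r| + |c r|) * alpha g r)) := by
      fun_prop
    rw [← Real.norm_eq_abs]
    refine (intervalIntegral.norm_integral_le_of_norm_le ht (Eventually.of_forall fun r hr => ?_)
      (hcont.intervalIntegrable (μ := volume) 0 t))
    have hr' : r ∈ Icc 0 t := ⟨hr.1.le, hr.2⟩
    have k1 : ContDiff ℝ ∞ (deriv (ψ n)) := (contDiff_infty_iff_deriv.1 (h1 n)).2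
    have k2 : ContDiff ℝ ∞ (deriv (deriv (ψ n))) := (contDiff_infty_iff_deriv.1 k1).2
    have b1 := bd r hr' _ k1.continuous (h5 n)
    have b2 := bd r hr' _ k2.continuous (h6 n)
    calc |d r * (∫ x, deriv (deriv (ψ n)) x * g x r) + c r * ∫ x, deriv (ψ n) x * g x r|
        ≤ |d r| * |∫ x, deriv (deriv (ψ n)) x * g x r| + |c r| * |∫ x, deriv (ψ n) x * g x r| := by
          rw [← abs_mul, ← abs_mul]; exact abs_add_le _ _
      _ ≤ |d r| * (C * ((n : ℝ) + 1)⁻¹ * alpha g r) + |c r| * (C * ((n : ℝ) + 1)⁻¹ * alpha g r) := by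
          gcongr
      _ = _ := by ring
  have lim0 : Tendsto (fun n : ℕ => ((n : ℝ) + 1)⁻¹ *
      (C * ∫ r in (0 : ℝ)..t, (|d r| + |c r|) * alpha g r)) atTop (𝓝 0) := by
    have := (tendsto_one_div_add_atTop_nhds_zero_nat (𝕜 := ℝ)).mul_const
      (C * ∫ r in (0 : ℝ)..t, (|d r| + |c r|) * alpha g r)
    simpa using this
  have lim : Tendsto (fun n => ∫ x, ψ n x * g x t / p x) atTop (𝓝 (∫ x, g x 0 / p x)) := by
    have := squeeze_zero_norm (fun n => (Real.norm_eq_abs _).trans_le (est n)) lim0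
    have := this.add (dom 0 hi)
    simpa using this
  -- The weighted bounds control `g/√p` but not `g/p` when `p` degenerates, so integrability comes
  -- from Fatou and convergence of the truncated masses.
  have hint : Integrable fun x => g x t / p x := by
    refine integrable_of_tendsto (G := fun n x => ψ n x * g x t / p x)
      (Eventually.of_forall (ptf t)) (fun n => ?_) ?_
    · exact (((h1 n).continuous.measurable.mul (slice_meas t)).div
        hp.continuous.measurable).aestronglyMeasurable
    · have hn : ∀ n, ∫⁻ x, ‖ψ n x * g x t / p x‖ₑ =
          ENNReal.ofReal (∫ x, ψ n x * g x t / p x) := fun n => by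
        obtain ⟨D, hD⟩ := (IsTest.of_hasCompactSupport hp (h1 n) (h2 n)).bound
        have hin := (h.weight_pairing hp (h1 n).continuous.measurable fun x => (hD x).1).1 t
        have hpos : 0 ≤ᵐ[volume] fun x => ψ n x * g x t / p x := by
          filter_upwards [hnn t ⟨ht, le_rfl⟩] with x hx
          exact div_nonneg (mul_nonneg (h3 n x).1 hx) (hp.pos x).le
        rw [ofReal_integral_eq_lintegral_ofReal hin hpos]
        refine lintegral_congr_ae ?_
        filter_upwards [hpos] with x hx
        exact Real.enorm_of_nonneg hx
      simp only [hn]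
      have hl : Tendsto (fun n => ENNReal.ofReal (∫ x, ψ n x * g x t / p x)) atTop
          (𝓝 (ENNReal.ofReal (∫ x, g x 0 / p x))) := (ENNReal.continuous_ofReal.tendsto _).comp lim
      rw [hl.liminf_eq]
      exact ENNReal.ofReal_ne_top
  exact ⟨hint, tendsto_nhds_unique (dom t hint) lim⟩

end IsRegularSolution

/-! ### Positivity of the diffusion coefficient -/

/-- The diffusion coefficient as a function of `α`. -/
def diffusion (M Mc y : ℝ) : ℝ :=
  (M - 1) ^ 2 / 2 * ((kappa M Mc - y) ^ 2 + 1 / (M - 1) * (y * (1 - y)))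

theorem continuous_diffusion (M Mc : ℝ) : Continuous (diffusion M Mc) := by
  unfold diffusion; fun_prop

theorem kappa_mem {M Mc : ℝ} (hM : 1 < M) (hMc : Mc ∈ Ioo 1 M) : kappa M Mc ∈ Ioo 0 1 := by
  have h1 : 0 < M - 1 := by linarith
  refine ⟨div_pos (by linarith [hMc.1]) h1, ?_⟩
  rw [kappa, div_lt_one h1]
  linarith [hMc.2]

/-- Two nonnegative terms that never vanish together: the square is zero only at `y = κ`, and there
`y (1 - y) > 0` because `0 < κ < 1`. -/
theorem diffusion_pos {M Mc y : ℝ} (hM : 1 < M) (hMc : Mc ∈ Ioo 1 M) (hy : y ∈ Icc (0 : ℝ) 1) :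
    0 < diffusion M Mc y := by
  have h1 : 0 < M - 1 := by linarith
  have hk := kappa_mem hM hMc
  refine mul_pos (by positivity) ?_
  have h2 : 0 ≤ 1 / (M - 1) * (y * (1 - y)) :=
    mul_nonneg (by positivity) (mul_nonneg hy.1 (by linarith [hy.2]))
  by_cases hne : kappa M Mc = y
  · have : 0 < 1 / (M - 1) * (y * (1 - y)) := by
      rw [← hne]
      exact mul_pos (by positivity) (mul_pos hk.1 (by linarith [hk.2]))
    positivity
  · have : 0 < (kappa M Mc - y) ^ 2 := by
      have := sub_ne_zero.2 hne
      positivity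
    linarith

theorem exists_diffusion_bounds {M Mc : ℝ} (hM : 1 < M) (hMc : Mc ∈ Ioo 1 M) :
    ∃ δ D : ℝ, 0 < δ ∧ ∀ y ∈ Icc (0 : ℝ) 1, δ ≤ diffusion M Mc y ∧ diffusion M Mc y ≤ D := by
  have hc := (continuous_diffusion M Mc).continuousOn (s := Icc 0 1)
  obtain ⟨y, hy, hy'⟩ := isCompact_Icc.exists_isMinOn (nonempty_Icc.2 zero_le_one) hc
  obtain ⟨z, hz, hz'⟩ := isCompact_Icc.exists_isMaxOn (nonempty_Icc.2 zero_le_one) hc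
  exact ⟨diffusion M Mc y, diffusion M Mc z, diffusion_pos hM hMc hy,
    fun w hw => ⟨hy' hw, hz' hw⟩⟩

theorem coeffD_eq (M Mc : ℝ) (g : ℝ → ℝ → ℝ) (t : ℝ) :
    coeffD M Mc g t = diffusion M Mc (alpha g t) := rfl

/-- A continuation argument: `α` stays in `[0, 1]` if it does so as long as `D ∘ α ≥ 0`. -/
theorem mem_Icc_of_continuation {α D : ℝ → ℝ} (hα : Continuous α) (hD : Continuous D)
    (hpos : ∀ y ∈ Icc (0 : ℝ) 1, 0 < D y)
    (hstep : ∀ T : ℝ, 0 ≤ T → (∀ r ∈ Ioo 0 T, 0 ≤ D (α r)) → ∀ t ∈ Icc 0 T, α t ∈ Icc (0 : ℝ) 1)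
    {t : ℝ} (ht : 0 ≤ t) : α t ∈ Icc (0 : ℝ) 1 := by
  by_contra hne
  set S := {s : ℝ | 0 ≤ s ∧ α s ∉ Icc (0 : ℝ) 1} with hS
  have hSne : S.Nonempty := ⟨t, ht, hne⟩
  have hbdd : BddBelow S := ⟨0, fun s hs => hs.1⟩
  set t₀ := sInf S with ht₀
  have h0 : 0 ≤ t₀ := le_csInf hSne fun s hs => hs.1
  have before : ∀ r, 0 ≤ r → r < t₀ → α r ∈ Icc (0 : ℝ) 1 := fun r hr hrt => by
    by_contra hr'
    exact not_lt.2 (csInf_le hbdd ⟨hr, hr'⟩) hrt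
  have at0 : α t₀ ∈ Icc (0 : ℝ) 1 :=
    hstep t₀ h0 (fun r hr => (hpos _ (before r hr.1.le hr.2)).le) t₀ ⟨h0, le_rfl⟩
  -- Strict positivity at the infimum `t₀` of the exit times extends the sign condition past `t₀`,
  -- so `hstep` rules out exit times just after it.
  have hev : ∀ᶠ r in 𝓝 t₀, 0 < D (α r) :=
    ((hD.comp hα).tendsto t₀).eventually (lt_mem_nhds (hpos _ at0))
  obtain ⟨ε, hε, hball⟩ := Metric.eventually_nhds_iff.1 hev
  obtain ⟨s, hs, hst⟩ := exists_lt_of_csInf_lt hSne (show sInf S < t₀ + ε by linarith)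
  have hs0 : t₀ ≤ s := csInf_le hbdd hs
  refine hs.2 (hstep s hs.1 (fun r hr => ?_) s ⟨hs.1, le_rfl⟩)
  rcases lt_or_ge r t₀ with h | h
  · exact (hpos _ (before r hr.1.le h)).le
  · refine (hball ?_).le
    rw [Real.dist_eq, abs_of_nonneg (by linarith)]
    linarith [hr.2]

namespace IsRegularSolution

variable {p c d : ℝ → ℝ} {g gt gx gxx : ℝ → ℝ → ℝ} {M Mc τ : ℝ}

theorem congr_coeff (h : IsRegularSolution p c d g gt gx gxx) {c' d' : ℝ → ℝ}
    (hc : ∀ t, 0 < t → c t = c' t) (hd : ∀ t, 0 < t → d t = d' t) :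
    IsRegularSolution p c' d' g gt gx gxx := by
  refine { h with eqn := ?_ }
  have h0 : ∀ᵐ z ∂(volume : Measure ℝ).prod (volume.restrict (Ioi (0 : ℝ))), 0 < z.2 := by
    rw [← restrict_halfPlane]
    filter_upwards [ae_restrict_mem isOpen_halfPlane.measurableSet] with z hz using hz.2
  filter_upwards [h.eqn, h0] with z hz hz0
  rw [hz, hc _ hz0, hd _ hz0]

theorem continuous_coeffC (h : IsRegularSolution p c d g gt gx gxx) (hp : IsWeight p) :
    Continuous (coeffC M Mc τ g) := by
  have := h.continuous_alpha hp
  unfold coeffC; fun_prop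

theorem continuous_coeffD (h : IsRegularSolution p c d g gt gx gxx) (hp : IsWeight p) :
    Continuous (coeffD M Mc g) :=
  (continuous_diffusion M Mc).comp (h.continuous_alpha hp)

/-- Positivity and mass conservation need `d ≥ 0`; `d ≥ 0` needs `α ∈ [0, 1]`; and this follows from
positivity and mass since `g ≤ g/p`. The continuation argument breaks the circle. -/
theorem density
    (h : IsRegularSolution p (coeffC M Mc τ g) (coeffD M Mc g) g gt gx gxx) (hp : IsWeight p)
    (hM : 1 < M) (hMc : Mc ∈ Ioo 1 M) (h0 : ∀ᵐ x, 0 ≤ g x 0)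
    (hi : Integrable fun x => g x 0 / p x) (hmass : ∫ x, g x 0 / p x = 1) {t : ℝ} (ht : 0 ≤ t) :
    (∀ᵐ x, 0 ≤ g x t) ∧ (Integrable fun x => g x t / p x) ∧ ∫ x, g x t / p x = 1 ∧
      alpha g t ∈ Icc (0 : ℝ) 1 := by
  have key : ∀ T : ℝ, 0 ≤ T → (∀ r ∈ Ioo 0 T, 0 ≤ diffusion M Mc (alpha g r)) →
      (∀ᵐ x, 0 ≤ g x T) ∧ (Integrable fun x => g x T / p x) ∧ ∫ x, g x T / p x = 1 ∧
      alpha g T ∈ Icc (0 : ℝ) 1 := by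
    intro T hT hd
    have hnn : ∀ r ∈ Icc 0 T, ∀ᵐ x, 0 ≤ g x r := fun r hr =>
      h.nonneg_of_initial hp hr.1 (fun s hs => hd s ⟨hs.1, hs.2.trans_le hr.2⟩) h0
    obtain ⟨m1, m2⟩ := h.mass hp (h.continuous_coeffC hp) (h.continuous_coeffD hp) hT hnn hi
    have hnT := hnn T ⟨hT, le_rfl⟩
    rw [hmass] at m2
    refine ⟨hnT, m1, m2, integral_nonneg_of_ae hnT, ?_⟩
    rw [alpha, ← m2]
    refine integral_mono_ae (h.integrable_slice hp T) m1 ?_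
    filter_upwards [hnT] with x hx
    exact le_div_self hx (hp.pos x) (hp.le_one x)
  have hα : ∀ r, 0 ≤ r → alpha g r ∈ Icc (0 : ℝ) 1 := fun r hr =>
    mem_Icc_of_continuation (h.continuous_alpha hp) (continuous_diffusion M Mc)
      (fun y hy => diffusion_pos hM hMc hy)
      (fun T hT hd s hs => (key s hs.1 fun r hr => hd r ⟨hr.1, hr.2.trans_le hs.2⟩).2.2.2) hr
  exact key t ht fun r hr => (diffusion_pos hM hMc (hα r hr.1.le)).le

/-! ### Sorting -/

/-- Otherwise `∫ gₓ² ≥ ε` at almost every time, and with `d ≥ δ` the square entropy would lose more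
than its initial value `E`. -/
theorem exists_time_le (h : IsRegularSolution p c d g gt gx gxx) (hp : IsWeight p) {δ : ℝ}
    (hδ : 0 < δ) (hd : ∀ t, 0 ≤ t → δ ≤ d t) {k : ℝ} (hk : 0 < k) :
    ∃ t, 0 < t ∧ ∀ᵐ x, g x t ≤ k := by
  set E := ∫ x, g x 0 ^ 2 / p x with hE
  have hE0 : 0 ≤ E := integral_nonneg fun x => div_nonneg (sq_nonneg _) (hp.pos x).le
  -- In `2 |H K| ≤ η H² + K²/η`, this `η` gives `η E ≤ k²/2`, and `ε` is chosen so that `ε/η =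
  -- k²/2`.
  set η := k ^ 2 / (2 * (E + 1)) with hη
  have hη0 : 0 < η := by positivity
  set ε := η * k ^ 2 / 2 with hε
  have hε0 : 0 < ε := by positivity
  by_contra! hcon
  have low : ∀ᵐ t ∂volume.restrict (Ioi (0 : ℝ)), ε ≤ ∫ x, gx x t ^ 2 := by
    filter_upwards [h.ae_isSlice, ae_restrict_mem measurableSet_Ioi] with t ⟨H, K, hsl, hH, hK, _⟩
      ht
    by_contra! hlt
    refine hcon t ht ?_
    have e1 : ∫ x, K x ^ 2 < ε := by
      rwa [integral_congr_ae (g := fun x => gx x t ^ 2) (by filter_upwards [hK] with x hx; rw [hx])]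
    have e2 : ∫ x, H x ^ 2 ≤ E := by
      refine le_trans ?_ (h.entropy_antitone hp isEntropy_sq (fun _ => by norm_num) le_rfl
        (le_of_lt ht) fun r hr => hδ.le.trans (hd r hr.1.le))
      refine integral_mono_ae (hsl.integrable_sq hp) ((h.entropy_pairing hp isEntropy_sq).1 t) ?_
      filter_upwards [hH] with x hx
      simp only [hx]
      exact le_div_self (sq_nonneg _) (hp.pos x) (hp.le_one x)
    have e3 : 2 * ∫ x, |H x * K x| ≤ k ^ 2 := by
      calc 2 * ∫ x, |H x * K x| = ∫ x, 2 * |H x * K x| := (integral_const_mul _ _).symm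
        _ ≤ ∫ x, (η * H x ^ 2 + η⁻¹ * K x ^ 2) := by
            refine integral_mono ((hsl.integrable_mul_deriv hp).abs.const_mul 2)
              (((hsl.integrable_sq hp).const_mul η).add
                (hsl.integrable_deriv_sq.const_mul η⁻¹)) fun x => ?_
            have hs := Real.sqrt_pos.2 hη0
            have es := Real.sq_sqrt hη0.le
            set r := Real.sqrt η
            simp only [abs_mul]
            rw [← es, ← sq_abs (H x), ← sq_abs (K x)]
            have e4 : (r ^ 2)⁻¹ * |K x| ^ 2 = (|K x| / r) ^ 2 := by field_simp
            have e5 : |H x| * |K x| = (r * |H x|) * (|K x| / r) := by field_simp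
            rw [e4, e5]
            nlinarith [sq_nonneg (r * |H x| - |K x| / r)]
        _ = η * (∫ x, H x ^ 2) + η⁻¹ * ∫ x, K x ^ 2 := by
            rw [integral_add ((hsl.integrable_sq hp).const_mul η)
              (hsl.integrable_deriv_sq.const_mul η⁻¹), integral_const_mul, integral_const_mul]
        _ ≤ η * E + η⁻¹ * ε := by gcongr
        _ ≤ k ^ 2 := by
            have a1 : η⁻¹ * ε = k ^ 2 / 2 := by rw [hε]; field_simp
            have a2 : η * E ≤ k ^ 2 / 2 := by
              rw [hη, div_mul_eq_mul_div, div_le_div_iff₀ (by positivity) (by norm_num)]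
              nlinarith [sq_nonneg k]
            linarith
    filter_upwards [hH] with x hx
    rw [← hx]
    exact not_lt.2 (le_of_sq_le_sq ((hsl.sq_le hp x).trans e3) hk.le)
  -- By this time the dissipation is at least `E + 1`, more than the available `E`.
  set T := (E + 1) / (2 * δ * ε) with hT
  have hT0 : 0 < T := by positivity
  obtain ⟨hint, heq⟩ := (h.entropy_pairing hp isEntropy_sq).2 0 T le_rfl hT0.le
  have b1 : ∫ r in (0 : ℝ)..T, 2 * δ * ε ≤
      ∫ r in (0 : ℝ)..T, d r * ∫ x, (2 : ℝ) * gx x r ^ 2 := by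
    refine intervalIntegral.integral_mono_ae_restrict hT0.le (by simp) hint ?_
    rw [← restrict_Ioo_eq_restrict_Icc]
    filter_upwards [ae_restrict_of_ae_restrict_of_subset Ioo_subset_Ioi_self low,
      ae_restrict_mem measurableSet_Ioo] with r hr hr'
    rw [integral_const_mul]
    have := hd r hr'.1.le
    calc 2 * δ * ε = δ * (2 * ε) := by ring
      _ ≤ d r * (2 * ∫ x, gx x r ^ 2) := by gcongr; exact hδ.le.trans this
  have b2 : 0 ≤ ∫ x, g x T ^ 2 / p x := integral_nonneg fun x =>
    div_nonneg (sq_nonneg _) (hp.pos x).le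
  rw [intervalIntegral.integral_const, sub_zero, smul_eq_mul] at b1
  have b3 : T * (2 * δ * ε) = E + 1 := by rw [hT]; field_simp
  linarith

theorem eventually_le (h : IsRegularSolution p c d g gt gx gxx) (hp : IsWeight p) {δ : ℝ}
    (hδ : 0 < δ) (hd : ∀ t, 0 ≤ t → δ ≤ d t) {k : ℝ} (hk : 0 < k) :
    ∀ᶠ t in atTop, ∀ᵐ x, g x t ≤ k := by
  obtain ⟨s, hs, hsk⟩ := h.exists_time_le hp hδ hd hk
  filter_upwards [eventually_ge_atTop s] with t ht
  exact h.le_of_le hp hk.le hs.le ht (fun r hr => hδ.le.trans (hd r (hs.le.trans hr.1.le))) hsk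

theorem exists_uniform_bound (h : IsRegularSolution p c d g gt gx gxx) (hp : IsWeight p)
    (hd : ∀ t, 0 ≤ t → 0 ≤ d t) : ∃ B, 0 ≤ B ∧ ∀ t, 0 ≤ t → ∀ᵐ x, g x t ≤ B := by
  obtain ⟨B, -, hB⟩ := h.exists_bound hp one_pos
  refine ⟨max B 0, le_max_right _ _, fun t ht => h.le_of_le hp (le_max_right _ _) le_rfl ht
    (fun r hr => hd r hr.1.le) ?_⟩
  filter_upwards [hB] with x hx
  exact (le_abs_self _).trans (hx.trans (le_max_left _ _))

end IsRegularSolution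

/-- Since `p f = g`, the integrand is `(1 - p)^{1/4} g^{7/4}`; drop the first factor and split
`g^{7/4} = g^{3/4} g`. -/
theorem sortingDensity_le {p : ℝ → ℝ} (hp : IsWeight p) {f : ℝ → ℝ → ℝ} {t x y k : ℝ}
    (hf : f x t = y / p x) (hy : 0 ≤ y) (hyk : y ≤ k) :
    0 ≤ sortingDensity p f t x ∧ sortingDensity p f t x ≤ k ^ (3 / 4 : ℝ) * y := by
  have h0 := hp.pos x
  have h1 : 0 ≤ 1 - p x := by linarith [hp.le_one x]
  have hfy : 0 ≤ f x t := by rw [hf]; positivity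
  refine ⟨by unfold sortingDensity; positivity, ?_⟩
  have e1 : p x ^ (7 / 4 : ℝ) * f x t ^ (7 / 4 : ℝ) = y ^ (7 / 4 : ℝ) := by
    rw [← Real.mul_rpow h0.le hfy, hf, mul_div_cancel₀ _ h0.ne']
  have e2 : y ^ (7 / 4 : ℝ) = y ^ (3 / 4 : ℝ) * y := by
    rcases hy.eq_or_lt with rfl | hy'
    · rw [Real.zero_rpow (by norm_num)]; simp
    · nth_rewrite 3 [← Real.rpow_one y]
      rw [← Real.rpow_add hy']; norm_num
  have e3 : (1 - p x) ^ (1 / 4 : ℝ) ≤ 1 :=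
    Real.rpow_le_one h1 (by linarith) (by norm_num)
  calc sortingDensity p f t x
      = (p x ^ (7 / 4 : ℝ) * f x t ^ (7 / 4 : ℝ)) * (1 - p x) ^ (1 / 4 : ℝ) := by
        unfold sortingDensity; ring
    _ ≤ (p x ^ (7 / 4 : ℝ) * f x t ^ (7 / 4 : ℝ)) * 1 := by gcongr
    _ = y ^ (3 / 4 : ℝ) * y := by rw [mul_one, e1, e2]
    _ ≤ k ^ (3 / 4 : ℝ) * y := by gcongr

/-! ### Aggregate learning -/

/-- A continuous function which does not increase while it is larger than `B` stays below `B`. -/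
theorem le_of_barrier {a : ℝ → ℝ} (ha : Continuous a) {B t₁ : ℝ} (h1 : a t₁ ≤ B)
    (hdec : ∀ s t, t₁ ≤ s → s ≤ t → (∀ r ∈ Ioc s t, B < a r) → a t ≤ a s) {t : ℝ} (ht : t₁ ≤ t) :
    a t ≤ B := by
  set S := Icc t₁ t ∩ {r | a r ≤ B} with hS
  have hSc : IsCompact S := isCompact_Icc.inter_right (isClosed_le ha continuous_const)
  have hSne : S.Nonempty := ⟨t₁, ⟨le_rfl, ht⟩, h1⟩
  have hs := hSc.sSup_mem hSne
  refine (hdec (sSup S) t hs.1.1 hs.1.2 fun r hr => ?_).trans hs.2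
  by_contra! hrB
  -- `sSup S` is the last time up to `t` at which `a ≤ B`; after it `a > B`, so `hdec` applies.
  exact not_lt.2 (le_csSup hSc.bddAbove ⟨⟨hs.1.1.trans hr.1.le, hr.2⟩, hrB⟩) hr.1

/-- A nonnegative continuous function dominated by its dissipation tends to zero. -/
theorem tendsto_zero_of_dissipation {y : ℝ → ℝ} (hy : Continuous y) (h0 : ∀ t, 0 ≤ t → 0 ≤ y t)
    {η : ℝ} (hη : 0 < η)
    (hdec : ∀ s t, 0 ≤ s → s ≤ t → y t ≤ y s - η * ∫ r in s..t, y r) :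
    Tendsto y atTop (𝓝 0) := by
  have anti : ∀ s t, 0 ≤ s → s ≤ t → y t ≤ y s := fun s t hs hst => by
    have h1 := hdec s t hs hst
    have h2 : 0 ≤ ∫ r in s..t, y r :=
      intervalIntegral.integral_nonneg hst fun r hr => h0 r (hs.trans hr.1)
    nlinarith
  -- As `y` does not increase, `t y(t) ≤ ∫₀ᵗ y ≤ y(0)/η`, which gives decay like `1/t`.
  have key : ∀ t, 0 < t → y t ≤ y 0 / η * t⁻¹ := fun t ht => by
    have h1 := hdec 0 t le_rfl ht.le
    have h2 : ∫ r in (0 : ℝ)..t, y t ≤ ∫ r in (0 : ℝ)..t, y r :=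
      intervalIntegral.integral_mono_on ht.le (by simp) (hy.intervalIntegrable _ _)
        fun r hr => anti r t hr.1 hr.2
    rw [intervalIntegral.integral_const, sub_zero, smul_eq_mul] at h2
    have h3 := h0 t ht.le
    rw [← div_eq_mul_inv, div_div, le_div_iff₀ (by positivity)]
    nlinarith
  have lim : Tendsto (fun t : ℝ => y 0 / η * t⁻¹) atTop (𝓝 0) := by
    simpa using tendsto_inv_atTop_zero.const_mul (y 0 / η)
  refine squeeze_zero' ?_ ?_ lim
  · filter_upwards [eventually_ge_atTop 0] with t ht using h0 t ht
  · filter_upwards [eventually_gt_atTop 0] with t ht using key t ht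

/-! ### Test functions available when `p` is bounded below -/

theorem isTest_exp {p : ℝ → ℝ} {pmin μ : ℝ} (hmin : 0 < pmin) (hp : ∀ x, pmin < p x)
    (hμ : |μ| ≤ 1) :
    IsTest p (fun x => Real.exp (μ * x)) (fun x => μ * Real.exp (μ * x))
      (fun x => μ ^ 2 * Real.exp (μ * x)) where
  hasDerivAt x := by
    have := ((hasDerivAt_id x).const_mul μ).exp
    convert! this using 1
    simp; ring
  hasDerivAt' x := by
    have := (((hasDerivAt_id x).const_mul μ).exp).const_mul μ
    convert! this using 1
    simp; ring
  continuous := by fun_prop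
  bound := by
    have hs := Real.sqrt_pos.2 hmin
    have key : ∀ x, Real.exp (μ * x) ≤ (Real.sqrt pmin)⁻¹ * (Real.exp |x| * Real.sqrt (p x)) := by
      intro x
      have h1 : Real.exp (μ * x) ≤ Real.exp |x| := by
        refine Real.exp_le_exp.2 ((le_abs_self _).trans ?_)
        rw [abs_mul]
        exact mul_le_of_le_one_left (abs_nonneg x) hμ
      have h2 : Real.sqrt pmin ≤ Real.sqrt (p x) := Real.sqrt_le_sqrt (hp x).le
      rw [inv_mul_eq_div, le_div_iff₀ hs]
      gcongr
    refine ⟨(Real.sqrt pmin)⁻¹, fun x => ⟨?_, ?_, ?_⟩⟩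
    · rw [abs_of_pos (Real.exp_pos _)]; exact key x
    · rw [abs_mul, abs_of_pos (Real.exp_pos _)]
      exact (mul_le_of_le_one_left (Real.exp_pos _).le hμ).trans (key x)
    · rw [abs_mul, abs_of_pos (Real.exp_pos _), abs_pow]
      exact (mul_le_of_le_one_left (Real.exp_pos _).le
        (pow_le_one₀ (abs_nonneg _) hμ)).trans (key x)

theorem IsEntryProbability.isWeight {p : ℝ → ℝ} {pmin cp : ℝ} (h : IsEntryProbability p pmin cp) :
    IsWeight p :=
  ⟨h.contDiff.continuous, fun x => h.pmin_nonneg.trans_lt (h.mem_Ioc x).1, fun x => (h.mem_Ioc x).2⟩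

theorem IsEntryProbability.monotone {p : ℝ → ℝ} {pmin cp : ℝ} (h : IsEntryProbability p pmin cp) :
    Monotone p :=
  monotone_of_deriv_nonneg (h.contDiff.differentiable (by norm_num)) h.deriv_nonneg

theorem IsEntryProbability.isTest {p : ℝ → ℝ} {pmin cp : ℝ} (h : IsEntryProbability p pmin cp)
    (hmin : 0 < pmin) : IsTest p p (deriv p) (deriv (deriv p)) := by
  have h1 : ContDiff ℝ 1 (deriv p) := ((contDiff_succ_iff_deriv (n := 1)).1 h.contDiff).2.2
  have h2 : Continuous (deriv (deriv p)) := h1.continuous_deriv le_rfl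
  have hs := Real.sqrt_pos.2 hmin
  have key : ∀ x y : ℝ, |y| ≤ 1 + cp →
      |y| ≤ (1 + cp) * (Real.sqrt pmin)⁻¹ * (Real.exp |x| * Real.sqrt (p x)) := by
    intro x y hy
    have h3 : 1 ≤ Real.exp |x| := Real.one_le_exp (abs_nonneg x)
    have h4 : Real.sqrt pmin ≤ Real.sqrt (p x) := Real.sqrt_le_sqrt (h.mem_Ioc x).1.le
    have h5 : 1 ≤ (Real.sqrt pmin)⁻¹ * (Real.exp |x| * Real.sqrt (p x)) := by
      rw [inv_mul_eq_div, le_div_iff₀ hs]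
      nlinarith
    have := h.cp_pos
    rw [mul_assoc]
    nlinarith
  have hcp := h.cp_pos
  have hpx : ∀ x, 0 < p x := h.isWeight.pos
  have b : ∀ x, cp * (1 - p x) ≤ 1 + cp := fun x => by nlinarith [hpx x]
  refine ⟨fun x => (h.contDiff.differentiable (by norm_num) x).hasDerivAt,
    fun x => (h1.differentiable one_ne_zero x).hasDerivAt, h2, _, fun x =>
    ⟨key x _ ?_, key x _ ?_, key x _ ?_⟩⟩
  · rw [abs_of_pos (hpx x)]; linarith [(h.mem_Ioc x).2]
  · rw [abs_of_nonneg (h.deriv_nonneg x)]; exact (h.deriv_le x).trans (b x)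
  · exact (h.abs_deriv2_le x).trans (b x)

namespace IsRegularSolution

variable {p c d : ℝ → ℝ} {g gt gx gxx : ℝ → ℝ → ℝ} {M Mc τ pmin cp : ℝ}

/-- The moment has time derivative `(d μ² + c μ) ∫ e^{μx} g`, at most `-η ∫ e^{μx} g`, and `g ≥ pmin
(g/p)` bounds this by `-η pmin` times the moment itself. -/
theorem tendsto_exp_moment (h : IsRegularSolution p c d g gt gx gxx) (hp : IsWeight p)
    (hmin : 0 < pmin) (hpmin : ∀ x, pmin < p x) (hnn : ∀ t, 0 ≤ t → ∀ᵐ x, 0 ≤ g x t) {μ η : ℝ}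
    (hμ : |μ| ≤ 1) (hη : 0 < η) (hcd : ∀ t, 0 ≤ t → d t * μ ^ 2 + c t * μ ≤ -η) :
    Tendsto (fun t => ∫ x, Real.exp (μ * x) * g x t / p x) atTop (𝓝 0) := by
  have hT := isTest_exp hmin hpmin hμ
  obtain ⟨C, hC⟩ := hT.bound
  have hy := h.continuous_weight_pairing hp hT.continuous₀.measurable fun x => (hC x).1
  have hint := (h.weight_pairing hp hT.continuous₀.measurable fun x => (hC x).1).1
  refine tendsto_zero_of_dissipation hy (fun t ht => integral_nonneg_of_ae ?_)
    (mul_pos hη hmin) fun s t hs hst => ?_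
  · filter_upwards [hnn t ht] with x hx
    exact div_nonneg (mul_nonneg (Real.exp_pos _).le hx) (hp.pos x).le
  · obtain ⟨i1, e1⟩ := h.pairing_sub hp hT hs hst
    have le : ∫ r in s..t, (d r * (∫ x, μ ^ 2 * Real.exp (μ * x) * g x r) +
        c r * ∫ x, μ * Real.exp (μ * x) * g x r) ≤
        ∫ r in s..t, -(η * pmin) * ∫ x, Real.exp (μ * x) * g x r / p x := by
      refine intervalIntegral.integral_mono_on hst i1 ((hy.intervalIntegrable _ _).const_mul _)
        fun r hr => ?_
      have hr0 := hs.trans hr.1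
      simp only [mul_assoc, integral_const_mul]
      have b0 : 0 ≤ ∫ x, Real.exp (μ * x) * g x r := integral_nonneg_of_ae (by
        filter_upwards [hnn r hr0] with x hx
        exact mul_nonneg (Real.exp_pos _).le hx)
      have b1 : pmin * (∫ x, Real.exp (μ * x) * g x r / p x) ≤ ∫ x, Real.exp (μ * x) * g x r := by
        rw [← integral_const_mul]
        have i2 : Integrable fun x => Real.exp (μ * x) * g x r := by
          have := (hint r).bdd_mul (c := 1) (f := p) hp.continuous.aestronglyMeasurable
            (Eventually.of_forall fun x => by
              rw [Real.norm_of_nonneg (hp.pos x).le]; exact hp.le_one x)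
          refine this.congr (Eventually.of_forall fun x => ?_)
          have := hp.pos x
          simp only
          field_simp
        refine integral_mono_ae ((hint r).const_mul _) i2 ?_
        filter_upwards [hnn r hr0] with x hx
        rw [← mul_div_assoc, div_le_iff₀ (hp.pos x), mul_comm]
        exact mul_le_mul_of_nonneg_left (hpmin x).le (mul_nonneg (Real.exp_pos _).le hx)
      have b2 := hcd r hr0
      set Y := ∫ x, Real.exp (μ * x) * g x r
      calc d r * (μ ^ 2 * Y) + c r * (μ * Y) = (d r * μ ^ 2 + c r * μ) * Y := by ring
        _ ≤ -η * Y := mul_le_mul_of_nonneg_right b2 b0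
        _ ≤ _ := by nlinarith
    rw [intervalIntegral.integral_const_mul] at le
    linarith

/-- While `|a|` is bounded below, the drift carries all the mass to infinity, so that `a` changes
sign. -/
theorem exists_abs_deviation_le
    (h : IsRegularSolution p (coeffC M Mc τ g) (coeffD M Mc g) g gt gx gxx)
    (hp : IsEntryProbability p pmin cp) (hmin : 0 < pmin) (hM : 1 < M) (hMc : Mc ∈ Ioo 1 M)
    (hτ : 0 < τ) (hnn : ∀ t, 0 ≤ t → ∀ᵐ x, 0 ≤ g x t)
    (hint : ∀ t, 0 ≤ t → Integrable fun x => g x t / p x)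
    (hmass : ∀ t, 0 ≤ t → ∫ x, g x t / p x = 1) (hα : ∀ t, 0 ≤ t → alpha g t ∈ Icc (0 : ℝ) 1)
    (hlow : ∃ x, p x < kappa M Mc) (hupp : ∃ x, kappa M Mc < p x) {B : ℝ} (hB : 0 < B) :
    ∃ t, 0 ≤ t ∧ |kappa M Mc - alpha g t| ≤ B := by
  by_contra! hcon
  have hw := hp.isWeight
  have hM1 : 0 < M - 1 := by linarith
  have hsτ := Real.sqrt_pos.2 hτ
  have hαc := h.continuous_alpha hw
  have hac : Continuous fun t => kappa M Mc - alpha g t := continuous_const.sub hαc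
  obtain ⟨δ, D, hδ, hD⟩ := exists_diffusion_bounds hM hMc
  have hD0 : 0 < D := by
    have := hD 0 ⟨le_rfl, zero_le_one⟩
    linarith [this.1, this.2]
  have hdD : ∀ t, 0 ≤ t → 0 ≤ coeffD M Mc g t ∧ coeffD M Mc g t ≤ D := fun t ht => by
    rw [coeffD_eq]
    have := hD _ (hα t ht)
    exact ⟨hδ.le.trans this.1, this.2⟩
  set c₀ := (M - 1) * B / Real.sqrt τ with hc₀
  have hc₀0 : 0 < c₀ := by positivity
  -- The rate is at most `1` so that the exponential is an admissible test function, and small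
  -- enough that diffusion `D l²` uses at most half of the drift `c₀ l`.
  set l := min 1 (c₀ / (2 * D)) with hl
  have hl0 : 0 < l := lt_min one_pos (by positivity)
  have hl1 : l ≤ 1 := min_le_left _ _
  have hlD : D * l ≤ c₀ / 2 := by
    have : l ≤ c₀ / (2 * D) := min_le_right _ _
    rw [le_div_iff₀ (by positivity)] at this
    linarith
  have decay : ∀ σ : ℝ, |σ| = 1 → (∀ t, 0 ≤ t → B ≤ σ * (kappa M Mc - alpha g t)) →
      Tendsto (fun t => ∫ x, Real.exp (-(σ * l) * x) * g x t / p x) atTop (𝓝 0) := by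
    intro σ hσ hσB
    have hσ2 : σ ^ 2 = 1 := by rw [← sq_abs, hσ]; norm_num
    refine h.tendsto_exp_moment hw hmin (fun x => (hp.mem_Ioc x).1) hnn
      (η := l * (c₀ / 2)) ?_ (by positivity) fun t ht => ?_
    · rw [abs_neg, abs_mul, hσ, abs_of_pos hl0, one_mul]; exact hl1
    · have b1 : c₀ ≤ σ * coeffC M Mc τ g t := by
        rw [hc₀, coeffC, mul_div_assoc', div_le_div_iff_of_pos_right hsτ]
        nlinarith [hσB t ht]
      have b2 := hdD t ht
      have e : (-(σ * l)) ^ 2 = l ^ 2 := by rw [neg_sq, mul_pow, hσ2, one_mul]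
      rw [e]
      have b3 : coeffD M Mc g t * l ^ 2 ≤ l * (c₀ / 2) := by
        calc coeffD M Mc g t * l ^ 2 ≤ D * l ^ 2 := by gcongr; exact b2.2
          _ = l * (D * l) := by ring
          _ ≤ _ := by gcongr
      nlinarith
  have momint : ∀ σ : ℝ, |σ| = 1 → ∀ t, Integrable fun x =>
      Real.exp (-(σ * l) * x) * g x t / p x := fun σ hσ t => by
    have hT := isTest_exp hmin (fun x => (hp.mem_Ioc x).1) (μ := -(σ * l))
      (by rw [abs_neg, abs_mul, hσ, abs_of_pos hl0, one_mul]; exact hl1)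
    obtain ⟨C, hC⟩ := hT.bound
    exact (h.weight_pairing hw hT.continuous₀.measurable fun x => (hC x).1).1 t
  -- A change of sign would produce a zero, by the intermediate value theorem.
  have sgn : (∀ t, 0 ≤ t → B < kappa M Mc - alpha g t) ∨
      ∀ t, 0 ≤ t → kappa M Mc - alpha g t < -B := by
    by_contra! hc
    obtain ⟨⟨t, ht, h1⟩, s, hs, h2⟩ := hc
    have h1' : kappa M Mc - alpha g t < -B := by
      rcases lt_abs.1 (hcon t ht) with h | h <;> linarith
    have h2' : B < kappa M Mc - alpha g s := by
      rcases lt_abs.1 (hcon s hs) with h | h <;> linarith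
    obtain ⟨r, hr, hr0⟩ := isPreconnected_Ici.intermediate_value (s := Ici (0 : ℝ)) ht hs
      hac.continuousOn (show (0 : ℝ) ∈ Icc _ _ from ⟨by linarith, by linarith⟩)
    have := hcon r hr
    simp only [hr0, abs_zero] at this
    linarith
  rcases sgn with hpos | hneg
  · obtain ⟨x₁, hx₁⟩ := hupp
    have lim := decay 1 (by simp) fun t ht => by linarith [hpos t ht]
    -- Integrates `p x ≥ p x₁ - p x₁ e^{l (x₁ - x)}` against `f`: monotonicity gives it to the right
    -- of `x₁`, and to the left the right side is nonpositive. As the moment vanishes, `α` ends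
    -- above `κ`, a contradiction.
    have low : ∀ t, 0 ≤ t → p x₁ - p x₁ * Real.exp (l * x₁) *
        (∫ x, Real.exp (-(1 * l) * x) * g x t / p x) ≤ alpha g t := by
      intro t ht
      have e0 : p x₁ - p x₁ * Real.exp (l * x₁) * (∫ x, Real.exp (-(1 * l) * x) * g x t / p x) =
          ∫ x, (p x₁ * (g x t / p x) -
            p x₁ * Real.exp (l * x₁) * (Real.exp (-(1 * l) * x) * g x t / p x)) := by
        rw [integral_sub ((hint t ht).const_mul _) ((momint 1 (by simp) t).const_mul _),
          integral_const_mul, integral_const_mul, hmass t ht, mul_one]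
      rw [e0]
      refine integral_mono_ae (((hint t ht).const_mul _).sub
        ((momint 1 (by simp) t).const_mul _)) (h.integrable_slice hw t) ?_
      filter_upwards [hnn t ht] with x hx
      have h0 := hw.pos x
      have h1 := hw.pos x₁
      have e : Real.exp (l * x₁) * Real.exp (-(1 * l) * x) = Real.exp (l * (x₁ - x)) := by
        rw [← Real.exp_add]; ring_nf
      have key : p x₁ - p x₁ * Real.exp (l * (x₁ - x)) ≤ p x := by
        rcases le_total x₁ x with hxx | hxx
        · have := hp.monotone hxx
          have := mul_pos h1 (Real.exp_pos (l * (x₁ - x)))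
          linarith
        · have : 1 ≤ Real.exp (l * (x₁ - x)) :=
            Real.one_le_exp (mul_nonneg hl0.le (by linarith))
          nlinarith
      calc p x₁ * (g x t / p x) - p x₁ * Real.exp (l * x₁) * (Real.exp (-(1 * l) * x) * g x t / p x)
          = (p x₁ - p x₁ * (Real.exp (l * x₁) * Real.exp (-(1 * l) * x))) * (g x t / p x) := by ring
        _ ≤ p x * (g x t / p x) := by
            rw [e]
            exact mul_le_mul_of_nonneg_right key (div_nonneg hx h0.le)
        _ = g x t := mul_div_cancel₀ _ h0.ne'
    have lim2 := (lim.const_mul (p x₁ * Real.exp (l * x₁))).const_sub (p x₁)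
    rw [mul_zero, sub_zero] at lim2
    obtain ⟨t, ht, ht0⟩ := ((lim2.eventually (lt_mem_nhds hx₁)).and (eventually_ge_atTop 0)).exists
    linarith [low t ht0, hpos t ht0]
  · obtain ⟨x₀, hx₀⟩ := hlow
    have lim := decay (-1) (by simp) fun t ht => by linarith [hneg t ht]
    -- The mirror estimate `p x ≤ p x₀ + e^{l (x - x₀)}`, where `p ≤ 1` handles the right of `x₀`.
    have upp : ∀ t, 0 ≤ t → alpha g t ≤ p x₀ + Real.exp (-(l * x₀)) *
        (∫ x, Real.exp (-(-1 * l) * x) * g x t / p x) := by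
      intro t ht
      have e0 : p x₀ + Real.exp (-(l * x₀)) * (∫ x, Real.exp (-(-1 * l) * x) * g x t / p x) =
          ∫ x, (p x₀ * (g x t / p x) +
            Real.exp (-(l * x₀)) * (Real.exp (-(-1 * l) * x) * g x t / p x)) := by
        rw [integral_add ((hint t ht).const_mul _) ((momint (-1) (by simp) t).const_mul _),
          integral_const_mul, integral_const_mul, hmass t ht, mul_one]
      rw [e0]
      refine integral_mono_ae (h.integrable_slice hw t) (((hint t ht).const_mul _).add
        ((momint (-1) (by simp) t).const_mul _)) ?_
      filter_upwards [hnn t ht] with x hx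
      have h0 := hw.pos x
      have h1 := hw.pos x₀
      have e : Real.exp (-(l * x₀)) * Real.exp (-(-1 * l) * x) = Real.exp (l * (x - x₀)) := by
        rw [← Real.exp_add]; ring_nf
      have key : p x ≤ p x₀ + Real.exp (l * (x - x₀)) := by
        rcases le_total x x₀ with hxx | hxx
        · have := hp.monotone hxx
          have := Real.exp_pos (l * (x - x₀))
          linarith
        · have : 1 ≤ Real.exp (l * (x - x₀)) :=
            Real.one_le_exp (mul_nonneg hl0.le (by linarith))
          linarith [hw.le_one x]
      calc g x t = p x * (g x t / p x) := (mul_div_cancel₀ _ h0.ne').symm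
        _ ≤ (p x₀ + Real.exp (-(l * x₀)) * Real.exp (-(-1 * l) * x)) * (g x t / p x) := by
            rw [e]
            exact mul_le_mul_of_nonneg_right key (div_nonneg hx h0.le)
        _ = _ := by ring
    have lim2 := (lim.const_mul (Real.exp (-(l * x₀)))).const_add (p x₀)
    rw [mul_zero, add_zero] at lim2
    obtain ⟨t, ht, ht0⟩ := ((lim2.eventually (gt_mem_nhds hx₀)).and (eventually_ge_atTop 0)).exists
    linarith [upp t ht0, hneg t ht0]

end IsRegularSolution

/-! ### Trapping of the deviation near zero -/

namespace IsRegularSolution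

variable {p : ℝ → ℝ} {g gt gx gxx : ℝ → ℝ → ℝ} {M Mc τ pmin cp : ℝ}

/-- For large deviations the drift dominates the diffusion. -/
theorem mul_coeffD_le (hM : 1 < M) (hMc : Mc ∈ Ioo 1 M) (hτ : 0 < τ) (hcp : 0 < cp)
    (hsmall : 4 * (1 + cp) * Real.sqrt τ * (M - 1) < 1) {σ r : ℝ} (hσ : |σ| = 1)
    (hα : alpha g r ∈ Icc (0 : ℝ) 1)
    (hB : Real.sqrt τ * (1 + cp) < σ * (kappa M Mc - alpha g r)) :
    cp * coeffD M Mc g r ≤ σ * coeffC M Mc τ g r := by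
  have hk := kappa_mem hM hMc
  have hs := Real.sqrt_pos.2 hτ
  unfold coeffD coeffC
  set m := M - 1
  set s := Real.sqrt τ
  set y := alpha g r
  have hm : 0 < m := by simp only [m]; linarith
  have hσ2 : σ ^ 2 = 1 := by rw [← sq_abs, hσ]; norm_num
  set A := σ * (kappa M Mc - y) with hA
  have hA2 : (kappa M Mc - y) ^ 2 = A ^ 2 := by rw [hA, mul_pow, hσ2, one_mul]
  have hA0 : 0 < A := lt_trans (by positivity) hB
  have hA1 : A ≤ 1 := by
    have h1 : A ≤ |A| := le_abs_self A
    rw [hA, abs_mul, hσ, one_mul, ← hA] at h1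
    exact h1.trans (abs_le.2 ⟨by linarith [hk.1, hα.2], by linarith [hk.2, hα.1]⟩)
  have hb : y * (1 - y) ≤ 1 / 4 := by nlinarith [sq_nonneg (y - 1 / 2)]
  rw [hA2, show σ * (m * (kappa M Mc - y) / s) = m * A / s by rw [hA]; ring, le_div_iff₀ hs]
  have e : cp * (m ^ 2 / 2 * (A ^ 2 + 1 / m * (y * (1 - y)))) * s =
      m * (cp * s * m / 2 * A ^ 2 + cp * s / 2 * (y * (1 - y))) := by field_simp
  rw [e]
  refine mul_le_mul_of_nonneg_left ?_ hm.le
  -- After the common factor `m` is removed, the target is a sum of two terms at most `A`; the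
  -- bounds `A² ≤ A` and `y (1 - y) ≤ 1/4` make each at most `A/8`.
  have h1 : cp * s * m ≤ 1 / 4 := by nlinarith [mul_pos hs hm]
  have h2 : cp * s ≤ A := by nlinarith
  have h3 : A ^ 2 ≤ A := by nlinarith
  have h4 : cp * s / 2 * (y * (1 - y)) ≤ cp * s / 2 * (1 / 4) :=
    mul_le_mul_of_nonneg_left hb (by positivity)
  have h5 : cp * s * m / 2 * A ^ 2 ≤ 1 / 4 / 2 * A := by gcongr
  linarith

/-- Testing with `p` gives `α' = d ∫ p'' g + c ∫ p' g`. Since `|p''| ≤ c_p p'`, the first integral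
is at most `c_p ∫ p' g` in absolute value, so `σ c ≥ c_p d` fixes the sign of `σ α'`. -/
theorem deviation_antitone
    (h : IsRegularSolution p (coeffC M Mc τ g) (coeffD M Mc g) g gt gx gxx)
    (hp : IsEntryProbability p pmin cp) (hp2 : ∀ x, |deriv (deriv p) x| ≤ cp * deriv p x)
    (hmin : 0 < pmin) (hM : 1 < M) (hMc : Mc ∈ Ioo 1 M) (hτ : 0 < τ)
    (hnn : ∀ t, 0 ≤ t → ∀ᵐ x, 0 ≤ g x t) (hα : ∀ t, 0 ≤ t → alpha g t ∈ Icc (0 : ℝ) 1)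
    (hsmall : 4 * (1 + cp) * Real.sqrt τ * (M - 1) < 1) {σ : ℝ} (hσ : |σ| = 1) {s t : ℝ}
    (hs : 0 ≤ s) (hst : s ≤ t)
    (hB : ∀ r ∈ Ioc s t, Real.sqrt τ * (1 + cp) < σ * (kappa M Mc - alpha g r)) :
    σ * (kappa M Mc - alpha g t) ≤ σ * (kappa M Mc - alpha g s) := by
  have hw := hp.isWeight
  have hT := hp.isTest hmin
  obtain ⟨-, e1⟩ := h.pairing_sub hw hT hs hst
  have eα : ∀ r, ∫ x, p x * g x r / p x = alpha g r := fun r =>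
    integral_congr_ae (Eventually.of_forall fun x => mul_div_cancel_left₀ _ (hw.pos x).ne')
  rw [eα, eα] at e1
  have pos : 0 ≤ ∫ r in s..t, σ * (coeffD M Mc g r * (∫ x, deriv (deriv p) x * g x r) +
      coeffC M Mc τ g r * ∫ x, deriv p x * g x r) := by
    rw [intervalIntegral.integral_of_le hst]
    refine setIntegral_nonneg measurableSet_Ioc fun r hr => ?_
    have hr0 : 0 ≤ r := hs.trans hr.1.le
    have hcd := mul_coeffD_le hM hMc hτ hp.cp_pos hsmall hσ (hα r hr0) (hB r hr)
    have hd : 0 ≤ coeffD M Mc g r := (diffusion_pos hM hMc (hα r hr0)).le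
    have iQ : Integrable fun x => deriv p x * g x r :=
      (h.integrable_slice hw r).bdd_mul (c := cp) hT.continuous₁.aestronglyMeasurable
        (Eventually.of_forall fun x => by
          rw [Real.norm_of_nonneg (hp.deriv_nonneg x)]
          refine (hp.deriv_le x).trans (mul_le_of_le_one_right hp.cp_pos.le ?_)
          linarith [hw.pos x])
    have hQ : |∫ x, deriv (deriv p) x * g x r| ≤ cp * ∫ x, deriv p x * g x r := by
      rw [← integral_const_mul]
      refine abs_integral_le_integral_abs.trans (integral_mono_of_nonneg
        (Eventually.of_forall fun x => abs_nonneg _) (iQ.const_mul cp) ?_)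
      filter_upwards [hnn r hr0] with x hx
      rw [abs_mul, abs_of_nonneg hx, ← mul_assoc]
      exact mul_le_mul_of_nonneg_right (hp2 x) hx
    have hQ0 : 0 ≤ ∫ x, deriv p x * g x r := integral_nonneg_of_ae (by
      filter_upwards [hnn r hr0] with x hx
      exact mul_nonneg (hp.deriv_nonneg x) hx)
    set Q := ∫ x, deriv p x * g x r
    set P := ∫ x, deriv (deriv p) x * g x r
    have h1 : -(cp * Q) ≤ σ * P := by
      have := neg_abs_le (σ * P)
      rw [abs_mul, hσ, one_mul] at this
      linarith
    calc 0 ≤ (σ * coeffC M Mc τ g r - cp * coeffD M Mc g r) * Q :=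
          mul_nonneg (by linarith) hQ0
      _ = coeffD M Mc g r * -(cp * Q) + σ * coeffC M Mc τ g r * Q := by ring
      _ ≤ coeffD M Mc g r * (σ * P) + σ * coeffC M Mc τ g r * Q := by gcongr
      _ = _ := by ring
  rw [intervalIntegral.integral_const_mul, ← e1] at pos
  linarith

/-- One time with `|a| ≤ B` exists by the escape-of-mass argument; the barrier lemma, applied to `a`
and to `-a`, keeps the bound from then on. -/
theorem eventually_abs_deviation_le
    (h : IsRegularSolution p (coeffC M Mc τ g) (coeffD M Mc g) g gt gx gxx)
    (hp : IsEntryProbability p pmin cp) (hp2 : ∀ x, |deriv (deriv p) x| ≤ cp * deriv p x)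
    (hmin : 0 < pmin) (hM : 1 < M) (hMc : Mc ∈ Ioo 1 M) (hτ : 0 < τ)
    (hnn : ∀ t, 0 ≤ t → ∀ᵐ x, 0 ≤ g x t)
    (hint : ∀ t, 0 ≤ t → Integrable fun x => g x t / p x)
    (hmass : ∀ t, 0 ≤ t → ∫ x, g x t / p x = 1) (hα : ∀ t, 0 ≤ t → alpha g t ∈ Icc (0 : ℝ) 1)
    (hlow : ∃ x, p x < kappa M Mc) (hupp : ∃ x, kappa M Mc < p x)
    (hsmall : 4 * (1 + cp) * Real.sqrt τ * (M - 1) < 1) :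
    ∀ᶠ t in atTop, |kappa M Mc - alpha g t| ≤ Real.sqrt τ * (1 + cp) := by
  have hB : 0 < Real.sqrt τ * (1 + cp) :=
    mul_pos (Real.sqrt_pos.2 hτ) (by linarith [hp.cp_pos])
  obtain ⟨t₁, h1, h2⟩ := h.exists_abs_deviation_le hp hmin hM hMc hτ hnn hint hmass hα hlow hupp hB
  have hαc := h.continuous_alpha hp.isWeight
  have key : ∀ σ : ℝ, |σ| = 1 → ∀ t, t₁ ≤ t →
      σ * (kappa M Mc - alpha g t) ≤ Real.sqrt τ * (1 + cp) := fun σ hσ t ht => by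
    refine le_of_barrier (a := fun t => σ * (kappa M Mc - alpha g t)) (by fun_prop) (t₁ := t₁) ?_
      (fun s t hs hst hr => h.deviation_antitone hp hp2 hmin hM hMc hτ hnn hα hsmall hσ
        (h1.trans hs) hst hr) ht
    refine (le_abs_self _).trans ?_
    rwa [abs_mul, hσ, one_mul]
  filter_upwards [eventually_ge_atTop t₁] with t ht
  have k1 := key 1 (by simp) t ht
  have k2 := key (-1) (by simp) t ht
  exact abs_le.2 ⟨by linarith, by linarith⟩

end IsRegularSolution

theorem kappa_mem_Ioo {M Mc : ℝ} (hM : 1 < M) (hMc : Mc ∈ Ioo 1 M) :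
    kappa M Mc ∈ Ioo ((Mc - 1) / M) (Mc / M) := by
  have h1 : 0 < M - 1 := by linarith
  have h2 : 0 < M := by linarith
  rw [kappa]
  constructor
  · exact div_lt_div_of_pos_left (by linarith [hMc.1]) h1 (by linarith)
  · rw [div_lt_div_iff₀ h1 h2]
    nlinarith [hMc.2]

theorem le_learningBound {cp pmin τ : ℝ} (hcp : 0 < cp) (hmin : 0 < pmin) (h1 : pmin ≤ 1) :
    Real.sqrt τ * (1 + cp) ≤ learningBound 2 cp pmin τ := by
  have h2 : pmin ^ 4 ≤ 1 := pow_le_one₀ hmin.le h1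
  have h3 : 1 + cp ≤ cHat 2 cp / pmin ^ 4 := by
    rw [le_div_iff₀ (by positivity), cHat]
    nlinarith
  rw [learningBound, mul_comm]
  exact mul_le_mul_of_nonneg_right h3 (Real.sqrt_nonneg τ)

end MarketEntry

end

/-! ### Proof of the theorem -/

open MarketEntry
theorem mainTheorem2 :
    ∃ C₀ : ℝ, 1 < C₀ ∧
      ∀ (M Mc τ : ℝ) (p : ℝ → ℝ) (pmin cp : ℝ) (g₀ : ℝ → ℝ) (g f : ℝ → ℝ → ℝ),
        1 < M → Mc ∈ Ioo 1 M → 0 < τ →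
        IsEntryProbability p pmin cp →
        (∀ x, |deriv (deriv p) x| ≤ cp * deriv p x) →
        IsInitialDatum p g₀ →
        IsStrongSolution M Mc τ p g₀ g →
        (∀ x t, f x t = g x t / p x) →
        -- the integrals below are meaningful
        ((∀ t, 0 ≤ t → (∀ᵐ x, 0 ≤ f x t) ∧ Integrable (fun x => f x t) ∧ ∫ x, f x t = 1 ∧
            Integrable (sortingDensity p f t)) ∧
        -- (i) sorting
        Tendsto (fun t => ∫ x, sortingDensity p f t x) atTop (𝓝 0) ∧
        IsSorting f ∧
        -- (ii) aggregate learning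
        (0 < pmin → (∃ x, p x < kappa M Mc) → (∃ x, kappa M Mc < p x) →
          cHat C₀ cp * Real.sqrt τ * (M - 1) < pmin ^ 4 →
          limsup (fun t => ((|deviation M Mc p f t| : ℝ) : EReal)) atTop
              ≤ (learningBound C₀ cp pmin τ : EReal) ∧
          kappa M Mc ∈ Ioo ((Mc - 1) / M) (Mc / M) ∧
          (kappa M Mc - learningBound C₀ cp pmin τ ∈ Ioo ((Mc - 1) / M) (Mc / M) →
            kappa M Mc + learningBound C₀ cp pmin τ ∈ Ioo ((Mc - 1) / M) (Mc / M) →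
            IsAggregateLearning M Mc p f ∧
            ∀ᶠ t in atTop, meanEntry p f t ∈ Ioo ((Mc - 1) / M) (Mc / M)))) := by
  -- With `C₀ = 2` the constant `ĉ_p` is `4 (1 + c_p)`, exactly the one in the smallness condition
  -- for the drift to dominate.
  refine ⟨2, by norm_num, fun M Mc τ p pmin cp g₀ g f hM hMc hτ hp hp2 h0 hsol hf => ?_⟩
  have hw := hp.isWeight
  obtain ⟨G, Gt, Gx, Gxx, hreg', hGg⟩ := hsol.exists_regular hw.continuous hw.pos hw.le_one h0
  have eα : ∀ t, 0 ≤ t → alpha g t = alpha G t := fun t ht =>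
    integral_congr_ae ((hGg t ht).mono fun x hx => hx.symm)
  -- The coefficients built from `g` are those built from `G` at positive times, so the equation
  -- becomes self-contained in `G`.
  have hreg : IsRegularSolution p (coeffC M Mc τ G) (coeffD M Mc G) G Gt Gx Gxx :=
    hreg'.congr_coeff (fun t ht => by simp only [coeffC, eα t ht.le])
      (fun t ht => by simp only [coeffD, eα t ht.le])
  have hG0 : ∀ᵐ x, G x 0 = g₀ x := by
    filter_upwards [hGg 0 le_rfl, hsol.2.1] with x h1 h2
    rw [h1, h2]
  have hG0p : (fun x => g₀ x / p x) =ᵐ[volume] fun x => G x 0 / p x := by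
    filter_upwards [hG0] with x hx
    rw [hx]
  have hG0i : Integrable fun x => G x 0 / p x :=
    -- A nonintegrable function would have Bochner integral zero, so the unit mass already contains
    -- integrability.
    (integrable_of_integral_eq_one h0.mass).congr hG0p
  have hG0m : ∫ x, G x 0 / p x = 1 := by rw [← integral_congr_ae hG0p, h0.mass]
  have hG0n : ∀ᵐ x, 0 ≤ G x 0 := by
    filter_upwards [hG0, h0.nonneg] with x h1 h2
    rwa [h1]
  have dens := fun {t : ℝ} (ht : 0 ≤ t) => hreg.density hw hM hMc hG0n hG0i hG0m ht
  have hfG : ∀ t, 0 ≤ t → ∀ᵐ x, f x t = G x t / p x := fun t ht => by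
    filter_upwards [hGg t ht] with x hx
    rw [hf, hx]
  obtain ⟨δ, D, hδ, hD⟩ := exists_diffusion_bounds hM hMc
  have hd : ∀ t, 0 ≤ t → δ ≤ coeffD M Mc G t := fun t ht => (hD _ (dens ht).2.2.2).1
  have sd_bound : ∀ t, 0 ≤ t → ∀ k, (∀ᵐ x, G x t ≤ k) → ∀ᵐ x,
      0 ≤ sortingDensity p f t x ∧ sortingDensity p f t x ≤ k ^ (3 / 4 : ℝ) * G x t := by
    intro t ht k hk
    filter_upwards [hfG t ht, (dens ht).1, hk] with x h1 h2 h3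
    exact sortingDensity_le hw h1 h2 h3
  refine ⟨fun t ht => ?_, ?_, fun R hR => ?_, fun hmin hlow hupp hsm => ?_⟩
  · obtain ⟨d1, d2, d3, -⟩ := dens ht
    have e := hfG t ht
    refine ⟨?_, d2.congr (e.mono fun x hx => hx.symm), by rw [integral_congr_ae e, d3], ?_⟩
    · filter_upwards [e, d1] with x h1 h2
      rw [h1]
      exact div_nonneg h2 (hw.pos x).le
    · obtain ⟨B, -, hB⟩ := hreg.exists_uniform_bound hw fun t ht => hδ.le.trans (hd t ht)
      refine ((hreg.integrable_slice hw t).const_mul (B ^ (3 / 4 : ℝ))).mono' ?_ ?_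
      · have hpm := hw.continuous.measurable
        have hfm : AEMeasurable (fun x => f x t) volume :=
          (d2.1.aemeasurable).congr (e.mono fun x hx => hx.symm)
        exact (((hpm.pow_const _).mul ((measurable_const.sub hpm).pow_const _)).aemeasurable.mul
          (hfm.pow_const _)).aestronglyMeasurable
      · filter_upwards [sd_bound t ht B (hB t ht)] with x hx
        rw [Real.norm_of_nonneg hx.1]
        exact hx.2
  · rw [Metric.tendsto_nhds]
    intro ε hε
    -- The level whose power `3/4` is `ε / 2`; the remaining factor is `∫ g ≤ 1`.
    have hk : 0 < (ε / 2) ^ (4 / 3 : ℝ) := by positivity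
    filter_upwards [hreg.eventually_le hw hδ hd hk, eventually_ge_atTop 0] with t h1 ht
    have hb := sd_bound t ht _ h1
    have n0 : 0 ≤ ∫ x, sortingDensity p f t x := integral_nonneg_of_ae (hb.mono fun x hx => hx.1)
    rw [dist_zero_right, Real.norm_of_nonneg n0]
    have e1 : ((ε / 2) ^ (4 / 3 : ℝ)) ^ (3 / 4 : ℝ) = ε / 2 := by
      rw [← Real.rpow_mul (by positivity)]
      norm_num
    calc ∫ x, sortingDensity p f t x
        ≤ ∫ x, ((ε / 2) ^ (4 / 3 : ℝ)) ^ (3 / 4 : ℝ) * G x t :=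
          integral_mono_of_nonneg (hb.mono fun x hx => hx.1)
            ((hreg.integrable_slice hw t).const_mul _) (hb.mono fun x hx => hx.2)
      _ = ε / 2 * alpha G t := by rw [integral_const_mul, e1]; rfl
      _ ≤ ε / 2 * 1 := by gcongr; exact (dens ht).2.2.2.2
      _ < ε := by linarith
  · rw [Metric.tendsto_nhds]
    intro ε hε
    have hm := hw.pos (-R)
    -- On `(-R, R]` one has `f ≤ k / p(-R)` by monotonicity of `p`, and this `k` makes the integral
    -- at most `ε / 2`.
    set k := ε * p (-R) / (4 * R) with hk
    have hk0 : 0 < k := by positivity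
    filter_upwards [hreg.eventually_le hw hδ hd hk0, eventually_ge_atTop 0] with t h1 ht
    have hb : ∀ᵐ x, x ∈ Ioc (-R) R → ‖f x t‖ ≤ k / p (-R) := by
      filter_upwards [hfG t ht, (dens ht).1, h1] with x a1 a2 a3 hx
      have hpx := hw.pos x
      have hmono : p (-R) ≤ p x := hp.monotone hx.1.le
      rw [a1, Real.norm_of_nonneg (by positivity)]
      gcongr
    have h2 := intervalIntegral.norm_integral_le_of_norm_le_const_ae (a := -R) (b := R)
      (f := fun x => f x t) (C := k / p (-R)) (by
        rw [uIoc_of_le (by linarith)]; exact hb)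
    rw [dist_zero_right]
    refine h2.trans_lt ?_
    rw [abs_of_pos (by linarith), hk]
    have : ε * p (-R) / (4 * R) / p (-R) * (R - -R) = ε / 2 := by field_simp; ring
    rw [this]
    linarith
  · have h1 : pmin ≤ 1 := (hp.mem_Ioc 0).1.le.trans (hp.mem_Ioc 0).2
    -- The assumption is stronger than needed here: only `pmin ^ 4 ≤ 1` is used.
    have hsmall : 4 * (1 + cp) * Real.sqrt τ * (M - 1) < 1 := by
      have h2 : pmin ^ 4 ≤ 1 := pow_le_one₀ hmin.le h1
      have h3 : cHat 2 cp = 4 * (1 + cp) := by rw [cHat]; ring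
      rw [h3] at hsm
      linarith
    have ev := hreg.eventually_abs_deviation_le hp hp2 hmin hM hMc hτ (fun t ht => (dens ht).1)
      (fun t ht => (dens ht).2.1) (fun t ht => (dens ht).2.2.1) (fun t ht => (dens ht).2.2.2)
      hlow hupp hsmall
    have hL := le_learningBound (τ := τ) hp.cp_pos hmin h1
    have emean : ∀ t, 0 ≤ t → meanEntry p f t = alpha G t := fun t ht => by
      refine integral_congr_ae ?_
      filter_upwards [hfG t ht] with x hx
      rw [hx, mul_div_cancel₀ _ (hw.pos x).ne']
    have edev : ∀ t, 0 ≤ t → deviation M Mc p f t = kappa M Mc - alpha G t := fun t ht => by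
      have e : ∀ᵐ x, (kappa M Mc - p x) * f x t = kappa M Mc * (G x t / p x) - G x t := by
        filter_upwards [hfG t ht] with x hx
        rw [hx, sub_mul, mul_div_cancel₀ _ (hw.pos x).ne']
      rw [deviation, integral_congr_ae e,
        integral_sub ((dens ht).2.1.const_mul _) (hreg.integrable_slice hw t),
        integral_const_mul, (dens ht).2.2.1, mul_one]
      rfl
    refine ⟨?_, kappa_mem_Ioo hM hMc, fun hl hu => ?_⟩
    · refine limsup_le_of_le (h := ?_)
      filter_upwards [ev, eventually_ge_atTop 0] with t h2 ht
      rw [edev t ht]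
      exact EReal.coe_le_coe_iff.2 (h2.trans hL)
    · have mem : ∀ᶠ t in atTop, meanEntry p f t ∈ Ioo ((Mc - 1) / M) (Mc / M) := by
        filter_upwards [ev, eventually_ge_atTop 0] with t h2 ht
        rw [emean t ht]
        have h3 := abs_le.1 (h2.trans hL)
        exact ⟨by linarith [hl.1, h3.2], by linarith [hu.2, h3.1]⟩
      refine ⟨⟨?_, ?_⟩, mem⟩
      · refine le_liminf_of_le (h := ?_)
        filter_upwards [mem] with t ht
        exact EReal.coe_le_coe_iff.2 ht.1.le
      · refine limsup_le_of_le (h := ?_)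
        filter_upwards [mem] with t ht
        exact EReal.coe_le_coe_iff.2 ht.2.le
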